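/- Let $d\ge 1$ and $\hbar>0$. Let $\widehat H_\hbar=\sum_{j=1}^d\big(-\tfrac{\hbar^2}{2}\partial_{x_j}^2+\tfrac{x_j^2}{2}\big)$ be the isotropic harmonic oscillator on $L^2(\mathbb R^d)$ and, for $N=0,1,2,\dots$, let $E_N=E_N(\hbar)=\hbar(N+\tfrac d2)$. Let $\Pi_{\hbar,E_N}$ be the orthogonal projection of $L^2(\mathbb R^d)$ onto the eigenspace $\{\psi\in L^2(\mathbb R^d):\widehat H_\hbar\psi=E_N\psi\}$ (equation in the sense of distributions). It has a continuous kernel $\Pi_{\hbar,E_N}(x,y)$, and the integrals defining the Wigner distributions $$W_{\hbar,E_N}(x,\xi)=\int_{\mathbb R^d}\Pi_{\hbar,E_N}\big(x+\tfrac v2,x-\tfrac v2\big)\,e^{-\frac i\hbar v\cdot\xi}\,\frac{dv}{(2\pi\hbar)^d},\qquad (x,\xi)\in\mathbb R^d\times\mathbb R^d,$$ converge absolutely and are real-valued. For $(x,\xi)\in\mathbb R^d\times\mathbb R^d$ consider the signed (Radon) measure $\mu_\hbar^{(x,\xi)}=\sum_{N=0}^\infty W_{\hbar,E_N}(x,\xi)\,\delta_{E_N}$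 on $\mathbb R$, with total variation $|\mu_\hbar^{(x,\xi)}|$ (the supremum of $\sum_{B\in P}|\mu_\hbar^{(x,\xi)}(B)|$ over finite families $P$ of disjoint bounded Borel subsets). Then: 1. For every $(x,\xi)$, $|\mu_\hbar^{(x,\xi)}|(\mathbb R)=\infty$. 2. For every $(x,\xi)$ and every $\tau\in\mathbb R$, $|\mu_\hbar^{(x,\xi)}|\big((-\infty,\tau]\big)<\infty$. 3. The total integral of the normalized measure $(2\pi\hbar)^d\mu_\hbar^{(x,\xi)}$ equals $1$ for all $(x,\xi)$, in the following senses. (a) For every $(x,\xi)$ and every Schwartz function $\chi$ on $\mathbb R$, the series $\int\chi(\varepsilon\tau)\,d\mu_\hbar^{(x,\xi)}(\tau)=\sum_N\chi(\varepsilon E_N)W_{\hbar,E_N}(x,\xi)$ converges absolutely for all $\varepsilon>0$, and $$\lim_{\varepsilon\to0^+}(2\pi\hbar)^d\int_{\mathbb R}\chi(\varepsilon\tau)\,d\mu_\hbar^{(x,\xi)}(\tau)=\chi(0).$$ In particular the limit is $1$ for every cut-off $\chi$ with $\chi(0)=1$. (b) $(2\pi\hbar)^d\sum_{N=0}^\infty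 W_{\hbar,E_N}=1$ as tempered distributions on $\mathbb R^d\times\mathbb R^d$: for every Schwartz function $\varphi$, each $W_{\hbar,E_N}\varphi$ is integrable and $(2\pi\hbar)^d\sum_{N<M}\int W_{\hbar,E_N}\varphi\,dx\,d\xi\to\int\varphi\,dx\,d\xi$ as $M\to\infty$. (c) If $d=1$ and $(x,\xi)\ne(0,0)$, then also $\lim_{\tau\to\infty}(2\pi\hbar)^d\mu_\hbar^{(x,\xi)}\big((-\infty,\tau]\big)=1$. -/

import Mathlib

open MeasureTheory Filter Topology Set
open scoped ENNReal SchwartzMap Laplacian InnerProductSpace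

noncomputable section

namespace IsotropicOscillator

/-- The configuration space `ℝ^d` with its Euclidean norm. -/
abbrev Space (d : ℕ) : Type := EuclideanSpace ℝ (Fin d)

/-- The Hilbert space `L²(ℝ^d, dx)` of complex-valued functions. -/
abbrev L2 (d : ℕ) : Type := Lp ℂ 2 (volume : Measure (Space d))

/-- The isotropic harmonic oscillator `∑ⱼ (-(ħ²/2) ∂²/∂xⱼ² + xⱼ²/2) = -(ħ²/2) Δ + |x|²/2`,
acting on tempered distributions. -/
def hamiltonian (d : ℕ) (ħ : ℝ) : 𝓢'(Space d, ℂ) →L[ℂ] 𝓢'(Space d, ℂ) :=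
  (-((ħ : ℂ) ^ 2 / 2)) • LineDeriv.laplacianCLM ℂ (Space d) 𝓢'(Space d, ℂ) +
    TemperedDistribution.smulLeftCLM ℂ (fun x : Space d => ((‖x‖ ^ 2 / 2 : ℝ) : ℂ))

/-- The eigenvalues `E_N(ħ) = ħ (N + d/2)`. -/
def energy (d : ℕ) (ħ : ℝ) (N : ℕ) : ℝ := ħ * ((N : ℝ) + (d : ℝ) / 2)

/-- The space `{ψ ∈ L²(ℝ^d) : Ĥ ψ = E ψ}`, the equation being understood in the sense of
(tempered) distributions. -/
def eigenspace (d : ℕ) (ħ E : ℝ) : Submodule ℂ (L2 d) :=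
  LinearMap.ker
    ((hamiltonian d ħ - (E : ℂ) • ContinuousLinearMap.id ℂ 𝓢'(Space d, ℂ)).comp
      (Lp.toTemperedDistributionCLM ℂ (volume : Measure (Space d)) 2)).toLinearMap

/-- Unfolded form: `ψ ∈ L²` lies in the eigenspace iff
`∫ (-(ħ²/2) Δφ + (|x|²/2) φ) ψ dx = E ∫ φ ψ dx` for all Schwartz functions `φ`. -/
theorem mem_eigenspace_iff (d : ℕ) (ħ E : ℝ) (ψ : L2 d) :
    ψ ∈ eigenspace d ħ E ↔ ∀ φ : 𝓢(Space d, ℂ),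
      -((ħ : ℂ) ^ 2 / 2) * (∫ x, Δ (φ : Space d → ℂ) x * ψ x) +
        ∫ x, ((‖x‖ ^ 2 / 2 : ℝ) : ℂ) * φ x * ψ x = (E : ℂ) * ∫ x, φ x * ψ x := by
  have hg : (fun x : Space d => ((‖x‖ ^ 2 / 2 : ℝ) : ℂ)).HasTemperateGrowth := by
    simp only [div_eq_mul_inv]
    fun_prop
  have h : ψ ∈ eigenspace d ħ E ↔
      hamiltonian d ħ (ψ : 𝓢'(Space d, ℂ)) = (E : ℂ) • (ψ : 𝓢'(Space d, ℂ)) := by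
    simp only [eigenspace, LinearMap.mem_ker]
    rw [← sub_eq_zero (b := (E : ℂ) • (ψ : 𝓢'(Space d, ℂ)))]
    rfl
  rw [h]
  have e : ∀ φ : 𝓢(Space d, ℂ), hamiltonian d ħ (ψ : 𝓢'(Space d, ℂ)) φ =
      -((ħ : ℂ) ^ 2 / 2) * (∫ x, Δ (φ : Space d → ℂ) x * ψ x) +
        ∫ x, ((‖x‖ ^ 2 / 2 : ℝ) : ℂ) * φ x * ψ x := by
    intro φ
    change (-((ħ : ℂ) ^ 2 / 2)) • (LineDeriv.laplacianCLM ℂ (Space d) 𝓢'(Space d, ℂ)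
      (ψ : 𝓢'(Space d, ℂ))) φ + (TemperedDistribution.smulLeftCLM ℂ
        (fun x : Space d => ((‖x‖ ^ 2 / 2 : ℝ) : ℂ)) (ψ : 𝓢'(Space d, ℂ))) φ = _
    rw [TemperedDistribution.laplacianCLM_apply, TemperedDistribution.laplacian_apply_apply,
      TemperedDistribution.smulLeftCLM_apply_apply, Lp.toTemperedDistribution_apply,
      Lp.toTemperedDistribution_apply]
    simp only [smul_eq_mul, SchwartzMap.smulLeftCLM_apply_apply hg, SchwartzMap.laplacian_apply]
  constructor
  · intro H φ
    rw [← e φ, H]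
    change (E : ℂ) • (ψ : 𝓢'(Space d, ℂ)) φ = _
    rw [Lp.toTemperedDistribution_apply]
    simp
  · intro H
    ext φ
    rw [e φ, H φ]
    change _ = (E : ℂ) • (ψ : 𝓢'(Space d, ℂ)) φ
    rw [Lp.toTemperedDistribution_apply]
    simp

/-- The eigenspaces are closed, so that the orthogonal projection onto them exists. -/
instance (d : ℕ) (ħ E : ℝ) : CompleteSpace (eigenspace d ħ E) := by
  have h : IsClosed (eigenspace d ħ E : Set (L2 d)) :=
    ContinuousLinearMap.isClosed_ker
      ((hamiltonian d ħ - (E : ℂ) • ContinuousLinearMap.id ℂ 𝓢'(Space d, ℂ)).comp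
        (Lp.toTemperedDistributionCLM ℂ (volume : Measure (Space d)) 2))
  exact h.completeSpace_coe

/-- The orthogonal projection `Π_{ħ, E_N(ħ)}` of `L²(ℝ^d)` onto the eigenspace of `E_N(ħ)`. -/
def spectralProjection (d : ℕ) (ħ : ℝ) (N : ℕ) : L2 d →L[ℂ] L2 d :=
  (eigenspace d ħ (energy d ħ N)).starProjection

/-- `K` is a continuous Schwartz kernel of the operator `T`:
`(T f)(x) = ∫ K(x, y) f(y) dy` for all test functions `f ∈ C_c^∞(ℝ^d)`.
There is at most one such `K`. -/
def IsContinuousKernel {d : ℕ} (T : L2 d →L[ℂ] L2 d) (K : Space d → Space d → ℂ) : Prop :=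
  Continuous (fun p : Space d × Space d => K p.1 p.2) ∧
    ∀ f : 𝓢(Space d, ℂ), HasCompactSupport (f : Space d → ℂ) →
      (T (f.toLp 2 volume) : Space d → ℂ) =ᵐ[volume] fun x => ∫ y, K x y * f y

/-- The kernel `Π_{ħ, E_N(ħ)}(x, y)`: the continuous Schwartz kernel of the projection. -/
def projectionKernel (d : ℕ) (ħ : ℝ) (N : ℕ) : Space d → Space d → ℂ :=
  Classical.epsilon (IsContinuousKernel (spectralProjection d ħ N))

/-- The semiclassical Wigner transform of a kernel,
`(2πħ)^{-d} ∫ K(x + v/2, x - v/2) e^{-(i/ħ) v·ξ} dv`. -/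
def wignerTransform {d : ℕ} (ħ : ℝ) (K : Space d → Space d → ℂ) (x ξ : Space d) : ℂ :=
  ((2 * Real.pi * ħ : ℝ) : ℂ)⁻¹ ^ d *
    ∫ v : Space d, K (x + (1 / 2 : ℝ) • v) (x - (1 / 2 : ℝ) • v) *
      Complex.exp (-(Complex.I / (ħ : ℂ)) * ((⟪v, ξ⟫_ℝ : ℝ) : ℂ))

/-- The Wigner distribution `W_{ħ, E_N(ħ)}(x, ξ)` of the `N`-th eigenspace projection. -/
def wigner (d : ℕ) (ħ : ℝ) (N : ℕ) (x ξ : Space d) : ℂ :=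
  wignerTransform ħ (projectionKernel d ħ N) x ξ

/-- The empirical measure `μ_ħ^{(x,ξ)} = ∑_N W_{ħ, E_N(ħ)}(x, ξ) δ_{E_N(ħ)}`, as a set function:
`μ(B) = ∑_{N : E_N(ħ) ∈ B} W_{ħ, E_N(ħ)}(x, ξ)`. The sum is finite for every `B` that is bounded
above; the definition is only used for such sets. -/
def empiricalMeasure (d : ℕ) (ħ : ℝ) (x ξ : Space d) (B : Set ℝ) : ℂ :=
  ∑ᶠ (N : ℕ) (_ : energy d ħ N ∈ B), wigner d ħ N x ξ

/-- The total variation `|m|(A)` of a (real or complex) Radon measure `m` on `ℝ`, given by its values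
on bounded Borel sets: the supremum of `∑_{B ∈ P} |m(B)|` over all finite families `P` of pairwise
disjoint bounded Borel subsets of `A`. -/
def totalVariation (m : Set ℝ → ℂ) (A : Set ℝ) : ℝ≥0∞ :=
  ⨆ (P : Finset (Set ℝ))
    (_ : ∀ B ∈ P, MeasurableSet B ∧ Bornology.IsBounded B ∧ B ⊆ A)
    (_ : (P : Set (Set ℝ)).PairwiseDisjoint id), ∑ B ∈ P, ‖m B‖ₑ

end IsotropicOscillator

end

/-! Everything is read off from one generating function. Put s = (|x|² + |ξ|²)/ħ. The numbers (πħ)^d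
W_N(x, ξ) are the Taylor coefficients at 0 of F(t) = (1 + t)^(-d) exp(-s (1 - t)/(1 + t)) on the
unit disc (`wigner_eq`, `hasDiscSum_wignerCoeff`). Indeed the product Hermite functions are total in
L², so those of degree N span the eigenspace and give its kernel
(`spectralProjection_eq_hermiteProj`); the Wigner transform factorizes over the coordinates; and for
a single Hermite function ladder identities turn it into a Laguerre function
(`integral_crossWigner_self`).

The Cayley transform maps the disc to the right half-plane, so the exponential is bounded by 1, and
the only singular point of F on the closed disc is t = -1. The normalized total integral ought to be
2^d F(1) = 1; the claims differ in how the series at t = 1 is summed.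

Absolute summability would make F bounded, but F blows up along a horocycle at -1
(`not_summable_coeff_wignerGen`). On a half-line only finitely many terms occur, so the variation
there is finite.

Multiplying F by (1 + t)^(4 + d) removes enough of the singularity to make the coefficients
summable, with sum given by Abel's theorem (`hasSum_addShift_wignerGen`). The factors 1 + t are then
divided out one by one. For Schwartz cut-offs this is summation by parts, where each finite
difference of the cut-off gains a power of ε (`CutoffSum.of_addShift`). For ordinary partial sums it
requires the coefficients to tend to zero, which holds for d = 1 and s > 0 by an energy and virial
argument for the Laguerre recurrence (`tendsto_zero_of_recurrence`).

Against a test function φ on phase space, W_N is a weak eigenfunction, with eigenvalue N + d/2, of a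
second order operator that can be moved onto φ (`wignerPairing_moyal`). The pairings therefore decay
rapidly, and Abel's theorem applies directly. -/

noncomputable section

namespace IsotropicOscillator

/-! ### Power series on the unit disc: Cauchy estimates, multiplication by 1 + t, Abel's theorem. -/

/-- `F` is the sum of the power series `∑ c n tⁿ` on the open unit disc. -/
def HasDiscSum (c : ℕ → ℂ) (F : ℂ → ℂ) : Prop :=
  ∀ t : ℂ, ‖t‖ < 1 → HasSum (fun n => c n * t ^ n) (F t)

namespace HasDiscSum

variable {c e : ℕ → ℂ} {F G : ℂ → ℂ}

theorem hasFPowerSeriesOnBall (h : HasDiscSum c F) :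
    HasFPowerSeriesOnBall F (FormalMultilinearSeries.ofScalars ℂ c) 0 1 where
  r_le := by
    refine ENNReal.le_of_forall_nnreal_lt fun r hr => ?_
    have hr' : (r : ℝ) < 1 := by exact_mod_cast hr
    have hs := (h (r : ℝ) (by simpa using hr')).summable.tendsto_atTop_zero.norm
    refine FormalMultilinearSeries.le_radius_of_tendsto (l := 0) _ ?_
    simpa [FormalMultilinearSeries.ofScalars_norm] using hs
  r_pos := one_pos
  hasSum := by
    intro y hy
    have hy' : ‖y‖ < 1 := by
      rw [Metric.mem_eball, edist_zero_right, ← ofReal_norm] at hy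
      simpa using (ENNReal.ofReal_lt_one).1 hy
    simpa [mul_comm] using h y hy'

theorem differentiableOn (h : HasDiscSum c F) : DifferentiableOn ℂ F (Metric.ball 0 1) := by
  have := h.hasFPowerSeriesOnBall.differentiableOn
  rwa [← ENNReal.ofReal_one, Metric.eball_ofReal] at this

theorem iteratedDeriv_eq (h : HasDiscSum c F) (n : ℕ) :
    iteratedDeriv n F 0 = n.factorial * c n := by
  have := h.hasFPowerSeriesOnBall.factorial_smul (1 : ℂ) n
  rw [iteratedDeriv_eq_iteratedFDeriv, ← this]
  simp

theorem coeff_eq (h : HasDiscSum c F) (n : ℕ) : c n = iteratedDeriv n F 0 / n.factorial := by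
  rw [h.iteratedDeriv_eq, mul_div_cancel_left₀ _ (by exact_mod_cast n.factorial_ne_zero)]

theorem unique (h : HasDiscSum c F) (h' : HasDiscSum e F) : c = e := by
  funext n
  rw [h.coeff_eq, h'.coeff_eq]

theorem of_differentiableOn (h : DifferentiableOn ℂ F (Metric.ball 0 1)) :
    HasDiscSum (fun n => iteratedDeriv n F 0 / n.factorial) F := by
  intro t ht
  have := Complex.hasSum_taylorSeries_on_ball (c := 0) (r := 1) (f := F) h
    (z := t) (by simpa using ht)
  simpa [smul_eq_mul, div_eq_inv_mul, mul_comm, mul_left_comm] using this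

theorem congr_sum (h : HasDiscSum c F) (hG : ∀ t : ℂ, ‖t‖ < 1 → F t = G t) : HasDiscSum c G :=
  fun t ht => hG t ht ▸ h t ht

theorem deriv_coeff {F' : ℂ → ℂ} (h : HasDiscSum c F)
    (hF : ∀ t : ℂ, ‖t‖ < 1 → HasDerivAt F (F' t) t) :
    HasDiscSum (fun n => (n + 1) * c (n + 1)) F' := by
  have h1 : DifferentiableOn ℂ (_root_.deriv F) (Metric.ball 0 1) :=
    h.differentiableOn.deriv Metric.isOpen_ball
  have h2 := (of_differentiableOn h1).congr_sum (G := F') fun t ht => (hF t ht).deriv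
  convert h2 using 2 with n
  rw [← iteratedDeriv_succ', h.iteratedDeriv_eq, Nat.factorial_succ]
  have : (n.factorial : ℂ) ≠ 0 := by exact_mod_cast n.factorial_ne_zero
  field_simp
  push_cast
  ring

theorem norm_coeff_le (h : HasDiscSum c F) {r B : ℝ} (hr : 0 < r) (hr1 : r < 1)
    (hB : ∀ t : ℂ, ‖t‖ = r → ‖F t‖ ≤ B) (n : ℕ) : ‖c n‖ ≤ B / r ^ n := by
  have hd : DiffContOnCl ℂ F (Metric.ball 0 r) :=
    (h.differentiableOn.mono (Metric.closedBall_subset_ball hr1)).diffContOnCl_ball le_rfl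
  have := Complex.norm_iteratedDeriv_le_of_forall_mem_sphere_norm_le n hr hd
    (C := B) (fun z hz => hB z (by simpa using hz))
  rw [h.iteratedDeriv_eq, norm_mul, Complex.norm_natCast, mul_div_assoc] at this
  exact le_of_mul_le_mul_left this (by exact_mod_cast n.factorial_pos)

theorem norm_coeff_le_of_bounded (h : HasDiscSum c F) {B : ℝ}
    (hB : ∀ t : ℂ, ‖t‖ < 1 → ‖F t‖ ≤ B) (n : ℕ) : ‖c n‖ ≤ B := by
  have h1 : Tendsto (fun r : ℝ => B / r ^ n) (𝓝[<] 1) (𝓝 (B / 1 ^ n)) := by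
    refine Tendsto.mono_left ?_ nhdsWithin_le_nhds
    exact tendsto_const_nhds.div (tendsto_id.pow n) (by simp)
  rw [one_pow, div_one] at h1
  refine ge_of_tendsto h1 ?_
  filter_upwards [Ioo_mem_nhdsLT (zero_lt_one (α := ℝ))] with r hr
  exact h.norm_coeff_le hr.1 hr.2 (fun t ht => hB t (ht ▸ hr.2)) n

theorem mul (h : HasDiscSum c F) (h' : HasDiscSum e G) :
    HasDiscSum (fun n => ∑ p ∈ Finset.HasAntidiagonal.antidiagonal n, c p.1 * e p.2) (fun t => F t * G t) := by
  intro t ht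
  have s1 := (h t ht).summable.norm
  have s2 := (h' t ht).summable.norm
  have h3 := tsum_mul_tsum_eq_tsum_sum_antidiagonal_of_summable_norm s1 s2
  rw [(h t ht).tsum_eq, (h' t ht).tsum_eq] at h3
  simp only [h3]
  have h4 := (summable_norm_sum_mul_antidiagonal_of_summable_norm s1 s2).of_norm.hasSum
  suffices h5 : ∀ n, (∑ p ∈ Finset.HasAntidiagonal.antidiagonal n, c p.1 * e p.2) * t ^ n =
      ∑ p ∈ Finset.HasAntidiagonal.antidiagonal n, c p.1 * t ^ p.1 * (e p.2 * t ^ p.2) by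
    simpa only [h5] using h4
  intro n
  rw [Finset.sum_mul]
  refine Finset.sum_congr rfl fun p hp => ?_
  rw [← Finset.HasAntidiagonal.mem_antidiagonal.1 hp, pow_add]
  ring

theorem const_mul (h : HasDiscSum c F) (k : ℂ) :
    HasDiscSum (fun n => k * c n) (fun t => k * F t) := fun t ht => by
  simpa [mul_assoc] using (h t ht).mul_left k

/-- Coefficients of `(1 + t) F(t)`. -/
def _root_.IsotropicOscillator.addShift (c : ℕ → ℂ) : ℕ → ℂ
  | 0 => c 0
  | n + 1 => c (n + 1) + c n

theorem one_add_mul (h : HasDiscSum c F) :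
    HasDiscSum (addShift c) (fun t => (1 + t) * F t) := by
  intro t ht
  have h1 := h t ht
  have h2 : HasSum (fun n => (match n with | 0 => 0 | k + 1 => c k * t ^ (k + 1) : ℂ))
      (t * F t) := by
    rw [← hasSum_nat_add_iff' 1]
    simpa [pow_succ, mul_comm, mul_left_comm] using h1.mul_left t
  convert h1.add h2 using 1
  · funext n
    cases n <;> simp [addShift, add_mul]
  · ring

theorem one_add_pow_mul (h : HasDiscSum c F) (k : ℕ) :
    HasDiscSum (addShift^[k] c) (fun t => (1 + t) ^ k * F t) := by
  induction k with
  | zero => simpa using h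
  | succ k ih =>
    rw [Function.iterate_succ_apply']
    convert ih.one_add_mul using 2 with t
    ring

/-- Abel's limit theorem for absolutely summable coefficients. -/
theorem hasSum_of_tendsto (h : HasDiscSum c F) (hc : Summable c) {L : ℂ}
    (hL : Tendsto (fun r : ℝ => F r) (𝓝[<] 1) (𝓝 L)) : HasSum c L := by
  have h1 : Tendsto (fun r : ℝ => ∑' n, c n * (r : ℂ) ^ n) (𝓝[<] 1) (𝓝 (∑' n, c n)) := by
    refine tendsto_tsum_of_dominated_convergence (bound := fun n => ‖c n‖) hc.norm ?_ ?_
    · intro n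
      have : Tendsto (fun r : ℝ => c n * (r : ℂ) ^ n) (𝓝 1) (𝓝 (c n * ((1 : ℝ) : ℂ) ^ n)) := by
        have : Continuous fun r : ℝ => c n * (r : ℂ) ^ n := by fun_prop
        exact this.tendsto 1
      simpa using this.mono_left nhdsWithin_le_nhds
    · filter_upwards [Ioo_mem_nhdsLT (zero_lt_one (α := ℝ))] with r hr n
      rw [norm_mul, norm_pow, Complex.norm_real, Real.norm_of_nonneg hr.1.le]
      exact mul_le_of_le_one_right (norm_nonneg _) (pow_le_one₀ hr.1.le hr.2.le)
  have h2 : Tendsto (fun r : ℝ => ∑' n, c n * (r : ℂ) ^ n) (𝓝[<] 1) (𝓝 L) := by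
    refine hL.congr' ?_
    filter_upwards [Ioo_mem_nhdsLT (zero_lt_one (α := ℝ))] with r hr
    exact (h r (by simpa [abs_of_pos hr.1] using hr.2)).tsum_eq.symm
  rw [tendsto_nhds_unique h2 h1]
  exact hc.hasSum

end HasDiscSum

/-! ### The generating function and the size of its coefficients. -/

theorem one_add_ne_zero {t : ℂ} (ht : ‖t‖ < 1) : 1 + t ≠ 0 := by
  intro h
  rw [eq_neg_of_add_eq_zero_right h] at ht
  simp at ht

theorem one_sub_norm_le {t : ℂ} : 1 - ‖t‖ ≤ ‖1 + t‖ := by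
  have := norm_sub_le_norm_add (1 : ℂ) t
  simpa using this

/-- The Cayley transform `(1 - t) / (1 + t)`. -/
def cayley (t : ℂ) : ℂ := (1 - t) / (1 + t)

/-- The Cayley transform maps the disc into the right half-plane. This is what bounds `expCayley s`
by 1 for s ≥ 0. -/
theorem cayley_re_nonneg {t : ℂ} (ht : ‖t‖ < 1) : 0 ≤ (cayley t).re := by
  have h1 : t.re ^ 2 + t.im ^ 2 < 1 := by
    have : ‖t‖ ^ 2 < 1 := by nlinarith [norm_nonneg t]
    rw [Complex.sq_norm, Complex.normSq_apply] at this
    nlinarith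
  rw [cayley, Complex.div_re, ← add_div]
  refine div_nonneg ?_ (Complex.normSq_nonneg _)
  simp
  nlinarith

/-- The factor `exp (-s (1 - t) / (1 + t))`. -/
def expCayley (s : ℝ) (t : ℂ) : ℂ := Complex.exp (-(s * cayley t))

theorem norm_expCayley_le {s : ℝ} (hs : 0 ≤ s) {t : ℂ} (ht : ‖t‖ < 1) : ‖expCayley s t‖ ≤ 1 := by
  rw [expCayley, Complex.norm_exp, Real.exp_le_one_iff]
  simpa using mul_nonneg hs (cayley_re_nonneg ht)

theorem hasDerivAt_expCayley (s : ℝ) {t : ℂ} (ht : ‖t‖ < 1) :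
    HasDerivAt (expCayley s) (2 * s / (1 + t) ^ 2 * expCayley s t) t := by
  have h0 := one_add_ne_zero ht
  have h1 : HasDerivAt cayley (-2 / (1 + t) ^ 2) t := by
    refine (((hasDerivAt_id' t).const_sub 1).div ((hasDerivAt_id' t).const_add 1) h0).congr_deriv ?_
    ring
  refine ((h1.const_mul (s : ℂ)).neg).cexp.congr_deriv ?_
  simp only [expCayley, Pi.neg_apply]
  ring

/-- The generating function `(1 + t)^{-d} exp (-s (1 - t) / (1 + t))`. -/
def wignerGen (d : ℕ) (s : ℝ) (t : ℂ) : ℂ := ((1 + t) ^ d)⁻¹ * expCayley s t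

theorem norm_wignerGen_le (d : ℕ) {s : ℝ} (hs : 0 ≤ s) {t : ℂ} (ht : ‖t‖ < 1) :
    ‖wignerGen d s t‖ ≤ ((1 - ‖t‖) ^ d)⁻¹ := by
  rw [wignerGen, norm_mul, norm_inv, norm_pow]
  refine (mul_le_of_le_one_right (by positivity) (norm_expCayley_le hs ht)).trans ?_
  have h1 : 0 < 1 - ‖t‖ := by linarith
  gcongr
  exact one_sub_norm_le

theorem hasDerivAt_wignerGen (d : ℕ) (s : ℝ) {t : ℂ} (ht : ‖t‖ < 1) :
    HasDerivAt (wignerGen d s)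
      ((-(d : ℂ) / (1 + t) + 2 * s / (1 + t) ^ 2) * wignerGen d s t) t := by
  have h0 := one_add_ne_zero ht
  have h1 : HasDerivAt (fun t : ℂ => ((1 + t) ^ d)⁻¹) (-(d : ℂ) / (1 + t) * ((1 + t) ^ d)⁻¹) t := by
    refine ((((hasDerivAt_id' t).const_add 1).pow d).inv (pow_ne_zero d h0)).congr_deriv ?_
    simp only [Pi.pow_apply]
    rcases d with _ | d
    · simp
    · simp only [Nat.add_sub_cancel]
      field_simp
      rw [pow_succ, mul_comm]
  refine (h1.mul (hasDerivAt_expCayley s ht)).congr_deriv ?_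
  rw [wignerGen]
  ring

section coefficients

variable {d : ℕ} {s : ℝ} {a : ℕ → ℂ}

/-- Cauchy's estimate on the circle of radius r = (n + 1)/(n + 2): there 1 - |t| = 1/(n + 2), while
r^(-n) = (1 + 1/(n + 1))^n ≤ e < 3. -/
theorem norm_coeff_wignerGen_le (hs : 0 ≤ s) (h : HasDiscSum a (wignerGen d s)) (n : ℕ) :
    ‖a n‖ ≤ 3 * ((n : ℝ) + 2) ^ d := by
  have hn : (0 : ℝ) < n + 2 := by positivity
  have hn1 : (0 : ℝ) < n + 1 := by positivity
  have h1 := h.norm_coeff_le (r := (n + 1) / (n + 2)) (B := ((n : ℝ) + 2) ^ d) (by positivity)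
    (by rw [div_lt_one hn]; linarith) (fun t ht => by
      refine (norm_wignerGen_le d hs (ht ▸ by rw [div_lt_one hn]; linarith)).trans ?_
      rw [ht, ← inv_pow, one_sub_div hn.ne', inv_div]
      norm_num) n
  refine h1.trans ?_
  rw [div_eq_mul_inv, mul_comm, ← inv_pow, inv_div]
  gcongr
  calc (((n : ℝ) + 2) / (n + 1)) ^ n ≤ (Real.exp (1 / (n + 1))) ^ n := by
        gcongr
        have := Real.add_one_le_exp (1 / ((n : ℝ) + 1))
        calc ((n : ℝ) + 2) / (n + 1) = 1 / (n + 1) + 1 := by field_simp; ring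
          _ ≤ _ := this
    _ = Real.exp (n / (n + 1)) := by rw [← Real.exp_nat_mul]; congr 1; ring
    _ ≤ Real.exp 1 := by
        gcongr
        rw [div_le_one hn1]
        linarith
    _ ≤ 3 := by linarith [Real.exp_one_lt_d9]

/-- Each derivative of `expCayley` costs a factor (1 + t)^(-2), so the fourth power leaves room for
two derivatives to stay bounded. Bounded Taylor coefficients of the second derivative mean decay of
order n^(-2). -/
theorem summable_coeff_of_pow_four (hs : 0 ≤ s)
    (h : HasDiscSum a (fun t => (1 + t) ^ 4 * expCayley s t)) : Summable a := by
  have d1 : ∀ t : ℂ, ‖t‖ < 1 → HasDerivAt (fun t => (1 + t) ^ 4 * expCayley s t)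
      ((4 * (1 + t) ^ 3 + 2 * s * (1 + t) ^ 2) * expCayley s t) t := fun t ht => by
    have h0 := one_add_ne_zero ht
    refine ((((hasDerivAt_id' t).const_add 1).pow 4).mul
      (hasDerivAt_expCayley s ht)).congr_deriv ?_
    simp only [Pi.pow_apply]
    field_simp
    push_cast
    ring
  have d2 : ∀ t : ℂ, ‖t‖ < 1 →
      HasDerivAt (fun t => (4 * (1 + t) ^ 3 + 2 * s * (1 + t) ^ 2) * expCayley s t)
      ((12 * (1 + t) ^ 2 + 12 * s * (1 + t) + 4 * s ^ 2) * expCayley s t) t := fun t ht => by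
    have h0 := one_add_ne_zero ht
    refine ((((((hasDerivAt_id' t).const_add 1).pow 3).const_mul 4).add
      ((((hasDerivAt_id' t).const_add 1).pow 2).const_mul (2 * s : ℂ))).mul
      (hasDerivAt_expCayley s ht)).congr_deriv ?_
    simp only [Pi.pow_apply, Pi.add_apply]
    field_simp
    push_cast
    ring
  have h2 := (h.deriv_coeff d1).deriv_coeff d2
  have hb := h2.norm_coeff_le_of_bounded (B := 48 + 24 * s + 4 * s ^ 2) fun t ht => by
    rw [norm_mul]
    refine (mul_le_of_le_one_right (norm_nonneg _) (norm_expCayley_le hs ht)).trans ?_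
    have h3 : ‖1 + t‖ ≤ 2 := (norm_add_le _ _).trans (by rw [norm_one]; linarith)
    refine (norm_add₃_le).trans ?_
    simp only [norm_mul, norm_pow, Complex.norm_real, Real.norm_of_nonneg hs, Complex.norm_ofNat]
    have : ‖1 + t‖ ^ 2 ≤ 2 ^ 2 := by gcongr
    have : s * ‖1 + t‖ ≤ s * 2 := by gcongr
    nlinarith
  rw [← summable_nat_add_iff 2]
  refine Summable.of_norm_bounded
    (g := fun n : ℕ => (48 + 24 * s + 4 * s ^ 2) * (1 / ((n : ℝ) + 1) ^ 2)) ?_ fun n => ?_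
  · refine Summable.mul_left _ ?_
    exact_mod_cast (summable_nat_add_iff 1).2 (Real.summable_one_div_nat_pow.2 one_lt_two)
  · have := hb n
    rw [norm_mul, norm_mul] at this
    have e1 : ‖(n : ℂ) + 1‖ = n + 1 := by
      rw [← Nat.cast_succ, Complex.norm_natCast]; push_cast; ring
    have e2 : ‖((n + 1 : ℕ) : ℂ) + 1‖ = n + 2 := by
      rw [← Nat.cast_succ, Complex.norm_natCast]; push_cast; ring
    rw [e1, e2] at this
    rw [mul_one_div, le_div_iff₀ (by positivity)]
    refine le_trans ?_ this
    have : 0 ≤ ‖a (n + 1 + 1)‖ := norm_nonneg _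
    have hn : (0 : ℝ) ≤ n := n.cast_nonneg
    nlinarith [mul_nonneg hn this]

theorem continuousAt_expCayley_one (s : ℝ) :
    Tendsto (fun r : ℝ => expCayley s r) (𝓝[<] 1) (𝓝 1) := by
  have : ContinuousAt (fun r : ℝ => expCayley s r) 1 := by
    unfold expCayley cayley
    have : (1 + ((1 : ℝ) : ℂ)) ≠ 0 := by norm_num
    fun_prop (disch := assumption)
  have h := this.tendsto.mono_left (nhdsWithin_le_nhds (s := Set.Iio (1 : ℝ)))
  simpa [expCayley, cayley] using h

/-- Of the 4 + d factors, d cancel the denominator of the generating function and 4 give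
summability; the sum is the value of (1 + t)^4 `expCayley s t` at t = 1. -/
theorem hasSum_addShift_wignerGen (hs : 0 ≤ s) (h : HasDiscSum a (wignerGen d s)) :
    Summable (addShift^[4 + d] a) ∧ HasSum (addShift^[4 + d] a) (2 ^ 4) := by
  have h1 : HasDiscSum (addShift^[4 + d] a) (fun t => (1 + t) ^ 4 * expCayley s t) :=
    (h.one_add_pow_mul (4 + d)).congr_sum fun t ht => by
      have h0 := one_add_ne_zero ht
      rw [wignerGen, pow_add]
      field_simp
  have h2 := summable_coeff_of_pow_four hs h1
  refine ⟨h2, h1.hasSum_of_tendsto h2 ?_⟩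
  have h3 : Tendsto (fun r : ℝ => (1 + (r : ℂ)) ^ 4) (𝓝[<] 1) (𝓝 (2 ^ 4)) := by
    have : Continuous fun r : ℝ => (1 + (r : ℂ)) ^ 4 := by fun_prop
    have := this.tendsto 1
    norm_num at this ⊢
    exact this.mono_left nhdsWithin_le_nhds
  simpa using h3.mul (continuousAt_expCayley_one s)

/-- Summable coefficients would bound the function on the disc, whereas it is unbounded on the curve
Re `cayley` t = 1, which approaches -1. -/
theorem not_summable_coeff_wignerGen (hd : 1 ≤ d) (h : HasDiscSum a (wignerGen d s)) :
    ¬ Summable a := by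
  intro hsum
  set B := ∑' n, ‖a n‖ with hB
  have hbd : ∀ t : ℂ, ‖t‖ < 1 → ‖wignerGen d s t‖ ≤ B := fun t ht => by
    rw [← (h t ht).tsum_eq]
    refine tsum_of_norm_bounded hsum.norm.hasSum fun n => ?_
    rw [norm_mul, norm_pow]
    exact mul_le_of_le_one_right (norm_nonneg _) (pow_le_one₀ (norm_nonneg _) ht.le)
  have hlow : ∀ y : ℝ, 2 ≤ y → y / 2 * Real.exp (-s) ≤ B := fun y hy => by
    have hne : (2 + y * Complex.I : ℂ) ≠ 0 := fun h => by
      have := congrArg Complex.re h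
      simp at this
    have hyn : y ≤ ‖(2 + y * Complex.I : ℂ)‖ := by
      have := Complex.abs_im_le_norm (2 + y * Complex.I : ℂ)
      simp at this
      exact (le_abs_self y).trans this
    -- The solution of `cayley t` = 1 + iy. There the exponential has constant modulus e^(-s), and
    -- 1/|1 + t| = |2 + iy|/2 grows with y.
    set t : ℂ := -(y * Complex.I) / (2 + y * Complex.I) with htd
    have ht : ‖t‖ < 1 := by
      rw [htd, norm_div, div_lt_one (norm_pos_iff.2 hne), norm_neg]
      refine lt_of_pow_lt_pow_left₀ 2 (norm_nonneg _) ?_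
      rw [Complex.sq_norm, Complex.sq_norm, Complex.normSq_apply, Complex.normSq_apply]
      simp
    have h1t : 1 + t = 2 / (2 + y * Complex.I) := by
      rw [htd]; field_simp; ring
    have hc : cayley t = 1 + y * Complex.I := by
      have : 1 - t = 2 * (1 + y * Complex.I) / (2 + y * Complex.I) := by
        rw [htd]; field_simp; ring
      rw [cayley, this, h1t]
      field_simp
    refine le_trans ?_ (hbd t ht)
    rw [wignerGen, expCayley, norm_mul, Complex.norm_exp, hc, h1t, ← inv_pow, inv_div, norm_pow,
      norm_div]
    simp only [Complex.neg_re, Complex.re_ofReal_mul, Complex.add_re, Complex.one_re,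
      Complex.I_re, mul_zero, add_zero, mul_one, Complex.norm_ofNat]
    gcongr
    calc y / 2 ≤ ‖(2 + y * Complex.I : ℂ)‖ / 2 := by gcongr
      _ ≤ _ := le_self_pow₀ (by rw [le_div_iff₀ two_pos]; linarith) (by omega)
  have hB0 : 0 ≤ B := tsum_nonneg fun _ => norm_nonneg _
  have := hlow (2 * (B + 1) * Real.exp s + 2) (le_add_of_nonneg_left (by positivity))
  rw [Real.exp_neg] at this
  have he := Real.exp_pos s
  have : (2 * (B + 1) * Real.exp s + 2) / 2 * (Real.exp s)⁻¹ = B + 1 + (Real.exp s)⁻¹ := by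
    field_simp
  have := inv_pos.2 he
  linarith

end coefficients

/-! ### Summation with Schwartz cut-offs, by finite differences. -/

theorem hasDerivAt_iterate_fwdDiff {f f' : ℝ → ℂ} (h : ℝ) (hf : ∀ u, HasDerivAt f (f' u) u)
    (m : ℕ) (u : ℝ) : HasDerivAt ((fwdDiff h)^[m] f) ((fwdDiff h)^[m] f' u) u := by
  induction m generalizing u with
  | zero => exact hf u
  | succ m ih =>
    rw [Function.iterate_succ_apply', Function.iterate_succ_apply']
    exact ((ih (u + h)).comp_add_const u h).sub (ih u)

/-- By the mean value inequality each difference of step h is h times a bound for the derivative, so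
induction runs over all Schwartz functions. The constant is uniform in h. -/
theorem norm_iterate_fwdDiff_le (m q : ℕ) (χ : 𝓢(ℝ, ℂ)) :
    ∃ C : ℝ, 0 ≤ C ∧ ∀ h : ℝ, 0 < h → ∀ y : ℝ, 0 ≤ y →
      ‖(fwdDiff h)^[m] χ y‖ ≤ C * h ^ m / (1 + y) ^ q := by
  induction m generalizing χ with
  | zero =>
    refine ⟨2 ^ q * ((Finset.Iic (q, 0)).sup fun m => SchwartzMap.seminorm ℝ m.1 m.2) χ,
      by positivity, fun h _ y hy => ?_⟩
    rw [le_div_iff₀ (by positivity), mul_comm]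
    simpa [abs_of_nonneg hy] using SchwartzMap.one_add_le_sup_seminorm_apply (𝕜 := ℝ)
      (m := (q, 0)) (k := q) (n := 0) le_rfl le_rfl χ y
  | succ m ih =>
    obtain ⟨C, hC, hb⟩ := ih (SchwartzMap.derivCLM ℝ ℂ χ)
    refine ⟨C, hC, fun h hh y hy => ?_⟩
    have hd := hasDerivAt_iterate_fwdDiff h (fun u => (χ.hasDerivAt u).congr_deriv
      (SchwartzMap.derivCLM_apply ℝ χ u).symm) m
    rw [Function.iterate_succ_apply', fwdDiff]
    have := (convex_Icc y (y + h)).norm_image_sub_le_of_norm_hasDerivWithin_le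
      (f := (fwdDiff h)^[m] χ) (C := C * h ^ m / (1 + y) ^ q)
      (fun u _ => (hd u).hasDerivWithinAt) (fun u hu => (hb h hh u (hy.trans hu.1)).trans
        (by have := hu.1; gcongr)) (left_mem_Icc.2 (by linarith)) (right_mem_Icc.2 (by linarith))
    refine this.trans_eq ?_
    rw [add_sub_cancel_left, Real.norm_of_nonneg hh.le]
    ring

theorem summable_one_div_succ_sq : Summable fun N : ℕ => 1 / ((N : ℝ) + 1) ^ 2 := by
  exact_mod_cast (summable_nat_add_iff 1).2 (Real.summable_one_div_nat_pow.2 one_lt_two)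

section pairing

variable {a : ℕ → ℂ} {C : ℝ} {p : ℕ}

/-- Decay of order p + 2 of the cut-off absorbs the growth of `a` and leaves a summable tail. The
factor `min ε 1` lets one estimate serve both for fixed ε and for ε → 0. -/
theorem norm_iterate_fwdDiff_mul_le (ha : ∀ N, ‖a N‖ ≤ C * ((N : ℝ) + 1) ^ p) (hC : 0 ≤ C)
    (χ : 𝓢(ℝ, ℂ)) (m : ℕ) :
    ∃ K : ℝ, 0 ≤ K ∧ ∀ ε : ℝ, 0 < ε → ∀ c₀ : ℝ, 0 ≤ c₀ → ∀ N : ℕ,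
      ‖(fwdDiff ε)^[m] χ (ε * (N + c₀)) * a N‖ ≤
        K * ε ^ m / (min ε 1) ^ (p + 2) * (1 / ((N : ℝ) + 1) ^ 2) := by
  obtain ⟨K, hK, hb⟩ := norm_iterate_fwdDiff_le m (p + 2) χ
  refine ⟨K * C, by positivity, fun ε hε c₀ hc N => ?_⟩
  have hδ : 0 < min ε 1 := lt_min hε one_pos
  have h1 : min ε 1 * ((N : ℝ) + 1) ≤ 1 + ε * (N + c₀) := by
    have h2 : min ε 1 * (N : ℝ) ≤ ε * N := by gcongr; exact min_le_left _ _
    have h3 : min ε 1 ≤ 1 := min_le_right _ _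
    have h4 : 0 ≤ ε * c₀ := by positivity
    linarith
  calc ‖(fwdDiff ε)^[m] χ (ε * (N + c₀)) * a N‖
      ≤ (K * ε ^ m / (1 + ε * (N + c₀)) ^ (p + 2)) * (C * ((N : ℝ) + 1) ^ p) := by
        rw [norm_mul]
        gcongr
        · exact hb ε hε _ (by positivity)
        · exact ha N
    _ ≤ (K * ε ^ m / (min ε 1 * ((N : ℝ) + 1)) ^ (p + 2)) * (C * ((N : ℝ) + 1) ^ p) := by
        gcongr
    _ = _ := by
        rw [mul_pow]
        field_simp
        ring

theorem summable_iterate_fwdDiff_mul (ha : ∀ N, ‖a N‖ ≤ C * ((N : ℝ) + 1) ^ p) (χ : 𝓢(ℝ, ℂ))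
    (m : ℕ) {ε : ℝ} (hε : 0 < ε) {c₀ : ℝ} (hc : 0 ≤ c₀) :
    Summable fun N : ℕ => (fwdDiff ε)^[m] χ (ε * (N + c₀)) * a N := by
  have hC : 0 ≤ C := by simpa using (norm_nonneg _).trans (ha 0)
  obtain ⟨K, -, hb⟩ := norm_iterate_fwdDiff_mul_le ha hC χ m
  exact Summable.of_norm_bounded (summable_one_div_succ_sq.mul_left _) (hb ε hε c₀ hc)

/-- With p + 3 differences the bound is ε^(p + 3)/ε^(p + 2) = ε up to a constant. -/
theorem tendsto_tsum_iterate_fwdDiff_mul (ha : ∀ N, ‖a N‖ ≤ C * ((N : ℝ) + 1) ^ p) (χ : 𝓢(ℝ, ℂ))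
    {c₀ : ℝ} (hc : 0 ≤ c₀) :
    Tendsto (fun ε : ℝ => ∑' N : ℕ, (fwdDiff ε)^[p + 3] χ (ε * (N + c₀)) * a N)
      (𝓝[>] 0) (𝓝 0) := by
  have hC : 0 ≤ C := by simpa using (norm_nonneg _).trans (ha 0)
  obtain ⟨K, -, hb⟩ := norm_iterate_fwdDiff_mul_le ha hC χ (p + 3)
  have h1 : Tendsto (fun ε : ℝ => K * ε * ∑' N : ℕ, 1 / ((N : ℝ) + 1) ^ 2) (𝓝[>] 0) (𝓝 0) := by
    have : Continuous fun ε : ℝ => K * ε * ∑' N : ℕ, 1 / ((N : ℝ) + 1) ^ 2 := by fun_prop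
    simpa using (this.tendsto 0).mono_left nhdsWithin_le_nhds
  refine squeeze_zero_norm' ?_ h1
  filter_upwards [Ioo_mem_nhdsGT (zero_lt_one (α := ℝ))] with ε hε
  refine tsum_of_norm_bounded (summable_one_div_succ_sq.hasSum.mul_left (K * ε)) fun N => ?_
  refine (hb ε hε.1 c₀ hc N).trans_eq ?_
  have := hε.1
  rw [min_eq_left hε.2.le]
  field_simp
  ring

theorem tsum_mul_addShift {c : ℕ → ℂ} (h1 : Summable fun N => c N * a N)
    (h2 : Summable fun N => c (N + 1) * a N) :
    HasSum (fun N => c N * addShift a N) (∑' N, c N * a N + ∑' N, c (N + 1) * a N) := by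
  have h3 : HasSum (fun N => (match N with | 0 => 0 | k + 1 => c (k + 1) * a k : ℂ))
      (∑' N, c (N + 1) * a N) := by
    rw [← hasSum_nat_add_iff' 1]
    simpa using h2.hasSum
  convert h1.hasSum.add h3 using 1
  funext n
  cases n <;> simp [addShift, mul_add]

theorem norm_addShift_le (ha : ∀ N, ‖a N‖ ≤ C * ((N : ℝ) + 1) ^ p) (N : ℕ) :
    ‖addShift a N‖ ≤ 2 * C * ((N : ℝ) + 1) ^ p := by
  have hC : 0 ≤ C := by simpa using (norm_nonneg _).trans (ha 0)
  cases N with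
  | zero =>
    have := ha 0
    simp only [addShift, Nat.cast_zero, zero_add, one_pow, mul_one] at this ⊢
    linarith
  | succ k =>
    have h1 := ha (k + 1)
    have h2 : C * ((k : ℝ) + 1) ^ p ≤ C * (((k + 1 : ℕ) : ℝ) + 1) ^ p := by
      gcongr
      linarith
    calc ‖a (k + 1) + a k‖ ≤ ‖a (k + 1)‖ + ‖a k‖ := norm_add_le _ _
      _ ≤ _ := by linarith [ha k]

/-- The series `∑ a N` has sum `S` with respect to all Schwartz cut-offs. -/
def CutoffSum (a : ℕ → ℂ) (S : ℂ) : Prop :=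
  ∀ (χ : 𝓢(ℝ, ℂ)) (c₀ : ℝ), 0 ≤ c₀ →
    Tendsto (fun ε : ℝ => ∑' N : ℕ, χ (ε * (N + c₀)) * a N) (𝓝[>] 0) (𝓝 (χ 0 * S))

theorem CutoffSum.of_hasSum {S : ℂ} (h : HasSum a S) : CutoffSum a S := by
  intro χ c₀ _
  rw [← h.tsum_eq, ← tsum_mul_left]
  refine tendsto_tsum_of_dominated_convergence
    (bound := fun N => SchwartzMap.seminorm ℝ 0 0 χ * ‖a N‖) (h.summable.norm.mul_left _) ?_ ?_
  · intro N
    have : Continuous fun ε : ℝ => χ (ε * (N + c₀)) * a N :=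
      (χ.continuous.comp (by fun_prop)).mul continuous_const
    simpa using (this.tendsto 0).mono_left nhdsWithin_le_nhds
  · refine Eventually.of_forall fun ε N => ?_
    rw [norm_mul]
    gcongr
    exact χ.norm_le_seminorm ℝ _

/-- A difference of the cut-off subtracts the sums with offsets c₀ + 1 and c₀, which have the same
limit. This is why `CutoffSum` quantifies over all offsets. -/
theorem CutoffSum.iterate_fwdDiff {S : ℂ} (ha : ∀ N, ‖a N‖ ≤ C * ((N : ℝ) + 1) ^ p)
    (h : CutoffSum a S) (χ : 𝓢(ℝ, ℂ)) (m : ℕ) (c₀ : ℝ) (hc : 0 ≤ c₀) :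
    Tendsto (fun ε : ℝ => ∑' N : ℕ, (fwdDiff ε)^[m] χ (ε * (N + c₀)) * a N) (𝓝[>] 0)
      (𝓝 (if m = 0 then χ 0 * S else 0)) := by
  induction m generalizing c₀ with
  | zero => simpa using h χ c₀ hc
  | succ m ih =>
    have h1 := (ih (c₀ + 1) (by linarith)).sub (ih c₀ hc)
    rw [sub_self] at h1
    simp only [Nat.add_eq_zero_iff, one_ne_zero, and_false, if_false]
    refine h1.congr' ?_
    filter_upwards [self_mem_nhdsWithin] with ε hε
    rw [← (summable_iterate_fwdDiff_mul ha χ m hε (by linarith)).tsum_sub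
      (summable_iterate_fwdDiff_mul ha χ m hε hc)]
    refine tsum_congr fun N => ?_
    rw [Function.iterate_succ_apply', fwdDiff, sub_mul]
    ring_nf

/-- Summation by parts gives ∑ χ_N (a_N + a_(N-1)) = 2 ∑ χ_N a_N + ∑ (Δχ)_N a_N. It therefore
suffices that the sums against Δχ tend to zero; the same identity applied to Δ^m χ reduces this to a
difference of high order. -/
theorem CutoffSum.of_addShift {S : ℂ} (ha : ∀ N, ‖a N‖ ≤ C * ((N : ℝ) + 1) ^ p)
    (h : CutoffSum (addShift a) (2 * S)) : CutoffSum a S := by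
  intro χ c₀ hc
  have key : ∀ m, ∀ ε : ℝ, 0 < ε → ∑' N : ℕ, (fwdDiff ε)^[m] χ (ε * (N + c₀)) * a N =
      1 / 2 * ∑' N : ℕ, (fwdDiff ε)^[m] χ (ε * (N + c₀)) * addShift a N -
        1 / 2 * ∑' N : ℕ, (fwdDiff ε)^[m + 1] χ (ε * (N + c₀)) * a N := by
    intro m ε hε
    have s0 := summable_iterate_fwdDiff_mul ha χ m hε hc
    have s1 := summable_iterate_fwdDiff_mul ha χ (m + 1) hε hc
    have e : ∀ N : ℕ, (fwdDiff ε)^[m] χ (ε * ((N + 1 : ℕ) + c₀)) * a N =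
        (fwdDiff ε)^[m + 1] χ (ε * (N + c₀)) * a N +
          (fwdDiff ε)^[m] χ (ε * (N + c₀)) * a N := by
      intro N
      rw [Function.iterate_succ_apply', fwdDiff]
      push_cast
      ring_nf
    rw [(tsum_mul_addShift s0 ((s1.add s0).congr fun N => (e N).symm)).tsum_eq, tsum_congr e, s1.tsum_add s0]
    ring
  -- Descent in the order of the difference, from p + 3 to 1: at positive order the sum against
  -- `addShift a` tends to zero, so by `key` the vanishing of order m + 1 passes to order m.
  have hT : ∀ k ≤ p + 2, Tendsto (fun ε : ℝ => ∑' N : ℕ,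
      (fwdDiff ε)^[p + 3 - k] χ (ε * (N + c₀)) * a N) (𝓝[>] 0) (𝓝 0) := by
    intro k hk
    induction k with
    | zero => exact tendsto_tsum_iterate_fwdDiff_mul ha χ hc
    | succ k ih =>
      have h1 := h.iterate_fwdDiff (norm_addShift_le ha) χ (p + 3 - (k + 1)) c₀ hc
      rw [if_neg (by omega)] at h1
      have h2 := (h1.const_mul (1 / 2)).sub ((ih (by omega)).const_mul (1 / 2))
      simp only [mul_zero, sub_zero] at h2
      refine h2.congr' ?_
      filter_upwards [self_mem_nhdsWithin] with ε hε
      rw [key (p + 3 - (k + 1)) ε hε, show p + 3 - (k + 1) + 1 = p + 3 - k by omega]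
  have h1 := hT (p + 2) le_rfl
  rw [show p + 3 - (p + 2) = 1 by omega] at h1
  have h2 := ((h χ c₀ hc).const_mul (1 / 2)).sub (h1.const_mul (1 / 2))
  rw [show 1 / 2 * (χ 0 * (2 * S)) - 1 / 2 * 0 = χ 0 * S by ring] at h2
  refine h2.congr' ?_
  filter_upwards [self_mem_nhdsWithin] with ε hε
  exact (key 0 ε hε).symm

theorem CutoffSum.of_iterate_addShift {S : ℂ} (k : ℕ)
    (ha : ∀ N, ‖a N‖ ≤ C * ((N : ℝ) + 1) ^ p)
    (h : CutoffSum (addShift^[k] a) (2 ^ k * S)) : CutoffSum a S := by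
  induction k generalizing a C S with
  | zero => simpa using h
  | succ k ih =>
    refine CutoffSum.of_addShift ha (ih (norm_addShift_le ha) ?_)
    rwa [Function.iterate_succ_apply, pow_succ, mul_assoc] at h

end pairing

section coefficients

variable {d : ℕ} {s : ℝ} {a : ℕ → ℂ}

theorem norm_coeff_wignerGen_le' (hs : 0 ≤ s) (h : HasDiscSum a (wignerGen d s)) (n : ℕ) :
    ‖a n‖ ≤ (3 * 2 ^ d) * ((n : ℝ) + 1) ^ d := by
  refine (norm_coeff_wignerGen_le hs h n).trans ?_
  rw [mul_assoc, ← mul_pow]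
  have : (0 : ℝ) ≤ n := n.cast_nonneg
  gcongr
  linarith

theorem cutoffSum_coeff_wignerGen (hs : 0 ≤ s) (h : HasDiscSum a (wignerGen d s)) :
    CutoffSum a (2 ^ d)⁻¹ := by
  refine CutoffSum.of_iterate_addShift (4 + d) (norm_coeff_wignerGen_le' hs h) ?_
  rw [pow_add, mul_assoc, mul_inv_cancel₀ (pow_ne_zero d two_ne_zero), mul_one]
  exact CutoffSum.of_hasSum (hasSum_addShift_wignerGen hs h).2

end coefficients

/-! ### Decay of solutions of the Laguerre recurrence. -/

section recurrence

variable {x : ℝ} {l q : ℕ → ℝ}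

/-- A solution of the Laguerre recurrence, written as a first order system, tends to zero.
The proof uses the energy `E n = x l (n+1) l n + q n ^ 2 / (n + 1)`. -/
theorem tendsto_zero_of_recurrence (hx : 0 < x)
    (hl : ∀ n : ℕ, ((n : ℝ) + 1) * (l (n + 1) - l n) = q n)
    (hq : ∀ n : ℕ, q (n + 1) = q n - x * l (n + 1)) : Tendsto l atTop (𝓝 0) := by
  -- Expanding with `hl`, Z n = (n + 1) x l (n+1) l n + (q n)², which is (n + 1) times the energy.
  -- In this completed form it is visibly nonnegative once n + 1 > x/4.
  set Z : ℕ → ℝ := fun n => (n + 1 - x / 4) * (x * l n ^ 2) + (q n + x * l n / 2) ^ 2 with hZ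
  set D : ℕ → ℝ := fun n => Z n / (n + 1 - x / 4) with hD
  have hZs : ∀ n, Z (n + 1) = Z n + x * l (n + 1) ^ 2 := fun n => by
    simp only [hZ, hq n, ← hl n]
    push_cast
    ring
  obtain ⟨n₀, hn₀⟩ := exists_nat_gt (x / 4)
  have hK : ∀ n, n₀ ≤ n → 1 < (n : ℝ) + 1 - x / 4 := fun n hn => by
    have : (n₀ : ℝ) ≤ n := by exact_mod_cast hn
    linarith
  have hlD : ∀ n, n₀ ≤ n → x * l n ^ 2 ≤ D n := fun n hn => by
    have h := hK n hn
    rw [hD]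
    simp only
    rw [le_div_iff₀ (by linarith), hZ]
    simp only
    nlinarith [sq_nonneg (q n + x * l n / 2)]
  have hD0 : ∀ n, n₀ ≤ n → 0 ≤ D n := fun n hn => (by positivity : 0 ≤ x * l n ^ 2).trans (hlD n hn)
  -- The increment of Z is x l (n+1)² ≤ D (n+1), exactly what the denominator of D gains by growing
  -- by 1.
  have hanti : ∀ n, n₀ ≤ n → D (n + 1) ≤ D n := fun n hn => by
    have h := hK n hn
    have h1 := hlD (n + 1) (by omega)
    have h2 : Z (n + 1) = D (n + 1) * ((n : ℝ) + 2 - x / 4) := by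
      simp only [hD]
      push_cast
      rw [show (n : ℝ) + 1 + 1 - x / 4 = n + 2 - x / 4 by ring, div_mul_cancel₀]
      linarith
    have h3 : Z n = D n * ((n : ℝ) + 1 - x / 4) := by
      simp only [hD]
      rw [div_mul_cancel₀]
      linarith
    have h4 := hZs n
    rw [h2, h3] at h4
    have : D (n + 1) * ((n : ℝ) + 1 - x / 4) ≤ D n * ((n : ℝ) + 1 - x / 4) := by linarith
    exact le_of_mul_le_mul_right this (by linarith)
  obtain ⟨L, hL⟩ : ∃ L, Tendsto D atTop (𝓝 L) := by
    have hm : Antitone fun n => D (n + n₀) := antitone_nat_of_succ_le fun n => by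
      have := hanti (n + n₀) (by omega)
      rwa [show n + 1 + n₀ = n + n₀ + 1 by omega]
    have hb : BddBelow (Set.range fun n => D (n + n₀)) :=
      ⟨0, by rintro _ ⟨n, rfl⟩; exact hD0 _ (by omega)⟩
    exact ⟨_, (tendsto_add_atTop_iff_nat n₀).1 (tendsto_atTop_ciInf hm hb)⟩
  have hDb : ∀ n, n₀ ≤ n → D n ≤ D n₀ := fun n hn => by
    induction n, hn using Nat.le_induction with
    | base => exact le_rfl
    | succ n hn ih => exact (hanti n hn).trans ih
  have hinv : Tendsto (fun n : ℕ => ((n : ℝ) + 1)⁻¹) atTop (𝓝 0) :=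
    (tendsto_natCast_atTop_atTop.atTop_add tendsto_const_nhds).inv_tendsto_atTop
  -- the energies converge to the same limit
  have hE : Tendsto (fun n : ℕ => Z n * ((n : ℝ) + 1)⁻¹) atTop (𝓝 L) := by
    have h1 : Tendsto (fun n : ℕ => D n * (1 - x / 4 * ((n : ℝ) + 1)⁻¹)) atTop
        (𝓝 (L * (1 - x / 4 * 0))) := hL.mul ((hinv.const_mul _).const_sub 1)
    simp only [mul_zero, sub_zero, mul_one] at h1
    refine h1.congr' ?_
    filter_upwards [eventually_ge_atTop n₀] with n hn
    have h := hK n hn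
    have h' : (n : ℝ) + 1 - x / 4 ≠ 0 := by linarith
    have e : 1 - x / 4 * ((n : ℝ) + 1)⁻¹ = (n + 1 - x / 4) * ((n : ℝ) + 1)⁻¹ := by
      have : (n : ℝ) + 1 ≠ 0 := by positivity
      field_simp
    simp only [hD]
    rw [e, ← mul_assoc, div_mul_cancel₀ _ h']
  -- bounds for `l` and `q`
  set B := D n₀ / x with hB
  have hB0 : 0 ≤ B := div_nonneg (hD0 _ le_rfl) hx.le
  have hlB : ∀ n, n₀ ≤ n → l n ^ 2 ≤ B := fun n hn => by
    rw [hB, le_div_iff₀ hx, mul_comm]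
    exact (hlD n hn).trans (hDb n hn)
  have hqB : ∀ n, n₀ ≤ n → q n ^ 2 ≤ (2 * D n₀ + x ^ 2 * B) * (n + 1) := fun n hn => by
    have h := hK n hn
    have h1 : (q n + x * l n / 2) ^ 2 ≤ D n₀ * ((n : ℝ) + 1) := by
      have h3 : Z n = D n * ((n : ℝ) + 1 - x / 4) := by
        simp only [hD]
        rw [div_mul_cancel₀]
        linarith
      have h4 : (q n + x * l n / 2) ^ 2 ≤ Z n := by
        simp only [hZ]
        have : 0 ≤ ((n : ℝ) + 1 - x / 4) * (x * l n ^ 2) := mul_nonneg (by linarith) (by positivity)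
        linarith
      rw [h3] at h4
      refine h4.trans (mul_le_mul (hDb n hn) (by linarith) (by linarith) (hD0 _ le_rfl))
    have h2 : x ^ 2 * l n ^ 2 ≤ x ^ 2 * B := by gcongr; exact hlB n hn
    have h3 : 0 ≤ x ^ 2 * B * n := by positivity
    nlinarith [sq_nonneg (q n + x * l n)]
  have hdl : Tendsto (fun n : ℕ => q n * ((n : ℝ) + 1)⁻¹) atTop (𝓝 0) := by
    have h1 : Tendsto (fun n : ℕ => (q n * ((n : ℝ) + 1)⁻¹) ^ 2) atTop (𝓝 0) := by
      have h2 := hinv.const_mul (2 * D n₀ + x ^ 2 * B)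
      rw [mul_zero] at h2
      refine squeeze_zero' (Eventually.of_forall fun n => sq_nonneg _) ?_ h2
      filter_upwards [eventually_ge_atTop n₀] with n hn
      have h3 := hqB n hn
      have hn1 : (0 : ℝ) < n + 1 := by positivity
      rw [mul_pow, inv_pow, ← div_eq_mul_inv, ← div_eq_mul_inv, div_le_div_iff₀ (by positivity) hn1]
      nlinarith
    have h2 := h1.sqrt
    rw [Real.sqrt_zero] at h2
    simp only [Real.sqrt_sq_eq_abs] at h2
    exact (tendsto_zero_iff_abs_tendsto_zero _).2 h2
  have hbdd : ∃ C, ∀ᶠ n : ℕ in atTop, ‖l n‖ ≤ C := by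
    refine ⟨√B, ?_⟩
    filter_upwards [eventually_ge_atTop n₀] with n hn
    rw [Real.norm_eq_abs, ← Real.sqrt_sq_eq_abs]
    exact Real.sqrt_le_sqrt (hlB n hn)
  obtain ⟨C, hC⟩ := hbdd
  have hprod : ∀ u : ℕ → ℝ, Tendsto u atTop (𝓝 0) → ∀ k, Tendsto (fun n => l (n + k) * u n)
      atTop (𝓝 0) := fun u hu k => by
    have h1 := hu.norm.const_mul C
    rw [norm_zero, mul_zero] at h1
    refine squeeze_zero_norm' ?_ h1
    filter_upwards [(tendsto_add_atTop_nat k).eventually hC] with n hn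
    rw [norm_mul]
    gcongr
  -- the virial identity
  have hvir : ∀ n : ℕ, l n * q n - l 0 * q 0 = ∑ j ∈ Finset.range n,
      (Z j * ((j : ℝ) + 1)⁻¹ - 2 * (x * l (j + 1) ^ 2)
        + x * (l (j + 1) * (q j * ((j : ℝ) + 1)⁻¹))) := fun n => by
    rw [← Finset.sum_range_sub (fun n => l n * q n)]
    refine Finset.sum_congr rfl fun j _ => ?_
    have hj : (j : ℝ) + 1 ≠ 0 := by positivity
    simp only [hZ, hq j, ← hl j]
    field_simp
    ring
  have hsumZ : ∀ n : ℕ, ∑ j ∈ Finset.range n, x * l (j + 1) ^ 2 = Z n - Z 0 := fun n => by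
    rw [← Finset.sum_range_sub Z]
    exact Finset.sum_congr rfl fun j _ => by rw [hZs]; ring
  have hn1 : Tendsto (fun n : ℕ => ((n : ℝ))⁻¹) atTop (𝓝 0) :=
    tendsto_natCast_atTop_atTop.inv_tendsto_atTop
  have hratio : Tendsto (fun n : ℕ => (n : ℝ)⁻¹ * (n + 1)) atTop (𝓝 1) := by
    have h1 := hn1.const_add 1
    rw [add_zero] at h1
    refine h1.congr' ?_
    filter_upwards [eventually_gt_atTop 0] with n hn
    have : (n : ℝ) ≠ 0 := by exact_mod_cast hn.ne'
    field_simp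
  have hc1 := hE.cesaro
  have hc2 : Tendsto (fun n : ℕ => (n : ℝ)⁻¹ * (Z n - Z 0)) atTop (𝓝 L) := by
    have h1 := (hratio.mul hE).sub (hn1.mul_const (Z 0))
    rw [one_mul, zero_mul, sub_zero] at h1
    refine h1.congr fun n => ?_
    have : (n : ℝ) + 1 ≠ 0 := by positivity
    field_simp
  have hc3 := ((hprod _ hdl 1).const_mul x).cesaro
  rw [mul_zero] at hc3
  have hc4 : Tendsto (fun n : ℕ => (n : ℝ)⁻¹ * (l n * q n - l 0 * q 0)) atTop (𝓝 0) := by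
    have h1 := (hratio.mul (hprod _ hdl 0)).sub (hn1.mul_const (l 0 * q 0))
    rw [mul_zero, zero_mul, sub_zero] at h1
    refine h1.congr fun n => ?_
    have : (n : ℝ) + 1 ≠ 0 := by positivity
    simp only [add_zero]
    field_simp
  have hc5 := (hc1.sub (hc2.const_mul 2)).add hc3
  -- Cesàro means of the virial identity: the left side is o(n), the energies average to L, the
  -- potential terms x l² also average to L by `hsumZ`, and the last term averages to 0. Hence 0 = L
  -- - 2L.
  have hL0 : L = 0 := by
    have := tendsto_nhds_unique hc4 (hc5.congr fun n => by
      rw [hvir n, ← hsumZ n, Finset.sum_add_distrib, Finset.sum_sub_distrib,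
        ← Finset.mul_sum _ _ 2]
      ring)
    linarith
  rw [hL0] at hL
  have h1 : Tendsto (fun n => l n ^ 2) atTop (𝓝 0) := by
    have h2 := hL.const_mul x⁻¹
    rw [mul_zero] at h2
    refine squeeze_zero' (Eventually.of_forall fun n => sq_nonneg _) ?_ h2
    filter_upwards [eventually_ge_atTop n₀] with n hn
    rw [← div_eq_inv_mul, le_div_iff₀ hx, mul_comm]
    exact hlD n hn
  have h2 := h1.sqrt
  rw [Real.sqrt_zero] at h2
  simp only [Real.sqrt_sq_eq_abs] at h2
  exact (tendsto_zero_iff_abs_tendsto_zero _).2 h2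

end recurrence

/-! ### Ordinary partial sums in dimension one. -/

section coefficients

variable {s : ℝ} {a : ℕ → ℂ}

/-- Coefficients of the differential equation (1 + t)² F' = (2s - (1 + t)) F. -/
theorem recurrence_coeff_wignerGen_one (h : HasDiscSum a (wignerGen 1 s)) (n : ℕ) :
    ((n : ℂ) + 2) * a (n + 2) + (2 * n + 3 - 2 * s) * a (n + 1) + (n + 1) * a n = 0 := by
  have h1 := (h.deriv_coeff (fun t ht => hasDerivAt_wignerGen 1 s ht)).one_add_mul.one_add_mul
  have h2 : HasDiscSum (fun n => 2 * s * a n - addShift a n)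
      (fun t => 2 * s * wignerGen 1 s t - (1 + t) * wignerGen 1 s t) := fun t ht => by
    simpa only [sub_mul] using (h.const_mul (2 * s) t ht).sub (h.one_add_mul t ht)
  have h3 := congrFun ((h1.congr_sum fun t ht => by
    have h0 := one_add_ne_zero ht
    push_cast
    field_simp
    ring).unique h2) (n + 1)
  cases n with
  | zero =>
    simp only [addShift] at h3
    push_cast at h3 ⊢
    linear_combination h3
  | succ n =>
    simp only [addShift] at h3
    push_cast at h3 ⊢
    linear_combination h3

theorem tendsto_coeff_wignerGen_one (hs : 0 < s) (h : HasDiscSum a (wignerGen 1 s)) :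
    Tendsto a atTop (𝓝 0) := by
  have key : ∀ b : ℕ → ℝ, (∀ n : ℕ, ((n : ℝ) + 2) * b (n + 2) + (2 * n + 3 - 2 * s) * b (n + 1) +
      (n + 1) * b n = 0) → Tendsto b atTop (𝓝 0) := fun b hb => by
    -- The alternating sign turns the recurrence into the one for Laguerre polynomials at 2s; it
    -- does not affect convergence to zero.
    have h1 := tendsto_zero_of_recurrence (x := 2 * s) (l := fun n => (-1) ^ n * b n)
      (q := fun n => (n + 1) * ((-1) ^ (n + 1) * b (n + 1) - (-1) ^ n * b n)) (by positivity)
      (fun n => rfl) (fun n => by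
        push_cast
        linear_combination (-1) ^ n * hb n)
    rw [tendsto_zero_iff_abs_tendsto_zero] at h1 ⊢
    refine h1.congr fun n => ?_
    simp [abs_mul]
  have hrec := recurrence_coeff_wignerGen_one h
  have hre := key (fun n => (a n).re) fun n => by
    have := congrArg Complex.re (hrec n)
    simpa using this
  have him := key (fun n => (a n).im) fun n => by
    have := congrArg Complex.im (hrec n)
    simpa using this
  have := (Complex.continuous_ofReal.tendsto 0).comp hre |>.add
    (((Complex.continuous_ofReal.tendsto 0).comp him).mul_const Complex.I)
  simp only [Complex.ofReal_zero, zero_mul, add_zero] at this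
  exact this.congr fun n => Complex.re_add_im (a n)

theorem tendsto_addShift (h : Tendsto a atTop (𝓝 0)) : Tendsto (addShift a) atTop (𝓝 0) := by
  rw [← tendsto_add_atTop_iff_nat 1]
  simpa [addShift] using ((tendsto_add_atTop_iff_nat 1).2 h).add h

theorem sum_range_addShift (a : ℕ → ℂ) (M : ℕ) :
    ∑ n ∈ Finset.range (M + 1), addShift a n = 2 * ∑ n ∈ Finset.range (M + 1), a n - a M := by
  induction M with
  | zero => simp [addShift]; ring
  | succ M ih =>
    rw [Finset.sum_range_succ, ih, Finset.sum_range_succ _ (M + 1), addShift]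
    ring

/-- Partial sums of `addShift a` are twice those of `a` up to the last term. Since that term tends
to zero, one factor 1 + t can be divided out at a time. -/
theorem tendsto_sum_range_of_addShift (h : Tendsto a atTop (𝓝 0)) {L : ℂ} (k : ℕ)
    (hL : Tendsto (fun M => ∑ n ∈ Finset.range M, addShift^[k] a n) atTop (𝓝 (2 ^ k * L))) :
    Tendsto (fun M => ∑ n ∈ Finset.range M, a n) atTop (𝓝 L) := by
  induction k generalizing a L with
  | zero => simpa using hL
  | succ k ih =>
    have h1 := ih (tendsto_addShift h) (L := 2 * L) (by
      rwa [pow_succ, mul_assoc] at hL)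
    rw [← tendsto_add_atTop_iff_nat 1] at h1 ⊢
    have h2 := (h1.add h).const_mul (1 / 2)
    rw [show 1 / 2 * (2 * L + 0) = L by ring] at h2
    refine h2.congr fun M => ?_
    rw [sum_range_addShift]
    ring

theorem tendsto_sum_coeff_wignerGen_one (hs : 0 < s) (h : HasDiscSum a (wignerGen 1 s)) :
    Tendsto (fun M => ∑ n ∈ Finset.range M, a n) atTop (𝓝 (1 / 2)) := by
  refine tendsto_sum_range_of_addShift (tendsto_coeff_wignerGen_one hs h) (4 + 1) ?_
  rw [show (2 : ℂ) ^ (4 + 1) * (1 / 2) = 2 ^ 4 by norm_num]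
  exact (hasSum_addShift_wignerGen hs.le h).2.tendsto_sum_nat

end coefficients

/-! ### Laguerre functions and their generating function. -/

section laguerre

/-- The functions `(-1)ⁿ e^{-s} Lₙ(2s)` (first component), generated by a two-term recurrence. -/
def laguerrePair (s : ℝ) : ℕ → ℝ × ℝ
  | 0 => (Real.exp (-s), 2 * s * Real.exp (-s))
  | n + 1 =>
    let u := (laguerrePair s n).2 / (n + 1) - (laguerrePair s n).1
    (u, 2 * s * u - (laguerrePair s n).2)

/-- The function `(-1)ⁿ e^{-s} Lₙ(2s)`. -/
def laguerreFun (n : ℕ) (s : ℝ) : ℝ := (laguerrePair s n).1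

theorem continuous_laguerrePair (n : ℕ) : Continuous fun s => laguerrePair s n := by
  induction n with
  | zero => simp only [laguerrePair]; fun_prop
  | succ n ih =>
    have h1 := ih.fst
    have h2 := ih.snd
    simp only [laguerrePair]
    fun_prop

theorem continuous_laguerreFun (n : ℕ) : Continuous (laguerreFun n) :=
  (continuous_laguerrePair n).fst

/-- The recurrence of `laguerrePair` determines its solutions up to a factor. -/
theorem eq_laguerrePair {s : ℝ} {u v : ℕ → ℂ} (hv : v 0 = 2 * s * u 0)
    (hu : ∀ n : ℕ, (n + 1) * (u (n + 1) + u n) = v n)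
    (hv' : ∀ n, v (n + 1) = 2 * s * u (n + 1) - v n) (n : ℕ) :
    u n = u 0 * Real.exp s * laguerreFun n s ∧ v n = u 0 * Real.exp s * (laguerrePair s n).2 := by
  have he : (Real.exp s : ℂ) * Real.exp (-s) = 1 := by
    rw [← Complex.ofReal_mul, ← Real.exp_add]
    simp
  induction n with
  | zero =>
    refine ⟨?_, ?_⟩
    · simp only [laguerreFun, laguerrePair]
      rw [mul_assoc, he, mul_one]
    · simp only [laguerrePair]
      rw [hv]
      push_cast at he ⊢
      linear_combination (-(2 * s * u 0)) * he
  | succ n ih =>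
    have hn : (n : ℂ) + 1 ≠ 0 := by exact_mod_cast n.succ_ne_zero
    have h1 : u (n + 1) = u 0 * Real.exp s * laguerreFun (n + 1) s := by
      have h2 : u (n + 1) = v n / (n + 1) - u n := by
        rw [← hu n]
        field_simp
        ring
      rw [h2, ih.1, ih.2]
      simp only [laguerreFun, laguerrePair]
      push_cast
      ring
    refine ⟨h1, ?_⟩
    rw [hv' n, h1, ih.2]
    simp only [laguerreFun, laguerrePair]
    push_cast
    ring

/-- With G = (1 + t) F = `expCayley s` one has (1 + t) G' = 2s F. Its coefficients are the
recurrence of `laguerrePair`, the second component being the coefficients of G'. -/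
theorem hasDiscSum_laguerreFun (s : ℝ) :
    HasDiscSum (fun n => (laguerreFun n s : ℂ)) (wignerGen 1 s) := by
  have hd : DifferentiableOn ℂ (wignerGen 1 s) (Metric.ball 0 1) := fun t ht =>
    (hasDerivAt_wignerGen 1 s (by simpa using ht)).differentiableAt.differentiableWithinAt
  have h := HasDiscSum.of_differentiableOn hd
  set a : ℕ → ℂ := fun n => iteratedDeriv n (wignerGen 1 s) 0 / n.factorial with ha
  have h1 : HasDiscSum (addShift a) (expCayley s) := h.one_add_mul.congr_sum fun t ht => by
    have h0 := one_add_ne_zero ht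
    rw [wignerGen]
    field_simp
  have h2 := (h1.deriv_coeff fun t ht => hasDerivAt_expCayley s ht).one_add_mul
  have h3 := (h2.congr_sum (G := fun t => 2 * s * wignerGen 1 s t) fun t ht => by
    have h0 := one_add_ne_zero ht
    rw [wignerGen]
    field_simp).unique (h.const_mul (2 * s))
  have h4 := eq_laguerrePair (s := s) (u := a) (v := fun n => (n + 1) * (a (n + 1) + a n))
    (by simpa [addShift] using congrFun h3 0) (fun n => rfl) (fun n => by
      have := congrFun h3 (n + 1)
      simp only [addShift] at this
      push_cast at this ⊢
      linear_combination this)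
  have ha0 : a 0 * Real.exp s = 1 := by
    simp [ha, wignerGen, expCayley, cayley, ← Complex.exp_add]
  have : (fun n => (laguerreFun n s : ℂ)) = a := by
    funext n
    rw [(h4 n).1, ha0, one_mul]
  rw [this]
  exact h

end laguerre

/-! ### Hermite functions of one variable and their Wigner transforms. -/

section hermite

open Polynomial

theorem derivative_hermite (n : ℕ) : derivative (hermite n) = n * hermite (n - 1) := by
  induction n with
  | zero => simp
  | succ n ih =>
    rcases n with _ | n
    · simp
    · rw [hermite_succ (n + 1), derivative_sub, derivative_mul, derivative_X, ih]
      simp only [Nat.add_sub_cancel, derivative_mul, derivative_natCast]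
      rw [hermite_succ n]
      push_cast
      ring

/-- The Hermite functions `Heₙ(κx) e^{-(κx)²/4}`. -/
def hermiteFun (κ : ℝ) (n : ℕ) (x : ℝ) : ℝ :=
  aeval (κ * x) (hermite n) * Real.exp (-(κ * x) ^ 2 / 4)

variable (κ : ℝ)

/-- For n = 0 the truncated index `n - 1` is harmless here and below, being multiplied by n. -/
theorem hermiteFun_succ (n : ℕ) (x : ℝ) :
    hermiteFun κ (n + 1) x = κ * x * hermiteFun κ n x - n * hermiteFun κ (n - 1) x := by
  simp only [hermiteFun, hermite_succ, derivative_hermite, map_sub, map_mul, aeval_X, map_natCast]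
  ring

theorem mul_hermiteFun (n : ℕ) (x : ℝ) :
    κ * x * hermiteFun κ n x = hermiteFun κ (n + 1) x + n * hermiteFun κ (n - 1) x := by
  rw [hermiteFun_succ]
  ring

theorem hasDerivAt_hermiteFun (n : ℕ) (x : ℝ) : HasDerivAt (hermiteFun κ n)
    (κ / 2 * (n * hermiteFun κ (n - 1) x - hermiteFun κ (n + 1) x)) x := by
  have h1 : HasDerivAt (fun x => κ * x) κ x := by
    simpa using (hasDerivAt_id' x).const_mul κ
  have h2 : HasDerivAt (fun x => aeval (κ * x) (hermite n))
      (aeval (κ * x) (derivative (hermite n)) * κ) x :=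
    ((hermite n).hasDerivAt_aeval (κ * x)).comp x h1
  refine (h2.mul (((h1.pow 2).neg.div_const 4).exp)).congr_deriv ?_
  rw [hermiteFun_succ, derivative_hermite]
  simp only [hermiteFun, Pi.pow_apply, Pi.neg_apply, map_mul, map_natCast]
  push_cast
  ring

theorem hasDerivAt_deriv_hermiteFun (n : ℕ) (x : ℝ) :
    HasDerivAt (fun x => κ / 2 * (n * hermiteFun κ (n - 1) x - hermiteFun κ (n + 1) x))
      ((κ ^ 4 * x ^ 2 / 4 - κ ^ 2 * (n + 1 / 2)) * hermiteFun κ n x) x := by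
  refine ((((hasDerivAt_hermiteFun κ (n - 1) x).const_mul (n : ℝ)).sub
    (hasDerivAt_hermiteFun κ (n + 1) x)).const_mul (κ / 2)).congr_deriv ?_
  have h1 := mul_hermiteFun κ (n + 1) x
  have h2 := mul_hermiteFun κ n x
  rcases n with _ | n
  · simp only [Nat.add_sub_cancel, Nat.cast_zero] at h1 h2 ⊢
    push_cast at h1 h2 ⊢
    linear_combination (-κ ^ 2 / 4) * h1 + (-κ ^ 3 * x / 4) * h2
  · have h3 := mul_hermiteFun κ n x
    simp only [Nat.add_sub_cancel] at h1 h2 h3 ⊢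
    push_cast at h1 h2 h3 ⊢
    linear_combination (-κ ^ 2 / 4) * h1 + (-κ ^ 3 * x / 4) * h2 + (-κ ^ 2 / 4 * (n + 1)) * h3

theorem continuous_hermiteFun (n : ℕ) : Continuous (hermiteFun κ n) :=
  continuous_iff_continuousAt.2 fun x => (hasDerivAt_hermiteFun κ n x).continuousAt

theorem exists_abs_pow_le_exp_sq {c : ℝ} (hc : 0 < c) (n : ℕ) :
    ∃ C, 0 ≤ C ∧ ∀ y : ℝ, |y| ^ n ≤ C * Real.exp (c * y ^ 2) := by
  -- From |y|^n ≤ 1 + y^(2n) and (c y²)^n / n! ≤ exp (c y²).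
  refine ⟨1 + n.factorial / c ^ n, by positivity, fun y => ?_⟩
  have h1 := Real.pow_div_factorial_le_exp (c * y ^ 2) (by positivity) n
  have h2 : (1 : ℝ) ≤ Real.exp (c * y ^ 2) := Real.one_le_exp (by positivity)
  have h3 : |y| ^ n ≤ 1 + (y ^ 2) ^ n := by
    rw [← sq_abs y, ← pow_mul, mul_comm, pow_mul]
    nlinarith [sq_nonneg (|y| ^ n - 1 / 2)]
  have h4 : (y ^ 2) ^ n ≤ n.factorial / c ^ n * Real.exp (c * y ^ 2) := by
    rw [div_le_iff₀ (by positivity), mul_pow] at h1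
    rw [div_mul_eq_mul_div, le_div_iff₀ (by positivity)]
    linarith
  linarith

theorem exists_abs_aeval_le_exp_sq {c : ℝ} (hc : 0 < c) (p : ℤ[X]) :
    ∃ C, 0 ≤ C ∧ ∀ y : ℝ, |aeval y p| ≤ C * Real.exp (c * y ^ 2) := by
  induction p using Polynomial.induction_on' with
  | add p q hp hq =>
    obtain ⟨C, hC, h1⟩ := hp
    obtain ⟨D, hD, h2⟩ := hq
    refine ⟨C + D, by positivity, fun y => ?_⟩
    rw [map_add, add_mul]
    exact (abs_add_le _ _).trans (add_le_add (h1 y) (h2 y))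
  | monomial n k =>
    obtain ⟨C, hC, h1⟩ := exists_abs_pow_le_exp_sq hc n
    refine ⟨|(k : ℝ)| * C, by positivity, fun y => ?_⟩
    rw [aeval_monomial, abs_mul, abs_pow, mul_assoc]
    simpa using mul_le_mul_of_nonneg_left (h1 y) (abs_nonneg (k : ℝ))

theorem exists_abs_hermiteFun_le (n : ℕ) :
    ∃ C, 0 ≤ C ∧ ∀ x, |hermiteFun κ n x| ≤ C * Real.exp (-(κ * x) ^ 2 / 8) := by
  obtain ⟨C, hC, h⟩ := exists_abs_aeval_le_exp_sq (c := 1 / 8) (by norm_num) (hermite n)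
  refine ⟨C, hC, fun x => ?_⟩
  rw [hermiteFun, abs_mul, Real.abs_exp]
  calc _ ≤ C * Real.exp (1 / 8 * (κ * x) ^ 2) * Real.exp (-(κ * x) ^ 2 / 4) := by
        gcongr
        exact h _
    _ = _ := by
        rw [mul_assoc, ← Real.exp_add]
        ring_nf

variable {κ}

theorem integrable_hermiteFun_mul (hκ : 0 < κ) (m n : ℕ) :
    Integrable fun x => hermiteFun κ m x * hermiteFun κ n x := by
  obtain ⟨C, hC, h1⟩ := exists_abs_hermiteFun_le κ m
  obtain ⟨D, hD, h2⟩ := exists_abs_hermiteFun_le κ n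
  refine Integrable.mono' ((integrable_exp_neg_mul_sq (b := κ ^ 2 / 4) (by positivity)).const_mul
    (C * D)) ((continuous_hermiteFun κ m).mul (continuous_hermiteFun κ n)).aestronglyMeasurable
    (Eventually.of_forall fun x => ?_)
  rw [Real.norm_eq_abs, abs_mul]
  calc _ ≤ (C * Real.exp (-(κ * x) ^ 2 / 8)) * (D * Real.exp (-(κ * x) ^ 2 / 8)) := by
        gcongr
        exacts [h1 x, h2 x]
    _ = C * D * (Real.exp (-(κ * x) ^ 2 / 8) * Real.exp (-(κ * x) ^ 2 / 8)) := by ring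
    _ = _ := by
        rw [← Real.exp_add]
        ring_nf

/-- Raising is adjoint to lowering: add the relation from integrating the derivative of the product
to zero and the one from the symmetry of multiplication by x. -/
theorem integral_hermiteFun_mul_succ (hκ : 0 < κ) (m n : ℕ) :
    ∫ x, hermiteFun κ (m + 1) x * hermiteFun κ n x =
      n * ∫ x, hermiteFun κ m x * hermiteFun κ (n - 1) x := by
  have i1 := integrable_hermiteFun_mul hκ (m + 1) n
  have i2 := (integrable_hermiteFun_mul hκ (m - 1) n).const_mul (m : ℝ)
  have i3 := integrable_hermiteFun_mul hκ m (n + 1)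
  have i4 := (integrable_hermiteFun_mul hκ m (n - 1)).const_mul (n : ℝ)
  have h1 := integral_eq_zero_of_hasDerivAt_of_integrable
    (f' := fun x => κ / 2 * ((m * (hermiteFun κ (m - 1) x * hermiteFun κ n x) -
        hermiteFun κ (m + 1) x * hermiteFun κ n x) +
      (n * (hermiteFun κ m x * hermiteFun κ (n - 1) x) - hermiteFun κ m x * hermiteFun κ (n + 1) x)))
    (fun x => ((hasDerivAt_hermiteFun κ m x).mul (hasDerivAt_hermiteFun κ n x)).congr_deriv
      (by ring)) (((i2.sub' i1).fun_add (i4.sub' i3)).const_mul (κ / 2)) (integrable_hermiteFun_mul hκ m n)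
  rw [integral_const_mul, integral_add (i2.sub' i1) (i4.sub' i3), integral_sub i2 i1,
    integral_sub i4 i3, integral_const_mul, integral_const_mul] at h1
  have h2 : ∫ x, (hermiteFun κ (m + 1) x * hermiteFun κ n x +
      m * (hermiteFun κ (m - 1) x * hermiteFun κ n x)) =
      ∫ x, (hermiteFun κ m x * hermiteFun κ (n + 1) x +
        n * (hermiteFun κ m x * hermiteFun κ (n - 1) x)) := by
    refine integral_congr_ae (Eventually.of_forall fun x => ?_)
    simp only
    linear_combination (-hermiteFun κ n x) * mul_hermiteFun κ m x +
      hermiteFun κ m x * mul_hermiteFun κ n x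
  rw [integral_add i1 i2, integral_add i3 i4, integral_const_mul, integral_const_mul] at h2
  have h3 := (mul_eq_zero.1 h1).resolve_left (by positivity)
  linarith

theorem integral_hermiteFun_mul (hκ : 0 < κ) (m n : ℕ) :
    ∫ x, hermiteFun κ m x * hermiteFun κ n x =
      if m = n then n.factorial * (√(2 * Real.pi) / κ) else 0 := by
  induction m generalizing n with
  | zero =>
    cases n with
    | zero =>
      simp only [hermiteFun, hermite_zero, map_one, one_mul, ← Real.exp_add]
      have : ∀ x : ℝ, -(κ * x) ^ 2 / 4 + -(κ * x) ^ 2 / 4 = -(κ ^ 2 / 2) * x ^ 2 := fun x => by ring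
      simp only [this, integral_gaussian, if_true, Nat.factorial_zero, Nat.cast_one, one_mul]
      rw [show Real.pi / (κ ^ 2 / 2) = 2 * Real.pi / κ ^ 2 by field_simp, Real.sqrt_div (by positivity),
        Real.sqrt_sq hκ.le]
    | succ n =>
      simp only [mul_comm (hermiteFun κ 0 _)]
      rw [integral_hermiteFun_mul_succ hκ]
      simp
  | succ m ih =>
    rw [integral_hermiteFun_mul_succ hκ]
    cases n with
    | zero => simp
    | succ n =>
      rw [ih]
      by_cases h : m = n
      · simp [h, Nat.factorial_succ]
        ring
      · simp [h]

/-- The integrand of the cross Wigner transform of two Hermite functions. -/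
def crossWigner (κ x η : ℝ) (m n : ℕ) (v : ℝ) : ℂ :=
  ((hermiteFun κ m (x + 1 / 2 * v) * hermiteFun κ n (x - 1 / 2 * v) : ℝ) : ℂ) *
    Complex.exp (-(Complex.I * η) * v)

theorem integrable_shift_hermiteFun_mul (hκ : 0 < κ) (x : ℝ) (m n : ℕ) :
    Integrable fun v => hermiteFun κ m (x + 1 / 2 * v) * hermiteFun κ n (x - 1 / 2 * v) := by
  obtain ⟨C, hC, h1⟩ := exists_abs_hermiteFun_le κ m
  obtain ⟨D, hD, h2⟩ := exists_abs_hermiteFun_le κ n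
  refine Integrable.mono' ((integrable_exp_neg_mul_sq (b := κ ^ 2 / 16) (by positivity)).const_mul
    (C * D)) (((continuous_hermiteFun κ m).comp (by fun_prop)).mul
    ((continuous_hermiteFun κ n).comp (by fun_prop))).aestronglyMeasurable
    (Eventually.of_forall fun v => ?_)
  rw [Real.norm_eq_abs, abs_mul]
  calc _ ≤ (C * Real.exp (-(κ * (x + 1 / 2 * v)) ^ 2 / 8)) *
        (D * Real.exp (-(κ * (x - 1 / 2 * v)) ^ 2 / 8)) := by
        gcongr
        exacts [h1 _, h2 _]
    _ = C * D * (Real.exp (-(κ * (x + 1 / 2 * v)) ^ 2 / 8) *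
        Real.exp (-(κ * (x - 1 / 2 * v)) ^ 2 / 8)) := by ring
    _ ≤ _ := by
        rw [← Real.exp_add]
        gcongr
        nlinarith [sq_nonneg (κ * x)]

theorem integrable_crossWigner (hκ : 0 < κ) (x η : ℝ) (m n : ℕ) :
    Integrable (crossWigner κ x η m n) := by
  refine (integrable_shift_hermiteFun_mul hκ x m n).ofReal.mul_bdd (c := 1) ?_ ?_
  · exact Continuous.aestronglyMeasurable (by fun_prop)
  · refine Eventually.of_forall fun v => ?_
    rw [Complex.norm_exp]
    simp

theorem hasDerivAt_crossWigner (x η : ℝ) (m n : ℕ) (v : ℝ) :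
    HasDerivAt (crossWigner κ x η m n)
      (κ / 4 * ((m * crossWigner κ x η (m - 1) n v - crossWigner κ x η (m + 1) n v) -
        (n * crossWigner κ x η m (n - 1) v - crossWigner κ x η m (n + 1) v)) -
        Complex.I * η * crossWigner κ x η m n v) v := by
  have e1 : HasDerivAt (fun v : ℝ => x + 1 / 2 * v) (1 / 2) v := by
    simpa only [mul_one] using ((hasDerivAt_id' v).const_mul (1 / 2)).const_add x
  have e2 : HasDerivAt (fun v : ℝ => x - 1 / 2 * v) (-(1 / 2)) v := by
    simpa only [mul_one] using ((hasDerivAt_id' v).const_mul (1 / 2)).const_sub x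
  have h1 := (((hasDerivAt_hermiteFun κ m _).comp v e1).mul
    ((hasDerivAt_hermiteFun κ n _).comp v e2)).ofReal_comp
  have h2 : HasDerivAt (fun v : ℝ => Complex.exp (-(Complex.I * η) * v))
      (Complex.exp (-(Complex.I * η) * v) * -(Complex.I * η)) v := by
    have := ((hasDerivAt_id' v).ofReal_comp.const_mul (-(Complex.I * η))).cexp
    simpa using this
  refine (h1.mul h2).congr_deriv ?_
  simp only [crossWigner, Function.comp_apply, Pi.mul_apply]
  push_cast
  ring

/-- Two linear relations determine both integrals: the integral of the v-derivative vanishes, and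
the two arguments x ± v/2 add up to 2x. -/
theorem integral_crossWigner_rec (hκ : 0 < κ) (x η : ℝ) (m n : ℕ) :
    (∫ v, crossWigner κ x η (m + 1) n v) =
      κ * (x - 2 * η / κ ^ 2 * Complex.I) * (∫ v, crossWigner κ x η m n v) -
        n * ∫ v, crossWigner κ x η m (n - 1) v ∧
    (∫ v, crossWigner κ x η m (n + 1) v) =
      κ * (x + 2 * η / κ ^ 2 * Complex.I) * (∫ v, crossWigner κ x η m n v) -
        m * ∫ v, crossWigner κ x η (m - 1) n v := by
  have i0 := integrable_crossWigner hκ x η m n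
  have i1 := integrable_crossWigner hκ x η (m + 1) n
  have i2 := (integrable_crossWigner hκ x η (m - 1) n).const_mul (m : ℂ)
  have i3 := integrable_crossWigner hκ x η m (n + 1)
  have i4 := (integrable_crossWigner hκ x η m (n - 1)).const_mul (n : ℂ)
  have h1 := integral_eq_zero_of_hasDerivAt_of_integrable (hasDerivAt_crossWigner (κ := κ) x η m n)
    ((((i2.sub' i1).sub' (i4.sub' i3)).const_mul (κ / 4 : ℂ)).sub (i0.const_mul (Complex.I * η))) i0
  rw [integral_sub (((i2.sub' i1).sub' (i4.sub' i3)).const_mul (κ / 4 : ℂ))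
    (i0.const_mul (Complex.I * η)), integral_const_mul, integral_sub (i2.sub' i1) (i4.sub' i3),
    integral_sub i2 i1, integral_sub i4 i3, integral_const_mul, integral_const_mul,
    integral_const_mul] at h1
  have h2 : ∫ v, ((crossWigner κ x η (m + 1) n v + m * crossWigner κ x η (m - 1) n v) +
      (crossWigner κ x η m (n + 1) v + n * crossWigner κ x η m (n - 1) v)) =
      ∫ v, 2 * κ * x * crossWigner κ x η m n v := by
    refine integral_congr_ae (Eventually.of_forall fun v => ?_)
    have h3 := mul_hermiteFun κ m (x + 1 / 2 * v)
    have h4 := mul_hermiteFun κ n (x - 1 / 2 * v)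
    have h5 : 2 * κ * x * (hermiteFun κ m (x + 1 / 2 * v) * hermiteFun κ n (x - 1 / 2 * v)) =
        (hermiteFun κ (m + 1) (x + 1 / 2 * v) + m * hermiteFun κ (m - 1) (x + 1 / 2 * v)) *
          hermiteFun κ n (x - 1 / 2 * v) + hermiteFun κ m (x + 1 / 2 * v) *
          (hermiteFun κ (n + 1) (x - 1 / 2 * v) + n * hermiteFun κ (n - 1) (x - 1 / 2 * v)) := by
      rw [← h3, ← h4]
      ring
    have h6 := congrArg (fun r : ℝ => (r : ℂ)) h5
    simp only [crossWigner]
    push_cast at h6 ⊢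
    linear_combination (-Complex.exp (-(Complex.I * η) * v)) * h6
  rw [integral_add (i1.fun_add i2) (i3.fun_add i4), integral_add i1 i2, integral_add i3 i4,
    integral_const_mul, integral_const_mul, integral_const_mul] at h2
  have hκ' : (κ : ℂ) ≠ 0 := by exact_mod_cast hκ.ne'
  constructor
  · field_simp
    linear_combination (κ / 2 : ℂ) * h2 - 2 * h1
  · field_simp
    linear_combination (κ / 2 : ℂ) * h2 + 2 * h1

theorem integral_crossWigner_zero (hκ : 0 < κ) (x ξ : ℝ) :
    ∫ v, crossWigner κ x (κ ^ 2 * ξ / 2) 0 0 v =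
      ((√(8 * Real.pi) / κ * Real.exp (-(κ ^ 2 * (x ^ 2 + ξ ^ 2) / 2)) : ℝ) : ℂ) := by
  have h1 := integral_cexp_quadratic (b := ((-(κ ^ 2 / 8) : ℝ) : ℂ))
    (by rw [Complex.ofReal_re]; simp; positivity)
    (-(Complex.I * ((κ ^ 2 * ξ / 2 : ℝ) : ℂ))) ((-(κ ^ 2 * x ^ 2 / 2) : ℝ) : ℂ)
  have h2 : ∀ v : ℝ, crossWigner κ x (κ ^ 2 * ξ / 2) 0 0 v =
      Complex.exp (((-(κ ^ 2 / 8) : ℝ) : ℂ) * v ^ 2 + -(Complex.I * ((κ ^ 2 * ξ / 2 : ℝ) : ℂ)) * v +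
        ((-(κ ^ 2 * x ^ 2 / 2) : ℝ) : ℂ)) := fun v => by
    simp only [crossWigner, hermiteFun, hermite_zero, map_one, one_mul, ← Real.exp_add]
    rw [Complex.ofReal_exp, ← Complex.exp_add]
    congr 1
    push_cast
    ring
  simp only [h2]
  rw [h1, Complex.ofReal_mul, Complex.ofReal_exp]
  have hκ' : (κ : ℂ) ≠ 0 := by exact_mod_cast hκ.ne'
  congr 1
  · rw [← Complex.ofReal_neg, neg_neg, ← Complex.ofReal_div,
      show (1 / 2 : ℂ) = ((1 / 2 : ℝ) : ℂ) by push_cast; rfl, ← Complex.ofReal_cpow (by positivity),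
      ← Real.sqrt_eq_rpow, show Real.pi / (κ ^ 2 / 8) = 8 * Real.pi / κ ^ 2 by field_simp,
      Real.sqrt_div (by positivity), Real.sqrt_sq hκ.le]
  · congr 1
    push_cast
    field_simp
    ring_nf
    rw [Complex.I_sq]
    ring

/-- The Wigner transform of a Hermite function is a Laguerre function. -/
theorem integral_crossWigner_self (hκ : 0 < κ) (x ξ : ℝ) (n : ℕ) :
    ∫ v, crossWigner κ x (κ ^ 2 * ξ / 2) n n v =
      ((√(8 * Real.pi) / κ * n.factorial * laguerreFun n (κ ^ 2 * (x ^ 2 + ξ ^ 2) / 2) : ℝ) : ℂ) := by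
  set s := κ ^ 2 * (x ^ 2 + ξ ^ 2) / 2 with hs
  set J : ℕ → ℕ → ℂ := fun m n => ∫ v, crossWigner κ x (κ ^ 2 * ξ / 2) m n v with hJ
  have hκ' : (κ : ℂ) ≠ 0 := by exact_mod_cast hκ.ne'
  have hrec := integral_crossWigner_rec hκ x (κ ^ 2 * ξ / 2)
  have e1 : (2 * ((κ ^ 2 * ξ / 2 : ℝ) : ℂ) / κ ^ 2) = ξ := by
    push_cast
    field_simp
  rw [e1] at hrec
  have r1 : ∀ m n, J (m + 1) n = κ * (x - ξ * Complex.I) * J m n - n * J m (n - 1) :=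
    fun m n => (hrec m n).1
  have r2 : ∀ m n, J m (n + 1) = κ * (x + ξ * Complex.I) * J m n - m * J (m - 1) n :=
    fun m n => (hrec m n).2
  have hy : (κ * (x - ξ * Complex.I)) * (κ * (x + ξ * Complex.I)) = 2 * (s : ℂ) := by
    rw [hs]
    push_cast
    linear_combination (-(κ ^ 2 * ξ ^ 2) : ℂ) * Complex.I_sq
  have hf : ∀ n : ℕ, (n.factorial : ℂ) ≠ 0 := fun n => by exact_mod_cast n.factorial_ne_zero
  -- The diagonal entries J n n / n!, together with suitably scaled entries J n (n+1), form a closed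
  -- first order system, because the two ladder factors multiply to 2s. It is the system defining
  -- `laguerrePair`.
  have h := (eq_laguerrePair (s := s) (u := fun n => J n n / n.factorial)
    (v := fun n => κ * (x - ξ * Complex.I) * J n (n + 1) / n.factorial)
    (by
      simp only [r2 0 0, Nat.factorial_zero, Nat.cast_zero, Nat.cast_one, div_one]
      linear_combination J 0 0 * hy)
    (fun n => by
      have := hf n
      have hn : (n : ℂ) + 1 ≠ 0 := by exact_mod_cast n.succ_ne_zero
      simp only [r1 n (n + 1), Nat.factorial_succ, Nat.add_sub_cancel]
      push_cast
      field_simp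
      ring)
    (fun n => by
      have := hf n
      have hn : (n : ℂ) + 1 ≠ 0 := by exact_mod_cast n.succ_ne_zero
      simp only [r2 (n + 1) (n + 1), Nat.factorial_succ, Nat.add_sub_cancel]
      push_cast
      field_simp
      linear_combination J (n + 1) (n + 1) * hy) n).1
  rw [div_eq_iff (hf n)] at h
  change J n n = _
  rw [h]
  have h0 : J 0 0 = ((√(8 * Real.pi) / κ * Real.exp (-s) : ℝ) : ℂ) :=
    integral_crossWigner_zero hκ x ξ
  rw [h0]
  have he : (Real.exp s : ℂ) * Real.exp (-s) = 1 := by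
    rw [← Complex.ofReal_mul, ← Real.exp_add]
    simp
  simp only [Nat.factorial_zero, Nat.cast_one, div_one]
  push_cast at he ⊢
  linear_combination ((√(8 * Real.pi) : ℝ) / κ * n.factorial * laguerreFun n s : ℂ) * he

end hermite

/-! ### Gaussians as Schwartz functions. -/

section gaussian

variable {E : Type*} [NormedAddCommGroup E] [InnerProductSpace ℝ E]

theorem hasTemperateGrowth_const_mul_norm_sq (c : ℝ) :
    Function.HasTemperateGrowth fun x : E => c * ‖x‖ ^ 2 := by
  fun_prop

/-- By the chain rule bound for higher derivatives, each derivative is at most a power of 1 + ‖x‖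
times the Gaussian. That power is at most a constant times exp (c (1 + ‖x‖)²/4), and (1 + ‖x‖)² ≤ 2
+ 2‖x‖². -/
theorem exists_pow_mul_norm_iteratedFDeriv_exp_le {c : ℝ} (hc : 0 < c) (k n : ℕ) :
    ∃ C : ℝ, ∀ x : E,
      ‖x‖ ^ k * ‖iteratedFDeriv ℝ n (fun x : E => Real.exp (-c * ‖x‖ ^ 2)) x‖ ≤ C := by
  have hq := hasTemperateGrowth_const_mul_norm_sq (E := E) (-c)
  obtain ⟨l, A, hA, hb⟩ := hq.norm_iteratedFDeriv_le_uniform n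
  obtain ⟨K, hK, hexp⟩ := exists_abs_pow_le_exp_sq (c := c / 4) (by positivity) (k + l * n)
  refine ⟨n.factorial * (1 + A) ^ n * (K * Real.exp (c / 2)), fun x => ?_⟩
  have h1 := norm_iteratedFDeriv_comp_le (𝕜 := ℝ) (g := Real.exp) (f := fun x : E => -c * ‖x‖ ^ 2)
    (n := n) (N := n) Real.contDiff_exp (hq.1.of_le (by exact_mod_cast le_top)) le_rfl x
    (C := Real.exp (-c * ‖x‖ ^ 2)) (D := (1 + A) * (1 + ‖x‖) ^ l)
    (fun i _ => by
      rw [norm_iteratedFDeriv_eq_norm_iteratedDeriv, iteratedDeriv_eq_iterate, Real.iter_deriv_exp,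
        Real.norm_eq_abs, Real.abs_exp])
    (fun i hi hin => by
      refine (hb i hin x).trans ?_
      have h2 : 1 ≤ (1 + A) * (1 + ‖x‖) ^ l :=
        one_le_mul_of_one_le_of_one_le (by linarith) (one_le_pow₀ (by linarith [norm_nonneg x]))
      refine le_trans ?_ (le_self_pow₀ h2 (by omega))
      gcongr
      linarith)
  have h3 : ‖x‖ ^ k ≤ (1 + ‖x‖) ^ k := by gcongr; linarith
  have h4 := hexp (1 + ‖x‖)
  rw [abs_of_nonneg (by positivity)] at h4
  calc ‖x‖ ^ k * ‖iteratedFDeriv ℝ n (fun x : E => Real.exp (-c * ‖x‖ ^ 2)) x‖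
      ≤ (1 + ‖x‖) ^ k * (n.factorial * Real.exp (-c * ‖x‖ ^ 2) * ((1 + A) * (1 + ‖x‖) ^ l) ^ n) := by
        gcongr
        exact h1
    _ = n.factorial * (1 + A) ^ n * ((1 + ‖x‖) ^ (k + l * n) * Real.exp (-c * ‖x‖ ^ 2)) := by
        rw [mul_pow, pow_add, pow_mul]
        ring
    _ ≤ n.factorial * (1 + A) ^ n *
        (K * Real.exp (c / 4 * (1 + ‖x‖) ^ 2) * Real.exp (-c * ‖x‖ ^ 2)) := by gcongr
    _ ≤ _ := by
        rw [mul_assoc K, ← Real.exp_add]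
        gcongr
        nlinarith [sq_nonneg (1 - ‖x‖), sq_nonneg ‖x‖]

/-- The Gaussian `exp (-c ‖x‖²)` as a Schwartz function. -/
def gaussianSchwartz (E : Type*) [NormedAddCommGroup E] [InnerProductSpace ℝ E] {c : ℝ}
    (hc : 0 < c) : 𝓢(E, ℂ) :=
  SchwartzMap.postcompCLM (𝕜 := ℝ) Complex.ofRealCLM
    { toFun := fun x => Real.exp (-c * ‖x‖ ^ 2)
      smooth' := (hasTemperateGrowth_const_mul_norm_sq (-c)).1.exp
      decay' := exists_pow_mul_norm_iteratedFDeriv_exp_le hc }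

theorem gaussianSchwartz_apply {c : ℝ} (hc : 0 < c) (x : E) :
    gaussianSchwartz E hc x = (Real.exp (-c * ‖x‖ ^ 2) : ℂ) := by
  rw [gaussianSchwartz, SchwartzMap.postcompCLM_apply]
  rfl

end gaussian

/-! ### Product Hermite functions on ℝ^d. -/

section hermite

open Polynomial

variable {d : ℕ} {κ : ℝ}

/-- The product Hermite functions on `ℝ^d`. -/
def hermiteProd (κ : ℝ) (α : Fin d → ℕ) (x : Space d) : ℝ := ∏ j, hermiteFun κ (α j) (x j)

theorem hermiteProd_eq (κ : ℝ) (α : Fin d → ℕ) (x : Space d) :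
    hermiteProd κ α x =
      (∏ j, aeval (κ * x j) (hermite (α j))) * Real.exp (-(κ ^ 2 / 4) * ‖x‖ ^ 2) := by
  simp only [hermiteProd, hermiteFun, Finset.prod_mul_distrib]
  rw [← Real.exp_sum, EuclideanSpace.real_norm_sq_eq, Finset.mul_sum]
  congr 2
  exact Finset.sum_congr rfl fun j _ => by ring

theorem continuous_hermiteProd (κ : ℝ) (α : Fin d → ℕ) : Continuous (hermiteProd κ α) := by
  refine continuous_finsetProd _ fun j _ => (continuous_hermiteFun κ (α j)).comp ?_
  fun_prop

theorem hasTemperateGrowth_aeval (p : ℤ[X]) : Function.HasTemperateGrowth fun y : ℝ => aeval y p := by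
  induction p using Polynomial.induction_on' with
  | add p q hp hq => 
    simp only [map_add]
    exact hp.add hq
  | monomial n k =>
    simp only [aeval_monomial]
    fun_prop

theorem hasTemperateGrowth_finset_prod {E ι : Type*} [NormedAddCommGroup E] [NormedSpace ℝ E]
    {s : Finset ι} {f : ι → E → ℝ} (h : ∀ i ∈ s, (f i).HasTemperateGrowth) :
    Function.HasTemperateGrowth fun x => ∏ i ∈ s, f i x := by
  classical
  induction s using Finset.induction_on with
  | empty => simp
  | insert i s hi ih =>
    simp only [Finset.prod_insert hi]
    exact (h i (Finset.mem_insert_self i s)).mul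
      (ih fun j hj => h j (Finset.mem_insert_of_mem hj))

theorem hasTemperateGrowth_prod_hermite (κ : ℝ) (α : Fin d → ℕ) : Function.HasTemperateGrowth
    fun x : Space d => ((∏ j, aeval (κ * x j) (hermite (α j)) : ℝ) : ℂ) := by
  refine Function.Complex.hasTemperateGrowth_ofReal.comp (hasTemperateGrowth_finset_prod fun j _ => ?_)
  refine (hasTemperateGrowth_aeval _).comp ?_
  exact (κ • (EuclideanSpace.proj j : Space d →L[ℝ] ℝ)).hasTemperateGrowth

/-- The product Hermite functions as Schwartz functions. -/
def hermiteSchwartz (hκ : 0 < κ) (α : Fin d → ℕ) : 𝓢(Space d, ℂ) :=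
  SchwartzMap.smulLeftCLM ℂ
    (fun x : Space d => ((∏ j, aeval (κ * x j) (hermite (α j)) : ℝ) : ℂ))
    (gaussianSchwartz (Space d) (c := κ ^ 2 / 4) (by positivity))

theorem hermiteSchwartz_apply (hκ : 0 < κ) (α : Fin d → ℕ) (x : Space d) :
    hermiteSchwartz hκ α x = (hermiteProd κ α x : ℂ) := by
  rw [hermiteSchwartz, SchwartzMap.smulLeftCLM_apply_apply (hasTemperateGrowth_prod_hermite κ α),
    gaussianSchwartz_apply, hermiteProd_eq, smul_eq_mul, Complex.ofReal_mul]

theorem hasLineDerivAt_mul_prod_erase {g : ℝ → ℝ} {g' : ℝ} (f : Fin d → ℝ → ℝ) (j : Fin d)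
    (x : Space d) (hg : HasDerivAt g g' (x j)) :
    HasLineDerivAt ℝ
      (fun y : Space d => ((g (y j) * ∏ i ∈ Finset.univ.erase j, f i (y i) : ℝ) : ℂ))
      ((g' * ∏ i ∈ Finset.univ.erase j, f i (x i) : ℝ) : ℂ) x (EuclideanSpace.single j 1) := by
  rw [HasLineDerivAt]
  have h1 : HasDerivAt (fun t : ℝ => g (x j + t)) g' 0 := by
    refine HasDerivAt.comp_const_add (x j) 0 ?_
    simpa using hg
  refine (h1.mul_const (∏ i ∈ Finset.univ.erase j, f i (x i))).ofReal_comp.congr_of_eventuallyEq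
    (Eventually.of_forall fun t => ?_)
  simp only [PiLp.add_apply, PiLp.smul_apply, PiLp.single_apply, if_true, smul_eq_mul, mul_one]
  congr 2
  refine Finset.prod_congr rfl fun i hi => ?_
  simp [(Finset.mem_erase.1 hi).1]

theorem lineDeriv_lineDeriv_hermiteSchwartz (hκ : 0 < κ) (α : Fin d → ℕ) (j : Fin d) (x : Space d) :
    LineDeriv.lineDerivOp (EuclideanSpace.single j (1 : ℝ) : Space d)
      (LineDeriv.lineDerivOp (EuclideanSpace.single j (1 : ℝ) : Space d) (hermiteSchwartz hκ α)) x =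
      ((κ ^ 4 * x j ^ 2 / 4 - κ ^ 2 * (α j + 1 / 2) : ℝ) : ℂ) * hermiteSchwartz hκ α x := by
  have e0 : ∀ y : Space d, hermiteProd κ α y = hermiteFun κ (α j) (y j) *
      ∏ i ∈ Finset.univ.erase j, hermiteFun κ (α i) (y i) := fun y =>
    (Finset.mul_prod_erase Finset.univ (fun i => hermiteFun κ (α i) (y i)) (Finset.mem_univ j)).symm
  have e1 : ∀ y : Space d, LineDeriv.lineDerivOp (EuclideanSpace.single j (1 : ℝ) : Space d)
      (hermiteSchwartz hκ α) y =
      ((κ / 2 * (α j * hermiteFun κ (α j - 1) (y j) - hermiteFun κ (α j + 1) (y j)) *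
        ∏ i ∈ Finset.univ.erase j, hermiteFun κ (α i) (y i) : ℝ) : ℂ) := fun y => by
    rw [SchwartzMap.lineDerivOp_apply]
    have : (hermiteSchwartz hκ α : Space d → ℂ) = fun y => ((hermiteFun κ (α j) (y j) *
        ∏ i ∈ Finset.univ.erase j, hermiteFun κ (α i) (y i) : ℝ) : ℂ) := by
      funext y
      rw [hermiteSchwartz_apply, e0]
    rw [this]
    exact (hasLineDerivAt_mul_prod_erase (fun i => hermiteFun κ (α i)) j y
      (hasDerivAt_hermiteFun κ (α j) (y j))).lineDeriv
  rw [SchwartzMap.lineDerivOp_apply, funext e1, hermiteSchwartz_apply, e0, ← Complex.ofReal_mul,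
    ← mul_assoc]
  exact (hasLineDerivAt_mul_prod_erase (fun i => hermiteFun κ (α i)) j x
      (hasDerivAt_deriv_hermiteFun κ (α j) (x j))).lineDeriv

theorem laplacian_hermiteSchwartz (hκ : 0 < κ) (α : Fin d → ℕ) (x : Space d) :
    Δ (hermiteSchwartz hκ α) x =
      ((κ ^ 4 * ‖x‖ ^ 2 / 4 - κ ^ 2 * (∑ j, α j + d / 2) : ℝ) : ℂ) * hermiteSchwartz hκ α x := by
  rw [SchwartzMap.laplacian_eq_sum (EuclideanSpace.basisFun (Fin d) ℝ), sum_apply]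
  simp only [EuclideanSpace.basisFun_apply, lineDeriv_lineDeriv_hermiteSchwartz]
  rw [← Finset.sum_mul, ← Complex.ofReal_sum, Finset.sum_sub_distrib, ← Finset.mul_sum,
    Finset.sum_add_distrib, EuclideanSpace.real_norm_sq_eq, Finset.mul_sum, Finset.sum_div]
  simp
  ring_nf
  simp

theorem integral_prod_space {𝕜 : Type*} [RCLike 𝕜] (f : Fin d → ℝ → 𝕜) :
    ∫ x : Space d, ∏ j, f j (x j) = ∏ j, ∫ y, f j y := by
  rw [← integral_fintype_prod_volume_eq_prod f,
    ← (PiLp.volume_preserving_toLp (Fin d)).integral_comp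
      (MeasurableEquiv.toLp 2 (Fin d → ℝ)).measurableEmbedding]

theorem integrable_prod_space {𝕜 : Type*} [RCLike 𝕜] {f : Fin d → ℝ → 𝕜}
    (hf : ∀ j, Integrable (f j)) : Integrable fun x : Space d => ∏ j, f j (x j) := by
  rw [← (PiLp.volume_preserving_toLp (Fin d)).integrable_comp_emb
      (MeasurableEquiv.toLp 2 (Fin d → ℝ)).measurableEmbedding]
  exact Integrable.fintype_prod hf

/-- The squared `L²` norm of `hermiteProd κ α`. -/
def hermiteNormSq (κ : ℝ) (α : Fin d → ℕ) : ℝ :=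
  ∏ j, ((α j).factorial * (√(2 * Real.pi) / κ))

theorem hermiteNormSq_pos (hκ : 0 < κ) (α : Fin d → ℕ) : 0 < hermiteNormSq κ α :=
  Finset.prod_pos fun j _ => by
    have := (α j).factorial_pos
    positivity

theorem integral_hermiteProd_mul (hκ : 0 < κ) (α β : Fin d → ℕ) :
    ∫ x, hermiteProd κ α x * hermiteProd κ β x = if α = β then hermiteNormSq κ α else 0 := by
  simp only [hermiteProd, ← Finset.prod_mul_distrib]
  rw [integral_prod_space (fun j y => hermiteFun κ (α j) y * hermiteFun κ (β j) y)]
  simp only [integral_hermiteFun_mul hκ]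
  split_ifs with h
  · subst h
    simp [hermiteNormSq]
  · obtain ⟨j, hj⟩ := Function.ne_iff.1 h
    exact Finset.prod_eq_zero (Finset.mem_univ j) (if_neg hj)

end hermite

/-! ### Totality of the Hermite functions in L². -/

section completeness

variable {d : ℕ} {κ : ℝ}

theorem integrable_schwartz_mul (f : 𝓢(Space d, ℂ)) (ψ : L2 d) :
    Integrable fun x => f x * ψ x :=
  (f.memLp 2 volume).integrable_mul (Lp.memLp ψ)

/-- An integrable function with vanishing Fourier transform vanishes almost everywhere. -/
theorem ae_eq_zero_of_fourier_eq_zero {f : Space d → ℂ} (hf : Integrable f)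
    (h : ∀ η : Space d, ∫ x, Complex.exp (((⟪x, η⟫_ℝ : ℝ) : ℂ) * Complex.I) * f x = 0) :
    ∀ᵐ x, f x = 0 := by
  have hF : FourierTransform.fourier f = 0 := by
    funext w
    rw [Real.fourier_eq', Pi.zero_apply, ← h ((-2 * Real.pi) • w)]
    refine integral_congr_ae (Eventually.of_forall fun x => ?_)
    simp [inner_smul_right]
  -- Writing g as the Fourier transform of its inverse transform, the transform moves onto f and the
  -- pairing vanishes.
  have hS : ∀ g : 𝓢(Space d, ℂ), ∫ x, f x * g x = 0 := fun g => by
    have h1 := VectorFourier.integral_fourierIntegral_smul_eq_flip (L := innerₗ (Space d))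
      Real.continuous_fourierChar continuous_inner hf
      (FourierTransformInv.fourierInv g : 𝓢(Space d, ℂ)).integrable (μ := volume) (ν := volume)
    have h2 : ∀ x, VectorFourier.fourierIntegral Real.fourierChar volume (innerₗ (Space d)).flip
        (FourierTransformInv.fourierInv g : 𝓢(Space d, ℂ)) x = g x := fun x => by
      rw [flip_innerₗ]
      have h3 : FourierTransform.fourier (FourierTransformInv.fourierInv g) = g :=
        FourierTransform.fourier_fourierInv_eq g
      conv_rhs => rw [← h3]
      rfl
    have h4 : ∀ x, VectorFourier.fourierIntegral Real.fourierChar volume (innerₗ (Space d)) f x = 0 :=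
      fun x => congrFun hF x
    simp only [h2, h4, smul_eq_mul, zero_mul, integral_zero] at h1
    exact h1.symm
  refine ae_eq_zero_of_integral_contDiff_smul_eq_zero hf.locallyIntegrable fun g hg hgc => ?_
  have hgc' : HasCompactSupport fun x => (g x : ℂ) := hgc.comp_left Complex.ofReal_zero
  have := hS (hgc'.toSchwartzMap (Complex.ofRealCLM.contDiff.comp hg))
  rw [← this]
  refine integral_congr_ae (Eventually.of_forall fun x => ?_)
  change g x • f x = f x * (g x : ℂ)
  rw [Complex.real_smul, mul_comm]

/-- The span of the product Hermite functions. -/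
def hermiteSpan (d : ℕ) (κ : ℝ) : Submodule ℝ (Space d → ℝ) :=
  Submodule.span ℝ (Set.range (hermiteProd κ))

theorem coord_mul_hermiteProd (hκ : 0 < κ) (α : Fin d → ℕ) (j : Fin d) (x : Space d) :
    x j * hermiteProd κ α x = κ⁻¹ * hermiteProd κ (Function.update α j (α j + 1)) x +
      (κ⁻¹ * α j) * hermiteProd κ (Function.update α j (α j - 1)) x := by
  have e : ∀ n, hermiteProd κ (Function.update α j n) x = hermiteFun κ n (x j) *
      ∏ i ∈ Finset.univ.erase j, hermiteFun κ (α i) (x i) := fun n => by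
    rw [hermiteProd, ← Finset.mul_prod_erase Finset.univ _ (Finset.mem_univ j)]
    simp only [Function.update_self]
    congr 1
    refine Finset.prod_congr rfl fun i hi => ?_
    rw [Function.update_of_ne (Finset.mem_erase.1 hi).1]
  have e0 := e (α j)
  rw [Function.update_eq_self] at e0
  rw [e0, e, e]
  have h := mul_hermiteFun κ (α j) (x j)
  have := hκ.ne'
  field_simp
  linear_combination (∏ i ∈ Finset.univ.erase j, hermiteFun κ (α i) (x i)) * h

theorem coord_mul_mem_hermiteSpan (hκ : 0 < κ) (j : Fin d) {f : Space d → ℝ}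
    (hf : f ∈ hermiteSpan d κ) : (fun x => x j * f x) ∈ hermiteSpan d κ := by
  induction hf using Submodule.span_induction with
  | mem f hf =>
    obtain ⟨α, rfl⟩ := hf
    simp only [coord_mul_hermiteProd hκ]
    exact add_mem (Submodule.smul_mem _ κ⁻¹ (Submodule.subset_span ⟨_, rfl⟩))
      (Submodule.smul_mem _ (κ⁻¹ * α j) (Submodule.subset_span ⟨_, rfl⟩))
  | zero =>
    simp only [Pi.zero_apply, mul_zero]
    exact Submodule.zero_mem (hermiteSpan d κ)
  | add f g _ _ hf hg =>
    simp only [Pi.add_apply, mul_add]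
    exact add_mem hf hg
  | smul c f _ hf =>
    simp only [Pi.smul_apply, smul_eq_mul, mul_left_comm _ c]
    exact Submodule.smul_mem _ c hf

/-- These are the terms of the power series of a plane wave times the ground state; they stay in the
span because it is stable under multiplication by coordinates. -/
theorem inner_pow_mul_mem_hermiteSpan (hκ : 0 < κ) (η : Space d) (k : ℕ) :
    (fun x => ⟪x, η⟫_ℝ ^ k * hermiteProd κ 0 x) ∈ hermiteSpan d κ := by
  induction k with
  | zero =>
    simp only [pow_zero, one_mul]
    exact Submodule.subset_span ⟨0, rfl⟩
  | succ k ih =>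
    have : (fun x : Space d => ⟪x, η⟫_ℝ ^ (k + 1) * hermiteProd κ 0 x) =
        ∑ j, η j • fun x : Space d => x j * (⟪x, η⟫_ℝ ^ k * hermiteProd κ 0 x) := by
      funext x
      simp only [Finset.sum_apply, Pi.smul_apply, smul_eq_mul]
      have e : ⟪x, η⟫_ℝ = ∑ j, η j * x j := by simp [PiLp.inner_apply]
      rw [pow_succ', mul_assoc]
      generalize ⟪x, η⟫_ℝ ^ k * hermiteProd κ 0 x = r
      rw [e, Finset.sum_mul]
      exact Finset.sum_congr rfl fun j _ => mul_assoc _ _ _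
    rw [this]
    exact Submodule.sum_mem _ fun j _ => Submodule.smul_mem _ _ (coord_mul_mem_hermiteSpan hκ j ih)

theorem hermiteProd_zero (κ : ℝ) (x : Space d) :
    hermiteProd κ 0 x = Real.exp (-(κ ^ 2 / 4) * ‖x‖ ^ 2) := by
  simp [hermiteProd_eq]

/-- Half of the Gaussian exponent absorbs ‖x‖ ‖η‖ by completing the square. It gives the dominating
function for the plane wave series. -/
theorem exp_mul_hermiteProd_zero_le (hκ : 0 < κ) (η x : Space d) :
    Real.exp |⟪x, η⟫_ℝ| * hermiteProd κ 0 x ≤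
      Real.exp (2 * ‖η‖ ^ 2 / κ ^ 2) * Real.exp (-(κ ^ 2 / 8) * ‖x‖ ^ 2) := by
  rw [hermiteProd_zero, ← Real.exp_add, ← Real.exp_add, Real.exp_le_exp]
  have h1 := abs_real_inner_le_norm x η
  have h2 : ‖x‖ * ‖η‖ ≤ κ ^ 2 / 8 * ‖x‖ ^ 2 + 2 * ‖η‖ ^ 2 / κ ^ 2 := by
    have h3 : κ ^ 2 / 8 * ‖x‖ ^ 2 + 2 * ‖η‖ ^ 2 / κ ^ 2 - ‖x‖ * ‖η‖ =
        1 / 8 * (κ * ‖x‖ - 4 * ‖η‖ / κ) ^ 2 := by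
      field_simp
      ring
    nlinarith [sq_nonneg (κ * ‖x‖ - 4 * ‖η‖ / κ)]
  linarith

/-- The product Hermite functions are total in `L²`. -/
theorem eq_zero_of_forall_integral_hermite_eq_zero (hκ : 0 < κ) (ψ : L2 d)
    (h : ∀ α, ∫ x, hermiteSchwartz hκ α x * ψ x = 0) : ψ = 0 := by
  have hspan : ∀ f ∈ hermiteSpan d κ, Integrable (fun x => (f x : ℂ) * ψ x) ∧
      ∫ x, (f x : ℂ) * ψ x = 0 := fun f hf => by
    induction hf using Submodule.span_induction with
    | mem f hf =>
      obtain ⟨α, rfl⟩ := hf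
      simp only [← hermiteSchwartz_apply hκ]
      exact ⟨integrable_schwartz_mul _ ψ, h α⟩
    | zero => simp
    | add f g _ _ hf hg =>
      simp only [Pi.add_apply, Complex.ofReal_add, add_mul]
      exact ⟨hf.1.add hg.1, by rw [integral_add hf.1 hg.1, hf.2, hg.2, add_zero]⟩
    | smul c f _ hf =>
      simp only [Pi.smul_apply, smul_eq_mul, Complex.ofReal_mul, mul_assoc]
      exact ⟨hf.1.const_mul _, by rw [integral_const_mul, hf.2, mul_zero]⟩
  -- The Fourier transform of the ground state times ψ vanishes: expand the plane wave, integrate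
  -- termwise, and each term is zero by `hspan`. As the ground state has no zeros, ψ vanishes.
  have hae : ∀ᵐ x, (hermiteProd κ 0 x : ℂ) * ψ x = 0 := by
    refine ae_eq_zero_of_fourier_eq_zero
      (hspan _ (Submodule.subset_span ⟨0, rfl⟩)).1 fun η => ?_
    have hg := (integrable_schwartz_mul
      (gaussianSchwartz (Space d) (c := κ ^ 2 / 8) (by positivity)) ψ).norm.const_mul
      (Real.exp (2 * ‖η‖ ^ 2 / κ ^ 2))
    have hexp : ∀ r : ℝ, HasSum (fun k : ℕ => |r| ^ k / k.factorial) (Real.exp |r|) := fun r => by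
      rw [Real.exp_eq_exp_ℝ]
      exact NormedSpace.exp_series_hasSum_exp' (𝕂 := ℝ) |r| |>.congr_fun fun k => by
        rw [smul_eq_mul, div_eq_inv_mul]
    have hcexp : ∀ z : ℂ, HasSum (fun k : ℕ => z ^ k / k.factorial) (Complex.exp z) := fun z => by
      rw [Complex.exp_eq_exp_ℂ]
      exact NormedSpace.expSeries_div_hasSum_exp z
    have hψ : AEStronglyMeasurable ψ volume := (Lp.memLp ψ).1
    have hsum := hasSum_integral_of_dominated_convergence (μ := (volume : Measure (Space d)))
      (F := fun (k : ℕ) x => ((((⟪x, η⟫_ℝ : ℝ) : ℂ) * Complex.I) ^ k / k.factorial) *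
        ((hermiteProd κ 0 x : ℂ) * ψ x))
      (f := fun x => Complex.exp (((⟪x, η⟫_ℝ : ℝ) : ℂ) * Complex.I) *
        ((hermiteProd κ 0 x : ℂ) * ψ x))
      (fun k x => |⟪x, η⟫_ℝ| ^ k / k.factorial * ‖(hermiteProd κ 0 x : ℂ) * ψ x‖)
      (fun k => by
        refine AEStronglyMeasurable.mul (Continuous.aestronglyMeasurable (by fun_prop))
          (AEStronglyMeasurable.mul (Continuous.aestronglyMeasurable ?_) hψ)
        exact Complex.continuous_ofReal.comp (continuous_hermiteProd κ 0))
      (fun k => Eventually.of_forall fun x => by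
        rw [norm_mul, norm_div, norm_pow, norm_mul, Complex.norm_real, Complex.norm_I, mul_one,
          Complex.norm_natCast, Real.norm_eq_abs])
      (Eventually.of_forall fun x => (hexp _).summable.mul_right _)
      (by
        simp only [tsum_mul_right, (hexp _).tsum_eq]
        refine hg.mono' ?_ (Eventually.of_forall fun x => ?_)
        · refine AEStronglyMeasurable.mul (Continuous.aestronglyMeasurable (by fun_prop))
            (AEStronglyMeasurable.norm (AEStronglyMeasurable.mul
              (Continuous.aestronglyMeasurable ?_) hψ))
          exact Complex.continuous_ofReal.comp (continuous_hermiteProd κ 0)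
        · have h0 : 0 ≤ hermiteProd κ 0 x := by rw [hermiteProd_zero]; positivity
          rw [norm_mul, norm_norm, Real.norm_eq_abs, Real.abs_exp, norm_mul, norm_mul,
            gaussianSchwartz_apply, Complex.norm_real, Complex.norm_real, Real.norm_of_nonneg h0,
            Real.norm_of_nonneg (Real.exp_pos _).le, ← mul_assoc, ← mul_assoc]
          exact mul_le_mul_of_nonneg_right (exp_mul_hermiteProd_zero_le hκ η x) (norm_nonneg _))
      (Eventually.of_forall fun x => (hcexp _).mul_right _)
    refine hsum.unique ?_
    convert hasSum_zero with k
    have h1 := (hspan _ (inner_pow_mul_mem_hermiteSpan hκ η k)).2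
    calc _ = ∫ x, (Complex.I ^ k / k.factorial) *
          (((⟪x, η⟫_ℝ ^ k * hermiteProd κ 0 x : ℝ) : ℂ) * ψ x) := by
          refine integral_congr_ae (Eventually.of_forall fun x => ?_)
          simp only
          push_cast
          ring
      _ = 0 := by rw [integral_const_mul, h1, mul_zero]
  rw [Lp.eq_zero_iff_ae_eq_zero]
  filter_upwards [hae] with x hx
  refine (mul_eq_zero.1 hx).resolve_left ?_
  rw [hermiteProd_zero]
  exact_mod_cast (Real.exp_pos _).ne'

end completeness

/-! ### Eigenspaces and spectral projections in terms of Hermite functions. -/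

section eigenspace

variable {d : ℕ} {κ ħ : ℝ}

theorem hamiltonian_hermiteSchwartz (hκ : 0 < κ) (hħ : κ ^ 2 * ħ = 2) (α : Fin d → ℕ)
    (x : Space d) :
    -((ħ : ℂ) ^ 2 / 2) * Δ (hermiteSchwartz hκ α) x +
      ((‖x‖ ^ 2 / 2 : ℝ) : ℂ) * hermiteSchwartz hκ α x =
      (energy d ħ (∑ j, α j) : ℂ) * hermiteSchwartz hκ α x := by
  rw [laplacian_hermiteSchwartz, energy, ← mul_assoc, ← add_mul]
  congr 1
  have h : (κ : ℂ) ^ 2 * ħ = 2 := by exact_mod_cast hħ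
  push_cast
  linear_combination (-(‖x‖ : ℂ) ^ 2 / 8 * (κ ^ 2 * ħ + 2) +
    ħ * (∑ j, (α j : ℂ) + d / 2) / 2) * h

theorem toLp_hermiteSchwartz_mem_eigenspace (hκ : 0 < κ) (hħ : κ ^ 2 * ħ = 2) (α : Fin d → ℕ) :
    (hermiteSchwartz hκ α).toLp 2 volume ∈ eigenspace d ħ (energy d ħ (∑ j, α j)) := by
  rw [mem_eigenspace_iff]
  intro φ
  set h := hermiteSchwartz hκ α with hh
  have hc : ∀ f : Space d → ℂ, ∫ x, f x * (h.toLp 2 volume : Space d → ℂ) x = ∫ x, f x * h x :=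
    fun f => integral_congr_ae (by
      filter_upwards [h.coeFn_toLp 2 volume] with x hx
      rw [hx])
  have hg : (fun x : Space d => ((‖x‖ ^ 2 / 2 : ℝ) : ℂ)).HasTemperateGrowth := by
    simp only [div_eq_mul_inv]
    fun_prop
  rw [hc, hc, hc]
  simp only [← SchwartzMap.laplacian_apply]
  rw [← SchwartzMap.integral_mul_laplacian_right_eq_left, ← integral_const_mul,
    ← integral_const_mul, ← integral_add]
  · refine integral_congr_ae (Eventually.of_forall fun x => ?_)
    have := hamiltonian_hermiteSchwartz hκ hħ α x
    simp only [← hh] at this ⊢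
    linear_combination φ x * this
  · exact (SchwartzMap.pairing (ContinuousLinearMap.mul ℂ ℂ) φ (Δ h)).integrable.const_mul _
  · refine ((SchwartzMap.pairing (ContinuousLinearMap.mul ℂ ℂ) (SchwartzMap.smulLeftCLM ℂ
      (fun x : Space d => ((‖x‖ ^ 2 / 2 : ℝ) : ℂ)) φ) h).integrable (μ := volume)).congr
      (Eventually.of_forall fun x => ?_)
    rw [SchwartzMap.pairing_apply_apply, SchwartzMap.smulLeftCLM_apply_apply hg]
    rfl

theorem energy_injective (d : ℕ) (hħ : ħ ≠ 0) : Function.Injective (energy d ħ) := fun M N h => by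
  have := mul_left_cancel₀ hħ h
  exact_mod_cast add_right_cancel this

/-- Testing the weak equation for ψ with a Hermite function gives two eigenvalues for the same
pairing. They differ unless the degrees agree. -/
theorem integral_hermiteSchwartz_mul_eq_zero (hκ : 0 < κ) (hħ : κ ^ 2 * ħ = 2) {N : ℕ}
    {α : Fin d → ℕ} (hα : ∑ j, α j ≠ N) {ψ : L2 d} (hψ : ψ ∈ eigenspace d ħ (energy d ħ N)) :
    ∫ x, hermiteSchwartz hκ α x * ψ x = 0 := by
  have hħ0 : ħ ≠ 0 := by
    rintro rfl
    simp at hħ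
  set h := hermiteSchwartz hκ α with hh
  have hg : (fun x : Space d => ((‖x‖ ^ 2 / 2 : ℝ) : ℂ)).HasTemperateGrowth := by
    simp only [div_eq_mul_inv]
    fun_prop
  have h1 := (mem_eigenspace_iff d ħ _ ψ).1 hψ h
  simp only [← SchwartzMap.laplacian_apply] at h1
  have i1 : Integrable fun x => ((‖x‖ ^ 2 / 2 : ℝ) : ℂ) * h x * ψ x := by
    have := integrable_schwartz_mul (SchwartzMap.smulLeftCLM ℂ
      (fun x : Space d => ((‖x‖ ^ 2 / 2 : ℝ) : ℂ)) h) ψ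
    simpa only [SchwartzMap.smulLeftCLM_apply_apply hg, smul_eq_mul] using this
  rw [← integral_const_mul, ← integral_add ((integrable_schwartz_mul (Δ h) ψ).const_mul _) i1] at h1
  have h2 : ∫ x, (-((ħ : ℂ) ^ 2 / 2) * (Δ h x * ψ x) + ((‖x‖ ^ 2 / 2 : ℝ) : ℂ) * h x * ψ x) =
      ∫ x, (energy d ħ (∑ j, α j) : ℂ) * (h x * ψ x) := by
    refine integral_congr_ae (Eventually.of_forall fun x => ?_)
    have := hamiltonian_hermiteSchwartz hκ hħ α x
    simp only [← hh] at this ⊢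
    linear_combination ψ x * this
  rw [h2, integral_const_mul] at h1
  by_contra h3
  exact hα (energy_injective d hħ0 (by exact_mod_cast mul_right_cancel₀ h3 h1))

theorem inner_toLp_hermiteSchwartz (hκ : 0 < κ) (α : Fin d → ℕ) (ψ : L2 d) :
    ⟪(hermiteSchwartz hκ α).toLp 2 volume, ψ⟫_ℂ = ∫ x, hermiteSchwartz hκ α x * ψ x := by
  rw [L2.inner_def]
  refine integral_congr_ae ?_
  filter_upwards [(hermiteSchwartz hκ α).coeFn_toLp 2 volume] with x hx
  rw [hx, hermiteSchwartz_apply]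
  simp [mul_comm]

theorem inner_hermiteSchwartz_hermiteSchwartz (hκ : 0 < κ) (α β : Fin d → ℕ) :
    ⟪(hermiteSchwartz hκ α).toLp 2 volume, (hermiteSchwartz hκ β).toLp 2 volume⟫_ℂ =
      if α = β then (hermiteNormSq κ α : ℂ) else 0 := by
  rw [inner_toLp_hermiteSchwartz]
  have h := congrArg (fun r : ℝ => (r : ℂ)) (integral_hermiteProd_mul hκ α β)
  simp only [← integral_complex_ofReal] at h
  rw [apply_ite Complex.ofReal, Complex.ofReal_zero] at h
  rw [← h]
  refine integral_congr_ae ?_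
  filter_upwards [(hermiteSchwartz hκ β).coeFn_toLp 2 volume] with x hx
  rw [hx, hermiteSchwartz_apply, hermiteSchwartz_apply, Complex.ofReal_mul]

/-- Multi-indices of length `N`. -/
def multiIndices (d N : ℕ) : Finset (Fin d → ℕ) := Finset.piAntidiag Finset.univ N

theorem mem_multiIndices {N : ℕ} {α : Fin d → ℕ} : α ∈ multiIndices d N ↔ ∑ j, α j = N := by
  simp [multiIndices]

/-- The projection onto the product Hermite functions of degree `N`. -/
def hermiteProj (hκ : 0 < κ) (N : ℕ) (ψ : L2 d) : L2 d :=
  ∑ α ∈ multiIndices d N, ((hermiteNormSq κ α : ℂ)⁻¹ * ∫ x, hermiteSchwartz hκ α x * ψ x) •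
    (hermiteSchwartz hκ α).toLp 2 volume

theorem integral_hermite_mul_sub_hermiteProj (hκ : 0 < κ) {N : ℕ} (ψ : L2 d) {α : Fin d → ℕ} :
    ⟪(hermiteSchwartz hκ α).toLp 2 volume, ψ - hermiteProj hκ N ψ⟫_ℂ =
      if ∑ j, α j = N then 0 else ∫ x, hermiteSchwartz hκ α x * ψ x := by
  have hne : (hermiteNormSq κ α : ℂ) ≠ 0 := by exact_mod_cast (hermiteNormSq_pos hκ α).ne'
  rw [inner_sub_right, hermiteProj, inner_sum, inner_toLp_hermiteSchwartz]
  simp only [inner_smul_right, inner_hermiteSchwartz_hermiteSchwartz, mul_ite, mul_zero,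
    Finset.sum_ite_eq, mem_multiIndices]
  split_ifs with h
  · field_simp
    ring
  · ring

theorem spectralProjection_eq_hermiteProj (hκ : 0 < κ) (hħ : κ ^ 2 * ħ = 2) (N : ℕ) (ψ : L2 d) :
    spectralProjection d ħ N ψ = hermiteProj hκ N ψ := by
  refine Submodule.eq_starProjection_of_mem_of_inner_eq_zero ?_ fun w hw => ?_
  · refine Submodule.sum_mem _ fun α hα => Submodule.smul_mem _ _ ?_
    rw [← mem_multiIndices.1 hα]
    exact toLp_hermiteSchwartz_mem_eigenspace hκ hħ α
  · have hw' : w = hermiteProj hκ N w := by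
      rw [← sub_eq_zero]
      refine eq_zero_of_forall_integral_hermite_eq_zero hκ _ fun α => ?_
      rw [← inner_toLp_hermiteSchwartz, integral_hermite_mul_sub_hermiteProj]
      split_ifs with h
      · rfl
      · exact integral_hermiteSchwartz_mul_eq_zero hκ hħ h hw
    rw [hw', hermiteProj.eq_1 hκ N w, inner_sum]
    refine Finset.sum_eq_zero fun α hα => ?_
    rw [inner_smul_right, ← inner_conj_symm, integral_hermite_mul_sub_hermiteProj,
      if_pos (mem_multiIndices.1 hα), map_zero, mul_zero]

end eigenspace

/-! ### The continuous kernel and its uniqueness. -/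

section kernel

variable {d : ℕ} {κ ħ : ℝ}

/-- The kernel of the projection onto the product Hermite functions of degree `N`. -/
def hermiteKernel (κ : ℝ) (N : ℕ) (x y : Space d) : ℂ :=
  ∑ α ∈ multiIndices d N, (((hermiteNormSq κ α)⁻¹ * (hermiteProd κ α x * hermiteProd κ α y) : ℝ) : ℂ)

theorem isContinuousKernel_hermiteKernel (hκ : 0 < κ) (hħ : κ ^ 2 * ħ = 2) (N : ℕ) :
    IsContinuousKernel (spectralProjection d ħ N) (hermiteKernel κ N) := by
  constructor
  · refine continuous_finsetSum _ fun α _ => Complex.continuous_ofReal.comp ?_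
    have := continuous_hermiteProd κ α
    fun_prop
  · intro f _
    rw [spectralProjection_eq_hermiteProj hκ hħ, hermiteProj]
    have hf : ∀ α : Fin d → ℕ, ∫ x, hermiteSchwartz hκ α x *
        (f.toLp 2 volume : Space d → ℂ) x = ∫ x, hermiteSchwartz hκ α x * f x :=
      fun α => integral_congr_ae (by
        filter_upwards [f.coeFn_toLp 2 volume] with x hx
        rw [hx])
    have h1 : ∀ᵐ x : Space d, ∀ α ∈ multiIndices d N,
        (((hermiteNormSq κ α : ℂ)⁻¹ * ∫ x, hermiteSchwartz hκ α x * f x) •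
          (hermiteSchwartz hκ α).toLp 2 volume : L2 d) x =
        ((hermiteNormSq κ α : ℂ)⁻¹ * ∫ x, hermiteSchwartz hκ α x * f x) * hermiteSchwartz hκ α x := by
      rw [Finset.eventually_all]
      intro α _
      filter_upwards [Lp.coeFn_smul ((hermiteNormSq κ α : ℂ)⁻¹ * ∫ x, hermiteSchwartz hκ α x * f x)
        ((hermiteSchwartz hκ α).toLp 2 volume), (hermiteSchwartz hκ α).coeFn_toLp 2 volume]
        with x hx hx'
      rw [hx, Pi.smul_apply, hx', smul_eq_mul]
    simp only [hf]
    filter_upwards [h1, Lp.coeFn_finsetSum (multiIndices d N) fun α =>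
      ((hermiteNormSq κ α : ℂ)⁻¹ * ∫ x, hermiteSchwartz hκ α x * f x) •
          (hermiteSchwartz hκ α).toLp 2 volume] with x hx hx'
    rw [hx', Finset.sum_apply, Finset.sum_congr rfl hx]
    simp only [hermiteKernel, Finset.sum_mul]
    have hi : ∀ α : Fin d → ℕ, Integrable fun y => hermiteSchwartz hκ α y * f y := fun α =>
      (SchwartzMap.pairing (ContinuousLinearMap.mul ℂ ℂ) (hermiteSchwartz hκ α) f).integrable
    have hi' : ∀ α : Fin d → ℕ, (fun y => (((hermiteNormSq κ α)⁻¹ *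
        (hermiteProd κ α x * hermiteProd κ α y) : ℝ) : ℂ) * f y) = fun y =>
        ((hermiteNormSq κ α : ℂ)⁻¹ * hermiteSchwartz hκ α x) *
          (hermiteSchwartz hκ α y * f y) := fun α => by
      funext y
      simp only [hermiteSchwartz_apply]
      push_cast
      ring
    rw [integral_finsetSum _ fun α _ => by rw [hi']; exact (hi α).const_mul _]
    refine Finset.sum_congr rfl fun α _ => ?_
    rw [hi', integral_const_mul]
    ring

/-- For a test function of compact support both integrals are continuous in x, so equality almost
everywhere becomes equality at each point; the fundamental lemma and continuity then act in y. This
pins down the choice made by `Classical.epsilon`. -/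
theorem IsContinuousKernel.unique {T : L2 d →L[ℂ] L2 d} {K K' : Space d → Space d → ℂ}
    (h : IsContinuousKernel T K) (h' : IsContinuousKernel T K') : K = K' := by
  funext x₀
  have hc : ∀ {K : Space d → Space d → ℂ}, IsContinuousKernel T K → ∀ f : 𝓢(Space d, ℂ),
      HasCompactSupport f → Continuous fun x => ∫ y, K x y * f y := fun {K} hK f hf => by
    have h1 : Continuous (Function.uncurry fun x y => K x y * f y) :=
      hK.1.mul (f.continuous.comp continuous_snd)
    refine (continuous_parametric_integral_of_continuous (μ := volume) h1 hf.isCompact).congr fun x => ?_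
    refine setIntegral_eq_integral_of_forall_compl_eq_zero fun y hy => ?_
    rw [image_eq_zero_of_notMem_tsupport hy, mul_zero]
  have heq : ∀ f : 𝓢(Space d, ℂ), HasCompactSupport f →
      ∫ y, K x₀ y * f y = ∫ y, K' x₀ y * f y := fun f hf => by
    have h1 := (h.2 f hf).symm.trans (h'.2 f hf)
    exact congrFun (((hc h f hf).ae_eq_iff_eq volume (hc h' f hf)).1 h1) x₀
  have hK : Continuous (K x₀) := h.1.comp (by fun_prop : Continuous fun y => (x₀, y))
  have hK' : Continuous (K' x₀) := h'.1.comp (by fun_prop : Continuous fun y => (x₀, y))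
  refine (hK.ae_eq_iff_eq volume hK').1 ?_
  refine ae_eq_of_integral_contDiff_smul_eq hK.locallyIntegrable hK'.locallyIntegrable
    fun g hg hgc => ?_
  have hgc' : HasCompactSupport fun x => (g x : ℂ) := hgc.comp_left Complex.ofReal_zero
  have := heq (hgc'.toSchwartzMap (Complex.ofRealCLM.contDiff.comp hg)) hgc'
  simp only [Complex.real_smul, mul_comm (g _ : ℂ)]
  exact this

theorem projectionKernel_eq (hκ : 0 < κ) (hħ : κ ^ 2 * ħ = 2) (N : ℕ) :
    projectionKernel d ħ N = hermiteKernel κ N :=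
  (Classical.epsilon_spec ⟨_, isContinuousKernel_hermiteKernel hκ hħ N⟩).unique
    (isContinuousKernel_hermiteKernel hκ hħ N)

end kernel

/-! ### Wigner distributions of the projections. -/

section wigner

variable {d : ℕ} {κ ħ : ℝ}

theorem HasDiscSum.finsetProd {ι : Type*} [DecidableEq ι] {c : ι → ℕ → ℂ} {F : ι → ℂ → ℂ}
    (h : ∀ i, HasDiscSum (c i) (F i)) (s : Finset ι) :
    HasDiscSum (fun n => ∑ α ∈ s.piAntidiag n, ∏ i ∈ s, c i (α i)) (fun t => ∏ i ∈ s, F i t) := by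
  induction s using Finset.cons_induction with
  | empty =>
    intro t _
    simp only [Finset.prod_empty]
    refine (hasSum_ite_eq 0 (1 : ℂ)).congr_fun fun n => ?_
    rcases eq_or_ne n 0 with rfl | hn
    · simp
    · simp [hn]
  | cons i s hi ih =>
    have := (h i).mul ih
    simp only [Finset.prod_cons]
    convert this using 2 with n
    rw [Finset.piAntidiag_cons, Finset.sum_disjiUnion]
    refine Finset.sum_congr rfl fun p _ => ?_
    rw [Finset.sum_map, Finset.mul_sum]
    refine Finset.sum_congr rfl fun α hα => ?_
    have h0 : α i = 0 := by
      by_contra h1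
      exact hi ((Finset.mem_piAntidiag.1 hα).2 i h1)
    simp only [addRightEmbedding_apply, Pi.add_apply, if_true, h0, zero_add]
    congr 1
    refine Finset.prod_congr rfl fun j hj => ?_
    rw [if_neg (by rintro rfl; exact hi hj), add_zero]

/-- The Wigner distribution of the eigenspace projection, up to the factor `(πħ)⁻ᵈ`. -/
def wignerCoeff (κ : ℝ) (N : ℕ) (x ξ : Space d) : ℝ :=
  ∑ α ∈ multiIndices d N, ∏ j, laguerreFun (α j) (κ ^ 2 * (x j ^ 2 + ξ j ^ 2) / 2)

theorem continuous_wignerCoeff (κ : ℝ) (N : ℕ) :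
    Continuous fun p : Space d × Space d => wignerCoeff κ N p.1 p.2 :=
  continuous_finsetSum _ fun α _ => continuous_finsetProd _ fun j _ =>
    (continuous_laguerreFun (α j)).comp (by fun_prop)

/-- The sum over multi-indices is the coefficient of a product of d one-dimensional generating
functions, whose exponents add up to a function of |x|² + |ξ|² alone. -/
theorem hasDiscSum_wignerCoeff (κ : ℝ) (x ξ : Space d) :
    HasDiscSum (fun N => (wignerCoeff κ N x ξ : ℂ))
      (wignerGen d (κ ^ 2 * (‖x‖ ^ 2 + ‖ξ‖ ^ 2) / 2)) := by
  have h := HasDiscSum.finsetProd (fun j : Fin d =>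
    hasDiscSum_laguerreFun (κ ^ 2 * (x j ^ 2 + ξ j ^ 2) / 2)) Finset.univ
  have e : ∀ N, ((wignerCoeff κ N x ξ : ℝ) : ℂ) = ∑ α ∈ Finset.univ.piAntidiag N,
      ∏ j, (laguerreFun (α j) (κ ^ 2 * (x j ^ 2 + ξ j ^ 2) / 2) : ℂ) := fun N => by
    simp [wignerCoeff, multiIndices]
  simp only [e]
  refine h.congr_sum fun t _ => ?_
  simp only [wignerGen, pow_one, Finset.prod_mul_distrib, Finset.prod_const, Finset.card_univ,
    Fintype.card_fin, inv_pow, expCayley, ← Complex.exp_sum, Finset.sum_neg_distrib,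
    ← Finset.sum_mul, EuclideanSpace.norm_sq_eq, Real.norm_eq_abs, sq_abs]
  congr 4
  rw [← Finset.sum_add_distrib, Finset.mul_sum, Finset.sum_div]
  push_cast
  rfl

theorem hermiteProd_mul_shift (κ : ℝ) (α : Fin d → ℕ) (x v : Space d) :
    hermiteProd κ α (x + (1 / 2 : ℝ) • v) * hermiteProd κ α (x - (1 / 2 : ℝ) • v) =
      ∏ j, (hermiteFun κ (α j) (x j + 1 / 2 * v j) * hermiteFun κ (α j) (x j - 1 / 2 * v j)) := by
  simp only [hermiteProd, ← Finset.prod_mul_distrib]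
  rfl

theorem integrable_hermiteKernel_shift (hκ : 0 < κ) (N : ℕ) (x : Space d) :
    Integrable fun v : Space d =>
      hermiteKernel κ N (x + (1 / 2 : ℝ) • v) (x - (1 / 2 : ℝ) • v) := by
  refine integrable_finsetSum _ fun α _ => Integrable.ofReal (Integrable.const_mul ?_ _)
  simp only [hermiteProd_mul_shift]
  exact integrable_prod_space fun j => integrable_shift_hermiteFun_mul hκ (x j) (α j) (α j)

/-- The frequency ξ/ħ is κ² ξ/2, since κ² ħ = 2. -/
theorem prod_crossWigner (hħ : κ ^ 2 * ħ = 2) (α : Fin d → ℕ) (x ξ v : Space d) :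
    ((hermiteProd κ α (x + (1 / 2 : ℝ) • v) * hermiteProd κ α (x - (1 / 2 : ℝ) • v) : ℝ) : ℂ) *
      Complex.exp (-(Complex.I / (ħ : ℂ)) * ((⟪v, ξ⟫_ℝ : ℝ) : ℂ)) =
      ∏ j, crossWigner κ (x j) (κ ^ 2 * ξ j / 2) (α j) (α j) (v j) := by
  have hħ0 : (ħ : ℂ) ≠ 0 := by
    rintro h
    rw [Complex.ofReal_eq_zero.1 h] at hħ
    simp at hħ
  have hk : (κ : ℂ) ^ 2 * ħ = 2 := by exact_mod_cast hħ
  simp only [crossWigner, Finset.prod_mul_distrib, ← Complex.exp_sum]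
  rw [hermiteProd_mul_shift, Complex.ofReal_prod]
  congr 2
  have e : ⟪v, ξ⟫_ℝ = ∑ j, ξ j * v j := by simp [PiLp.inner_apply]
  rw [e]
  push_cast
  rw [Finset.mul_sum]
  refine Finset.sum_congr rfl fun j _ => ?_
  field_simp
  linear_combination (ξ j * v j : ℂ) * hk

theorem wignerTransform_hermiteKernel (hκ : 0 < κ) (hħ : κ ^ 2 * ħ = 2) (N : ℕ) (x ξ : Space d) :
    wignerTransform ħ (hermiteKernel κ N) x ξ =
      (((Real.pi * ħ)⁻¹ ^ d * wignerCoeff κ N x ξ : ℝ) : ℂ) := by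
  have hħ0 : 0 < ħ := by
    by_contra h
    nlinarith [sq_nonneg κ]
  have e : ∀ α : Fin d → ℕ, (fun v : Space d => (((hermiteNormSq κ α)⁻¹ *
      (hermiteProd κ α (x + (1 / 2 : ℝ) • v) * hermiteProd κ α (x - (1 / 2 : ℝ) • v)) : ℝ) : ℂ) *
      Complex.exp (-(Complex.I / (ħ : ℂ)) * ((⟪v, ξ⟫_ℝ : ℝ) : ℂ))) = fun v : Space d =>
      (((hermiteNormSq κ α)⁻¹ : ℝ) : ℂ) *
        ∏ j, crossWigner κ (x j) (κ ^ 2 * ξ j / 2) (α j) (α j) (v j) := fun α => by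
    funext v
    rw [← prod_crossWigner hħ, Complex.ofReal_mul (hermiteNormSq κ α)⁻¹, mul_assoc]
  have hi : ∀ α : Fin d → ℕ, Integrable fun v : Space d =>
      ∏ j, crossWigner κ (x j) (κ ^ 2 * ξ j / 2) (α j) (α j) (v j) := fun α =>
    integrable_prod_space fun j => integrable_crossWigner hκ _ _ _ _
  simp only [wignerTransform, hermiteKernel, Finset.sum_mul]
  rw [integral_finsetSum _ fun α _ => by rw [e]; exact (hi α).const_mul _, wignerCoeff,
    Finset.mul_sum, Finset.mul_sum, Complex.ofReal_sum]
  refine Finset.sum_congr rfl fun α _ => ?_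
  rw [e, integral_const_mul, integral_prod_space
    (fun j => crossWigner κ (x j) (κ ^ 2 * ξ j / 2) (α j) (α j))]
  simp only [integral_crossWigner_self hκ]
  have hprod : ∀ c : ℝ, c ^ d = ∏ _j : Fin d, c := fun c => by simp
  rw [← Complex.ofReal_inv, ← Complex.ofReal_pow, ← Complex.ofReal_prod, ← Complex.ofReal_mul,
    ← Complex.ofReal_mul, hermiteNormSq, hprod, hprod, ← Finset.prod_inv_distrib,
    ← Finset.prod_mul_distrib, ← Finset.prod_mul_distrib, ← Finset.prod_mul_distrib]
  congr 1
  refine Finset.prod_congr rfl fun j _ => ?_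
  -- The ratio √(8π)/√(2π) = 2 per coordinate turns (2πħ)^(-1) into (πħ)^(-1).
  have h1 : √(8 * Real.pi) = 2 * √(2 * Real.pi) := by
    rw [show 8 * Real.pi = 2 ^ 2 * (2 * Real.pi) by ring, Real.sqrt_mul (by positivity),
      Real.sqrt_sq (by norm_num)]
  have h2 : √(2 * Real.pi) ≠ 0 := by positivity
  have h3 : ((α j).factorial : ℝ) ≠ 0 := by exact_mod_cast (α j).factorial_ne_zero
  have := Real.pi_pos
  rw [h1]
  field_simp

theorem wigner_eq (hħ : 0 < ħ) (N : ℕ) (x ξ : Space d) :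
    wigner d ħ N x ξ = (((Real.pi * ħ)⁻¹ ^ d * wignerCoeff (√(2 / ħ)) N x ξ : ℝ) : ℂ) := by
  have hκ : 0 < √(2 / ħ) := by positivity
  have h2 : √(2 / ħ) ^ 2 * ħ = 2 := by
    rw [Real.sq_sqrt (by positivity)]
    field_simp
  rw [wigner, projectionKernel_eq hκ h2, wignerTransform_hermiteKernel hκ h2]

theorem norm_wignerCoeff_le (κ : ℝ) (N : ℕ) (x ξ : Space d) :
    ‖(wignerCoeff κ N x ξ : ℂ)‖ ≤ 3 * ((N : ℝ) + 2) ^ d :=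
  norm_coeff_wignerGen_le (by positivity) (hasDiscSum_wignerCoeff κ x ξ) N

end wigner

/-! ### Euler operator and termwise integration of power series. -/

theorem HasDiscSum.euler {c : ℕ → ℂ} {F F' : ℂ → ℂ} (h : HasDiscSum c F)
    (hF : ∀ t : ℂ, ‖t‖ < 1 → HasDerivAt F (F' t) t) :
    HasDiscSum (fun n => n * c n) (fun t => t * F' t) := fun t ht => by
  rw [← hasSum_nat_add_iff' 1]
  simp only [Finset.range_one, Finset.sum_singleton, Nat.cast_zero, zero_mul, sub_zero]
  refine ((h.deriv_coeff hF t ht).mul_left t).congr_fun fun n => ?_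
  push_cast
  ring

theorem HasDiscSum.add {c e : ℕ → ℂ} {F G : ℂ → ℂ} (h : HasDiscSum c F) (h' : HasDiscSum e G) :
    HasDiscSum (fun n => c n + e n) (fun t => F t + G t) := fun t ht => by
  simpa only [add_mul] using (h t ht).add (h' t ht)

/-- The coefficients of the generating function multiplied by `N + d / 2`. -/
theorem HasDiscSum.number_wignerGen {d : ℕ} {s : ℝ} {a : ℕ → ℂ}
    (h : HasDiscSum a (wignerGen d s)) :
    HasDiscSum (fun n => ((n : ℂ) + d / 2) * a n) (fun t =>
      ((1 - cayley t ^ 2) / 2 * s + d * cayley t / 2) * wignerGen d s t) := by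
  have h1 := (h.euler fun t ht => hasDerivAt_wignerGen d s ht).add (h.const_mul (d / 2))
  simp only [add_mul]
  simp only [add_mul] at h1
  refine h1.congr_sum fun t ht => ?_
  have := one_add_ne_zero ht
  rw [cayley]
  field_simp
  ring

/-- Integration of a family of power series against an integrable function. -/
theorem HasDiscSum.integral {X : Type*} [MeasurableSpace X] {μ : Measure X} {c : ℕ → X → ℂ}
    {F : ℂ → X → ℂ} {φ : X → ℂ} {C : ℝ} {k : ℕ}
    (h : ∀ x, HasDiscSum (fun n => c n x) (fun t => F t x))
    (hm : ∀ n, AEStronglyMeasurable (c n) μ) (hc : ∀ n x, ‖c n x‖ ≤ C * ((n : ℝ) + 2) ^ k)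
    (hφ : Integrable φ μ) :
    HasDiscSum (fun n => ∫ x, c n x * φ x ∂μ) (fun t => ∫ x, F t x * φ x ∂μ) := fun t ht => by
  have hsum : Summable fun n : ℕ => C * ((n : ℝ) + 2) ^ k * ‖t‖ ^ n := by
    have h1 := summable_pow_mul_geometric_of_norm_lt_one k (r := ‖t‖) (by simpa using ht)
    have h2 : Summable fun n : ℕ => (n : ℝ) ^ k * ‖t‖ ^ n + ‖t‖ ^ n :=
      h1.add (summable_geometric_of_lt_one (norm_nonneg _) ht)
    refine Summable.of_norm_bounded (g := fun n : ℕ =>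
      |C| * 3 ^ k * ((n : ℝ) ^ k * ‖t‖ ^ n + ‖t‖ ^ n)) (h2.mul_left _) fun n => ?_
    rw [norm_mul, norm_mul, Real.norm_eq_abs, norm_pow, norm_pow, norm_norm, mul_assoc, mul_assoc,
      ← add_one_mul, ← mul_assoc (3 ^ k)]
    refine mul_le_mul_of_nonneg_left (mul_le_mul_of_nonneg_right ?_ (by positivity)) (abs_nonneg C)
    rw [Real.norm_of_nonneg (by positivity)]
    rcases n.eq_zero_or_pos with rfl | hn
    · norm_num
      have : (2 : ℝ) ^ k ≤ 3 ^ k := by gcongr; norm_num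
      have : (0 : ℝ) ≤ 0 ^ k := by positivity
      nlinarith [pow_pos (three_pos (α := ℝ)) k]
    · have hn' : (1 : ℝ) ≤ n := by exact_mod_cast hn
      calc ((n : ℝ) + 2) ^ k ≤ (3 * n) ^ k := by gcongr; linarith
        _ = 3 ^ k * n ^ k := mul_pow _ _ _
        _ ≤ _ := by gcongr; linarith
  have h1 := hasSum_integral_of_dominated_convergence (μ := μ)
    (F := fun n x => c n x * t ^ n * φ x) (f := fun x => F t x * φ x)
    (fun n x => C * ((n : ℝ) + 2) ^ k * ‖t‖ ^ n * ‖φ x‖)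
    (fun n => ((hm n).mul_const _).mul hφ.1)
    (fun n => Eventually.of_forall fun x => by
      rw [norm_mul, norm_mul, norm_pow]
      gcongr
      exact hc n x)
    (Eventually.of_forall fun x => hsum.mul_right _)
    (by
      simp only [tsum_mul_right]
      exact hφ.norm.const_mul _)
    (Eventually.of_forall fun x => (h x t ht).mul_right _)
  refine h1.congr_fun fun n => ?_
  rw [← integral_mul_const]
  refine integral_congr_ae (Eventually.of_forall fun x => ?_)
  simp only
  ring

/-! ### Pairing with test functions on phase space. -/

section phaseSpace

variable {d : ℕ} {κ : ℝ}

instance : (volume : Measure (Space d × Space d)).IsAddHaarMeasure :=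
  inferInstanceAs (((volume : Measure (Space d)).prod volume).IsAddHaarMeasure)

/-- The standard basis of phase space. -/
def phaseBasis : Fin d ⊕ Fin d → Space d × Space d :=
  Sum.elim (fun j => (EuclideanSpace.single j 1, 0)) (fun j => (0, EuclideanSpace.single j 1))

/-- The standard coordinates of phase space. -/
def phaseCoord : Fin d ⊕ Fin d → Space d × Space d →L[ℝ] ℝ :=
  Sum.elim (fun j => (EuclideanSpace.proj j).comp (ContinuousLinearMap.fst ℝ _ _))
    (fun j => (EuclideanSpace.proj j).comp (ContinuousLinearMap.snd ℝ _ _))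

theorem phaseCoord_phaseBasis (i k : Fin d ⊕ Fin d) :
    phaseCoord k (phaseBasis i) = if k = i then 1 else 0 := by
  rcases i with i | i <;> rcases k with k | k <;> simp [phaseCoord, phaseBasis]

theorem sum_phaseCoord_sq (p : Space d × Space d) :
    ∑ i, phaseCoord i p ^ 2 = ‖p.1‖ ^ 2 + ‖p.2‖ ^ 2 := by
  simp [Fintype.sum_sum_type, phaseCoord, EuclideanSpace.norm_sq_eq]

theorem hasTemperateGrowth_phaseCoord (i : Fin d ⊕ Fin d) :
    (fun p : Space d × Space d => (phaseCoord i p : ℂ)).HasTemperateGrowth := by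
  fun_prop

/-- Multiplication by a coordinate of phase space. -/
def mulCoord (i : Fin d ⊕ Fin d) (φ : 𝓢(Space d × Space d, ℂ)) : 𝓢(Space d × Space d, ℂ) :=
  SchwartzMap.smulLeftCLM ℂ (fun p : Space d × Space d => (phaseCoord i p : ℂ)) φ

theorem mulCoord_apply (i : Fin d ⊕ Fin d) (φ : 𝓢(Space d × Space d, ℂ)) (p : Space d × Space d) :
    mulCoord i φ p = phaseCoord i p * φ p :=
  SchwartzMap.smulLeftCLM_apply_apply (hasTemperateGrowth_phaseCoord i) _ _

/-- Differentiation in the direction of a coordinate of phase space. -/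
def derivCoord (i : Fin d ⊕ Fin d) (φ : 𝓢(Space d × Space d, ℂ)) : 𝓢(Space d × Space d, ℂ) :=
  LineDeriv.lineDerivOp (phaseBasis i) φ

theorem hasLineDerivAt_derivCoord (i : Fin d ⊕ Fin d) (φ : 𝓢(Space d × Space d, ℂ))
    (p : Space d × Space d) : HasLineDerivAt ℝ φ (derivCoord i φ p) p (phaseBasis i) := by
  rw [derivCoord, SchwartzMap.lineDerivOp_apply]
  exact φ.differentiableAt.lineDifferentiableAt.hasLineDerivAt

theorem derivCoord_mulCoord (i : Fin d ⊕ Fin d) (φ : 𝓢(Space d × Space d, ℂ)) :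
    derivCoord i (mulCoord i φ) = mulCoord i (derivCoord i φ) + φ := by
  ext p
  have h1 := hasLineDerivAt_derivCoord i (mulCoord i φ) p
  have h2 : HasLineDerivAt ℝ (mulCoord i φ) (φ p + phaseCoord i p * derivCoord i φ p) p
      (phaseBasis i) := by
    have h3 := hasLineDerivAt_derivCoord i φ p
    have h4 : HasDerivAt (fun h : ℝ => (phaseCoord i (p + h • phaseBasis i) : ℂ)) 1 0 := by
      have : HasDerivAt (fun h : ℝ => phaseCoord i (p + h • phaseBasis i)) 1 0 := by
        simp only [map_add, map_smul, phaseCoord_phaseBasis, if_true, smul_eq_mul, mul_one]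
        exact (hasDerivAt_id (0 : ℝ)).const_add _
      exact_mod_cast this.ofReal_comp
    have h5 := h4.mul h3
    simp only [zero_smul, add_zero, one_mul] at h5
    refine h5.congr_of_eventuallyEq (Eventually.of_forall fun h => ?_)
    exact mulCoord_apply i φ _
  rw [add_apply, mulCoord_apply, h1.unique h2, add_comm]

/-- The generating function of the Wigner distributions on phase space. -/
def phaseGen (κ : ℝ) (t : ℂ) (p : Space d × Space d) : ℂ :=
  wignerGen d (κ ^ 2 * (‖p.1‖ ^ 2 + ‖p.2‖ ^ 2) / 2) t

theorem continuous_phaseGen (κ : ℝ) (t : ℂ) :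
    Continuous fun p : Space d × Space d => phaseGen κ t p := by
  unfold phaseGen wignerGen expCayley
  fun_prop

theorem integrable_phaseGen_mul (κ : ℝ) {t : ℂ} (ht : ‖t‖ < 1) (φ : 𝓢(Space d × Space d, ℂ)) :
    Integrable fun p => phaseGen κ t p * φ p :=
  φ.integrable.bdd_mul (continuous_phaseGen κ t).aestronglyMeasurable
    (Eventually.of_forall fun p => norm_wignerGen_le d (by positivity) ht)

theorem hasLineDerivAt_phaseGen (κ : ℝ) (t : ℂ) (i : Fin d ⊕ Fin d) (p : Space d × Space d) :
    HasLineDerivAt ℝ (phaseGen κ t) (-(κ ^ 2 * cayley t * (phaseCoord i p * phaseGen κ t p))) p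
      (phaseBasis i) := by
  have e : ∀ h : ℝ, ‖(p + h • phaseBasis i).1‖ ^ 2 + ‖(p + h • phaseBasis i).2‖ ^ 2 =
      ‖p.1‖ ^ 2 + ‖p.2‖ ^ 2 + (2 * phaseCoord i p * h + h ^ 2) := fun h => by
    rw [← sum_phaseCoord_sq, ← sum_phaseCoord_sq]
    have : ∀ k, phaseCoord k (p + h • phaseBasis i) ^ 2 = phaseCoord k p ^ 2 +
        if k = i then 2 * phaseCoord k p * h + h ^ 2 else 0 := fun k => by
      rw [map_add, map_smul, phaseCoord_phaseBasis]
      split_ifs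
      · simp
        ring
      · simp
    simp only [this, Finset.sum_add_distrib, Finset.sum_ite_eq', Finset.mem_univ, if_true]
  have h1 : HasDerivAt (fun h : ℝ => κ ^ 2 * (‖p.1‖ ^ 2 + ‖p.2‖ ^ 2 +
      (2 * phaseCoord i p * h + h ^ 2)) / 2) (κ ^ 2 * phaseCoord i p) 0 := by
    have := ((((hasDerivAt_id (0 : ℝ)).const_mul (2 * phaseCoord i p)).add
      ((hasDerivAt_id (0 : ℝ)).pow 2)).const_add (‖p.1‖ ^ 2 + ‖p.2‖ ^ 2)).const_mul (κ ^ 2)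
      |>.div_const 2
    refine this.congr_deriv ?_
    simp
    ring
  have h2 := (((h1.ofReal_comp.mul_const (cayley t)).neg).cexp).const_mul (((1 + t) ^ d)⁻¹)
  refine (h2.congr_deriv ?_).congr_of_eventuallyEq (Eventually.of_forall fun h => ?_)
  · simp only [phaseGen, wignerGen, expCayley]
    simp
    ring
  · simp only [phaseGen, wignerGen, expCayley, e, Pi.neg_apply]

/-- Integration against the generating function turns derivatives into multiplications. -/
theorem integral_phaseGen_mul_derivCoord (κ : ℝ) {t : ℂ} (ht : ‖t‖ < 1) (i : Fin d ⊕ Fin d)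
    (φ : 𝓢(Space d × Space d, ℂ)) :
    ∫ p, phaseGen κ t p * derivCoord i φ p =
      κ ^ 2 * cayley t * ∫ p, phaseGen κ t p * mulCoord i φ p := by
  have e : (fun p => -(κ ^ 2 * cayley t * (phaseCoord i p * phaseGen κ t p)) * φ p) =
      fun p => -(κ ^ 2 * cayley t) * (phaseGen κ t p * mulCoord i φ p) := by
    funext p
    rw [mulCoord_apply]
    ring
  have := integral_bilinear_hasLineDerivAt_right_eq_neg_left_of_integrable
    (μ := (volume : Measure (Space d × Space d)))
    (f := phaseGen κ t) (g := φ) (g' := derivCoord i φ)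
    (f' := fun p => -(κ ^ 2 * cayley t * (phaseCoord i p * phaseGen κ t p))) (v := phaseBasis i)
    (B := ContinuousLinearMap.mul ℝ ℂ)
    (by
      simp only [ContinuousLinearMap.mul_apply', e]
      exact (integrable_phaseGen_mul κ ht _).const_mul _)
    (integrable_phaseGen_mul κ ht _) (integrable_phaseGen_mul κ ht _)
    (fun p _ => hasLineDerivAt_phaseGen κ t i p) (fun p _ => hasLineDerivAt_derivCoord i φ p)
  simp only [ContinuousLinearMap.mul_apply', e] at this
  rw [this, integral_const_mul]
  ring

/-- The phase space operator `(κ² / 4) |z|² - Δ_z / (4κ²)`: the symmetrized Moyal product with the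
symbol of the Hamiltonian, divided by `ħ = 2 / κ²`. -/
def moyal (κ : ℝ) (φ : 𝓢(Space d × Space d, ℂ)) : 𝓢(Space d × Space d, ℂ) :=
  ∑ i, (((κ ^ 2 / 4 : ℝ) : ℂ) • mulCoord i (mulCoord i φ) -
    (((4 * κ ^ 2)⁻¹ : ℝ) : ℂ) • derivCoord i (derivCoord i φ))

/-- The generating function is a Gaussian in z = (x, ξ) with complex parameter κ² `cayley t`. Two
integrations by parts give (κ² `cayley t`)² z_i² - κ² `cayley t` for each of the 2d coordinates. -/
theorem integral_phaseGen_mul_moyal (hκ : 0 < κ) {t : ℂ} (ht : ‖t‖ < 1)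
    (φ : 𝓢(Space d × Space d, ℂ)) :
    ∫ p, phaseGen κ t p * moyal κ φ p = ∫ p, ((1 - cayley t ^ 2) / 2 *
      ((κ ^ 2 * (‖p.1‖ ^ 2 + ‖p.2‖ ^ 2) / 2 : ℝ) : ℂ) + d * cayley t / 2) * phaseGen κ t p * φ p := by
  have hκ' : (κ : ℂ) ≠ 0 := by exact_mod_cast hκ.ne'
  set I : 𝓢(Space d × Space d, ℂ) → ℂ := fun ψ => ∫ p, phaseGen κ t p * ψ p with hI
  have hi := fun ψ : 𝓢(Space d × Space d, ℂ) => integrable_phaseGen_mul κ ht ψ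
  have h1 : ∀ i, I (derivCoord i (derivCoord i φ)) =
      (κ ^ 2 * cayley t) ^ 2 * I (mulCoord i (mulCoord i φ)) - κ ^ 2 * cayley t * I φ := fun i => by
    have h2 : I (derivCoord i (mulCoord i φ)) = I (mulCoord i (derivCoord i φ)) + I φ := by
      rw [derivCoord_mulCoord, hI]
      simp only [add_apply, mul_add]
      exact integral_add (hi _) (hi _)
    have h3 : ∀ ψ, I (derivCoord i ψ) = κ ^ 2 * cayley t * I (mulCoord i ψ) :=
      fun ψ => integral_phaseGen_mul_derivCoord κ ht i ψ
    rw [h3] at h2 ⊢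
    linear_combination (-(κ ^ 2 * cayley t)) * h2
  have h4 : I (moyal κ φ) = ∑ i, ((κ ^ 2 / 4 : ℝ) * I (mulCoord i (mulCoord i φ)) -
      ((4 * κ ^ 2)⁻¹ : ℝ) * I (derivCoord i (derivCoord i φ))) := by
    simp only [hI, moyal, sum_apply, sub_apply, smul_apply,
      smul_eq_mul, Finset.mul_sum, mul_sub, mul_left_comm (phaseGen κ t _)]
    rw [integral_finsetSum _ fun i _ => ((hi _).const_mul _).sub' ((hi _).const_mul _)]
    refine Finset.sum_congr rfl fun i _ => ?_
    rw [integral_sub ((hi _).const_mul _) ((hi _).const_mul _), integral_const_mul,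
      integral_const_mul]
  have h5 : (fun p => ((1 - cayley t ^ 2) / 2 *
      ((κ ^ 2 * (‖p.1‖ ^ 2 + ‖p.2‖ ^ 2) / 2 : ℝ) : ℂ) + d * cayley t / 2) * phaseGen κ t p * φ p) =
      fun p => ∑ i, ((1 - cayley t ^ 2) / 4 * κ ^ 2 *
        (phaseGen κ t p * mulCoord i (mulCoord i φ) p) +
        cayley t / 4 * (phaseGen κ t p * φ p)) := by
    funext p
    simp only [mulCoord_apply, Finset.sum_add_distrib, ← sum_phaseCoord_sq, Finset.sum_const,
      Finset.card_univ, Fintype.card_sum, Fintype.card_fin]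
    push_cast
    simp only [Finset.mul_sum, Finset.sum_mul, Finset.sum_div, add_mul, nsmul_eq_mul]
    push_cast
    congr 1
    · refine Finset.sum_congr rfl fun i _ => ?_
      ring
    · ring
  change I (moyal κ φ) = _
  rw [h4, h5, integral_finsetSum _ fun i _ => ((hi _).const_mul _).fun_add ((hi _).const_mul _)]
  refine Finset.sum_congr rfl fun i _ => ?_
  rw [integral_add ((hi _).const_mul _) ((hi _).const_mul _), integral_const_mul,
    integral_const_mul, h1]
  change _ = (1 - cayley t ^ 2) / 4 * κ ^ 2 * I (mulCoord i (mulCoord i φ)) + cayley t / 4 * I φ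
  push_cast
  field_simp
  ring

/-- The pairing of the coefficient functions with a test function. -/
def wignerPairing (κ : ℝ) (φ : 𝓢(Space d × Space d, ℂ)) (N : ℕ) : ℂ :=
  ∫ p, (wignerCoeff κ N p.1 p.2 : ℂ) * φ p

theorem hasDiscSum_wignerPairing (κ : ℝ) (φ : 𝓢(Space d × Space d, ℂ)) :
    HasDiscSum (wignerPairing κ φ) fun t => ∫ p, phaseGen κ t p * φ p :=
  HasDiscSum.integral (fun p => hasDiscSum_wignerCoeff κ p.1 p.2)
    (fun n => (Complex.continuous_ofReal.comp (continuous_wignerCoeff κ n)).aestronglyMeasurable)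
    (fun n p => norm_wignerCoeff_le κ n p.1 p.2) φ.integrable

/-- The operator `moyal κ` and the Euler operator t d/dt + d/2 act on the generating function in the
same way, so the coefficients agree. -/
theorem wignerPairing_moyal (hκ : 0 < κ) (φ : 𝓢(Space d × Space d, ℂ)) (N : ℕ) :
    wignerPairing κ (moyal κ φ) N = ((N : ℂ) + d / 2) * wignerPairing κ φ N := by
  have h1 : HasDiscSum (fun N => ∫ p, (((N : ℂ) + d / 2) * (wignerCoeff κ N p.1 p.2 : ℂ)) * φ p)
      fun t => ∫ p, ((1 - cayley t ^ 2) / 2 *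
      ((κ ^ 2 * (‖p.1‖ ^ 2 + ‖p.2‖ ^ 2) / 2 : ℝ) : ℂ) + d * cayley t / 2) * phaseGen κ t p * φ p := by
    refine HasDiscSum.integral (C := (d + 1) * 3) (k := d + 1)
      (fun p => (hasDiscSum_wignerCoeff κ p.1 p.2).number_wignerGen)
      (fun n => ((Complex.continuous_ofReal.comp
        (continuous_wignerCoeff κ n)).aestronglyMeasurable).const_mul _)
      (fun n p => ?_) φ.integrable
    have h2 : ‖(n : ℂ) + d / 2‖ ≤ (d + 1) * ((n : ℝ) + 2) := by
      refine (norm_add_le _ _).trans ?_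
      simp only [norm_div, Complex.norm_natCast, Complex.norm_ofNat]
      have : (0 : ℝ) ≤ d * n := by positivity
      nlinarith [(n.cast_nonneg : (0 : ℝ) ≤ n), (d.cast_nonneg : (0 : ℝ) ≤ d)]
    rw [norm_mul]
    calc _ ≤ (d + 1) * ((n : ℝ) + 2) * (3 * ((n : ℝ) + 2) ^ d) :=
          mul_le_mul h2 (norm_wignerCoeff_le κ n p.1 p.2) (norm_nonneg _) (by positivity)
      _ = _ := by ring
  have h3 := congrFun (((hasDiscSum_wignerPairing κ (moyal κ φ)).congr_sum
    fun t ht => integral_phaseGen_mul_moyal hκ ht φ).unique h1) N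
  rw [h3, wignerPairing, ← integral_const_mul]
  simp only [mul_assoc]

theorem norm_wignerPairing_le (κ : ℝ) (φ : 𝓢(Space d × Space d, ℂ)) (N : ℕ) :
    ‖wignerPairing κ φ N‖ ≤ 3 * ((N : ℝ) + 2) ^ d * ∫ p, ‖φ p‖ := by
  rw [wignerPairing, ← integral_const_mul]
  refine norm_integral_le_of_norm_le (φ.integrable.norm.const_mul _)
    (Eventually.of_forall fun p => ?_)
  rw [norm_mul]
  exact mul_le_mul_of_nonneg_right (norm_wignerCoeff_le κ N p.1 p.2) (norm_nonneg _)

theorem wignerPairing_iterate_moyal (hκ : 0 < κ) (φ : 𝓢(Space d × Space d, ℂ)) (N k : ℕ) :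
    wignerPairing κ ((moyal κ)^[k] φ) N = ((N : ℂ) + d / 2) ^ k * wignerPairing κ φ N := by
  induction k with
  | zero => simp
  | succ k ih =>
    rw [Function.iterate_succ_apply', wignerPairing_moyal hκ, ih]
    ring

/-- Applying `moyal κ` d + 2 times gains (N + d/2)^(d + 2) over the growth (N + 2)^d of the
coefficients, hence decay N^(-2). -/
theorem summable_wignerPairing (hd : 1 ≤ d) (hκ : 0 < κ) (φ : 𝓢(Space d × Space d, ℂ)) :
    Summable (wignerPairing κ φ) := by
  set C := ∫ p, ‖((moyal κ)^[d + 2] φ) p‖ with hC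
  have hC0 : 0 ≤ C := integral_nonneg fun p => norm_nonneg _
  refine Summable.of_norm_bounded (g := fun N : ℕ => (3 * 4 ^ (d + 2) * C) * (1 / ((N : ℝ) + 1) ^ 2))
    (summable_one_div_succ_sq.mul_left _) fun N => ?_
  have h1 := norm_wignerPairing_le κ ((moyal κ)^[d + 2] φ) N
  have hd' : (1 : ℝ) ≤ d := by exact_mod_cast hd
  have h2 : ‖(N : ℂ) + d / 2‖ = (N : ℝ) + d / 2 := by
    rw [show ((N : ℂ) + d / 2) = (((N : ℝ) + d / 2 : ℝ) : ℂ) by push_cast; rfl, Complex.norm_real,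
      Real.norm_of_nonneg (by positivity)]
  rw [wignerPairing_iterate_moyal hκ, norm_mul, norm_pow, h2, ← hC] at h1
  have hN : (0 : ℝ) ≤ N := N.cast_nonneg
  -- The base satisfies (N + 2)/4 ≤ N + 1/2 ≤ N + d/2 because d ≥ 1.
  have h3 : (((N : ℝ) + 2) / 4) ^ (d + 2) ≤ ((N : ℝ) + d / 2) ^ (d + 2) := by
    gcongr
    linarith
  have h4 := (mul_le_mul_of_nonneg_right h3 (norm_nonneg (wignerPairing κ φ N))).trans h1
  rw [div_pow, pow_add ((N : ℝ) + 2)] at h4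
  have h5 : ‖wignerPairing κ φ N‖ * ((N : ℝ) + 2) ^ 2 ≤ 3 * 4 ^ (d + 2) * C := by
    have hp : (0 : ℝ) < ((N : ℝ) + 2) ^ d := by positivity
    refine le_of_mul_le_mul_left ?_ hp
    rw [div_mul_eq_mul_div, div_le_iff₀ (by positivity)] at h4
    linarith
  rw [mul_one_div, le_div_iff₀ (by positivity)]
  refine le_trans ?_ h5
  gcongr
  norm_num

theorem tendsto_integral_phaseGen (κ : ℝ) (φ : 𝓢(Space d × Space d, ℂ)) :
    Tendsto (fun r : ℝ => ∫ p, phaseGen κ r p * φ p) (𝓝[<] 1) (𝓝 ((2 ^ d)⁻¹ * ∫ p, φ p)) := by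
  rw [← integral_const_mul]
  have hr : ∀ᶠ r : ℝ in 𝓝[<] 1, r ∈ Ioo (0 : ℝ) 1 := Ioo_mem_nhdsLT one_pos
  refine tendsto_integral_filter_of_dominated_convergence (fun p => ‖φ p‖) ?_ ?_
    φ.integrable.norm ?_
  · exact Eventually.of_forall fun r =>
      ((continuous_phaseGen κ r).mul φ.continuous).aestronglyMeasurable
  · filter_upwards [hr] with r hr
    refine Eventually.of_forall fun p => ?_
    rw [norm_mul]
    refine mul_le_of_le_one_left (norm_nonneg _) ?_
    have h1 : ‖(r : ℂ)‖ < 1 := by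
      rw [Complex.norm_real, Real.norm_of_nonneg hr.1.le]
      exact hr.2
    have h2 : ‖1 + (r : ℂ)‖ = 1 + r := by
      rw [← Complex.ofReal_one, ← Complex.ofReal_add, Complex.norm_real,
        Real.norm_of_nonneg (by linarith [hr.1])]
    rw [phaseGen, wignerGen, norm_mul, norm_inv, norm_pow, h2]
    refine mul_le_one₀ (inv_le_one_of_one_le₀ (one_le_pow₀ (by linarith [hr.1]))) (norm_nonneg _)
      (norm_expCayley_le (by positivity) h1)
  · refine Eventually.of_forall fun p => Tendsto.mul_const _ ?_
    have h1 : Tendsto (fun r : ℝ => ((1 + (r : ℂ)) ^ d)⁻¹) (𝓝[<] 1) (𝓝 ((2 ^ d)⁻¹)) := by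
      have h2 : Tendsto (fun r : ℝ => (1 + (r : ℂ)) ^ d) (𝓝 1) (𝓝 ((1 + ((1 : ℝ) : ℂ)) ^ d)) :=
        Continuous.tendsto (by fun_prop) 1
      rw [Complex.ofReal_one, one_add_one_eq_two] at h2
      exact (h2.mono_left nhdsWithin_le_nhds).inv₀ (pow_ne_zero _ two_ne_zero)
    have h3 := h1.mul (continuousAt_expCayley_one (κ ^ 2 * (‖p.1‖ ^ 2 + ‖p.2‖ ^ 2) / 2))
    rw [mul_one] at h3
    exact h3

theorem hasSum_wignerPairing (hd : 1 ≤ d) (hκ : 0 < κ) (φ : 𝓢(Space d × Space d, ℂ)) :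
    HasSum (wignerPairing κ φ) ((2 ^ d)⁻¹ * ∫ p, φ p) :=
  (hasDiscSum_wignerPairing κ φ).hasSum_of_tendsto (summable_wignerPairing hd hκ φ)
    (tendsto_integral_phaseGen κ φ)

end phaseSpace

/-! ### The measure: total variation and total integral. -/

section measure

variable {d : ℕ} {ħ : ℝ} {x ξ : Space d}

theorem energy_le_iff (hħ : 0 < ħ) {τ : ℝ} (hτ : energy d ħ 0 ≤ τ) (N : ℕ) :
    energy d ħ N ≤ τ ↔ N < ⌊τ / ħ - d / 2⌋₊ + 1 := by
  simp only [energy, Nat.cast_zero, zero_add] at hτ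
  have h0 : 0 ≤ τ / ħ - d / 2 := by
    rw [sub_nonneg, le_div_iff₀ hħ]
    linarith
  rw [Nat.lt_succ_iff, Nat.le_floor_iff h0, energy, le_sub_iff_add_le, le_div_iff₀ hħ, mul_comm]

theorem finite_energy_le (hħ : 0 < ħ) (τ : ℝ) : {N | energy d ħ N ≤ τ}.Finite := by
  rcases le_or_gt (energy d ħ 0) τ with h | h
  · simp only [energy_le_iff hħ h]
    exact Set.finite_lt_nat _
  · refine Set.Finite.subset Set.finite_empty fun N hN => ?_
    have h1 : energy d ħ 0 ≤ energy d ħ N := by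
      simp only [energy, Nat.cast_zero]
      gcongr
      exact N.cast_nonneg
    exact absurd (h1.trans hN) (not_le.2 h)

theorem empiricalMeasure_singleton (hħ : 0 < ħ) (N : ℕ) :
    empiricalMeasure d ħ x ξ {energy d ħ N} = wigner d ħ N x ξ := by
  simp only [empiricalMeasure, Set.mem_singleton_iff, (energy_injective d hħ.ne').eq_iff]
  exact finsum_cond_eq_left

theorem empiricalMeasure_eq_sum {B : Set ℝ} (h : {N | energy d ħ N ∈ B}.Finite) :
    empiricalMeasure d ħ x ξ B = ∑ N ∈ h.toFinset, wigner d ħ N x ξ :=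
  finsum_mem_eq_finite_toFinset_sum _ h

/-- Families of singletons {E_N} are admissible in the supremum, the energies being distinct. -/
theorem tsum_enorm_wigner_le (hħ : 0 < ħ) :
    ∑' N, ‖wigner d ħ N x ξ‖ₑ ≤ totalVariation (empiricalMeasure d ħ x ξ) Set.univ := by
  classical
  rw [ENNReal.tsum_eq_iSup_sum]
  refine iSup_le fun s => ?_
  have hinj : Function.Injective fun N : ℕ => ({energy d ħ N} : Set ℝ) :=
    Set.singleton_injective.comp (energy_injective d hħ.ne')
  have h1 : ∑ N ∈ s, ‖wigner d ħ N x ξ‖ₑ =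
      ∑ B ∈ s.image fun N => ({energy d ħ N} : Set ℝ), ‖empiricalMeasure d ħ x ξ B‖ₑ := by
    rw [Finset.sum_image hinj.injOn]
    simp only [empiricalMeasure_singleton hħ]
  rw [h1]
  refine le_iSup_of_le (s.image fun N => ({energy d ħ N} : Set ℝ)) (le_iSup_of_le ?_
    (le_iSup_of_le ?_ le_rfl))
  · intro B hB
    obtain ⟨N, -, rfl⟩ := Finset.mem_image.1 hB
    exact ⟨measurableSet_singleton _, Bornology.isBounded_singleton, Set.subset_univ _⟩
  · intro B hB B' hB' hne
    obtain ⟨N, -, rfl⟩ := Finset.mem_image.1 (Finset.mem_coe.1 hB)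
    obtain ⟨N', -, rfl⟩ := Finset.mem_image.1 (Finset.mem_coe.1 hB')
    exact Set.disjoint_singleton.2 fun h => hne (congrArg _ h)

/-- Each energy lies in at most one member of a disjoint family, so after exchanging the sums every
N is counted at most once. -/
theorem totalVariation_Iic_le (hħ : 0 < ħ) (τ : ℝ) :
    totalVariation (empiricalMeasure d ħ x ξ) (Set.Iic τ) ≤
      ∑ N ∈ (finite_energy_le (d := d) hħ τ).toFinset, ‖wigner d ħ N x ξ‖ₑ := by
  classical
  set T := (finite_energy_le (d := d) hħ τ).toFinset with hT
  refine iSup_le fun P => iSup_le fun hP => iSup_le fun hdisj => ?_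
  have h1 : ∀ B ∈ P, ‖empiricalMeasure d ħ x ξ B‖ₑ ≤
      ∑ N ∈ T, if energy d ħ N ∈ B then ‖wigner d ħ N x ξ‖ₑ else 0 := fun B hB => by
    have hB' : {N | energy d ħ N ∈ B} ⊆ {N | energy d ħ N ≤ τ} := fun N hN => (hP B hB).2.2 hN
    have hf := (finite_energy_le hħ τ).subset hB'
    rw [empiricalMeasure_eq_sum hf, ← Finset.sum_filter]
    have h2 : T.filter (fun N => energy d ħ N ∈ B) = hf.toFinset := by
      ext N
      simp only [hT, Finset.mem_filter, Set.Finite.mem_toFinset]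
      exact ⟨fun h => h.2, fun h => ⟨hB' h, h⟩⟩
    rw [h2]
    exact enorm_sum_le _ _
  refine (Finset.sum_le_sum h1).trans ?_
  rw [Finset.sum_comm]
  refine Finset.sum_le_sum fun N _ => ?_
  rw [← Finset.sum_filter, Finset.sum_const]
  refine (nsmul_le_nsmul_left zero_le (Finset.card_le_one.2 fun B hB B' hB' => ?_)).trans
    (one_nsmul _).le
  rw [Finset.mem_filter] at hB hB'
  by_contra hne
  exact Set.disjoint_left.1 (hdisj hB.1 hB'.1 hne) hB.2 hB'.2

theorem two_pi_pow_mul_wigner (hħ : 0 < ħ) (N : ℕ) (x ξ : Space d) :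
    ((2 * Real.pi * ħ : ℝ) : ℂ) ^ d * wigner d ħ N x ξ =
      2 ^ d * (wignerCoeff (√(2 / ħ)) N x ξ : ℂ) := by
  have := Real.pi_pos
  rw [wigner_eq hħ, ← Complex.ofReal_pow, ← Complex.ofReal_mul, ← mul_assoc, ← mul_pow]
  have : 2 * Real.pi * ħ * (Real.pi * ħ)⁻¹ = 2 := by
    field_simp
  rw [this]
  push_cast
  rfl

theorem wigner_eq_smul (hħ : 0 < ħ) (N : ℕ) (x ξ : Space d) :
    wigner d ħ N x ξ =
      (((Real.pi * ħ)⁻¹ ^ d : ℝ) : ℂ) * (wignerCoeff (√(2 / ħ)) N x ξ : ℂ) := by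
  rw [wigner_eq hħ, Complex.ofReal_mul]

theorem totalVariation_univ (hd : 1 ≤ d) (hħ : 0 < ħ) (x ξ : Space d) :
    totalVariation (empiricalMeasure d ħ x ξ) Set.univ = ⊤ := by
  rw [← top_le_iff]
  refine le_trans (top_le_iff.2 ?_) (tsum_enorm_wigner_le hħ)
  by_contra h
  have h1 : Summable fun N => wigner d ħ N x ξ :=
    (ENNReal.tsum_coe_ne_top_iff_summable.1 h).of_nnnorm
  refine not_summable_coeff_wignerGen hd (hasDiscSum_wignerCoeff (√(2 / ħ)) x ξ) ?_
  have h2 : (((Real.pi * ħ)⁻¹ ^ d : ℝ) : ℂ) ≠ 0 := by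
    have := Real.pi_pos
    exact_mod_cast (by positivity : (Real.pi * ħ)⁻¹ ^ d ≠ 0)
  simp only [wigner_eq_smul hħ] at h1
  exact (summable_mul_left_iff h2).1 h1

theorem cutoff_energy (χ : 𝓢(ℝ, ℂ)) (ε : ℝ) (N : ℕ) :
    χ (ε * energy d ħ N) = χ (ε * ħ * (N + (d : ℝ) / 2)) := by
  rw [energy, mul_assoc]

theorem summable_cutoff_mul_wigner (hħ : 0 < ħ) (x ξ : Space d) (χ : 𝓢(ℝ, ℂ)) {ε : ℝ}
    (hε : 0 < ε) : Summable fun N : ℕ => χ (ε * energy d ħ N) * wigner d ħ N x ξ := by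
  have h := summable_iterate_fwdDiff_mul (norm_coeff_wignerGen_le' (by positivity)
    (hasDiscSum_wignerCoeff (√(2 / ħ)) x ξ)) χ 0 (mul_pos hε hħ)
    (c₀ := (d : ℝ) / 2) (by positivity)
  simp only [Function.iterate_zero, id] at h
  simp only [cutoff_energy, wigner_eq_smul hħ, mul_left_comm (χ _)]
  exact h.mul_left _

/-- Since ε E_N = (εħ)(N + d/2), this is `CutoffSum` with step εħ and offset d/2. -/
theorem tendsto_cutoff_mul_wigner (hħ : 0 < ħ) (x ξ : Space d) (χ : 𝓢(ℝ, ℂ)) :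
    Tendsto (fun ε : ℝ => ((2 * Real.pi * ħ : ℝ) : ℂ) ^ d *
      ∑' N : ℕ, χ (ε * energy d ħ N) * wigner d ħ N x ξ) (𝓝[>] 0) (𝓝 (χ 0)) := by
  have h := cutoffSum_coeff_wignerGen (by positivity) (hasDiscSum_wignerCoeff (√(2 / ħ)) x ξ) χ
    ((d : ℝ) / 2) (by positivity)
  have hm : Tendsto (fun ε : ℝ => ε * ħ) (𝓝[>] 0) (𝓝[>] 0) := by
    refine tendsto_nhdsWithin_iff.2 ⟨?_, ?_⟩
    · have : Tendsto (fun ε : ℝ => ε * ħ) (𝓝 0) (𝓝 (0 * ħ)) := Continuous.tendsto (by fun_prop) 0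
      rw [zero_mul] at this
      exact this.mono_left nhdsWithin_le_nhds
    · filter_upwards [self_mem_nhdsWithin] with ε hε
      exact mul_pos hε hħ
  have h1 := (h.comp hm).const_mul (2 ^ d)
  rw [mul_left_comm, mul_inv_cancel₀ (pow_ne_zero d two_ne_zero), mul_one] at h1
  refine h1.congr fun ε => ?_
  simp only [Function.comp_apply]
  rw [← tsum_mul_left, ← tsum_mul_left]
  refine tsum_congr fun N => ?_
  rw [mul_left_comm, mul_left_comm (_ ^ d) (χ _), two_pi_pow_mul_wigner hħ, cutoff_energy]

theorem tendsto_empiricalMeasure_Iic (hħ : 0 < ħ) {x ξ : Space 1} (h : (x, ξ) ≠ (0, 0)) :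
    Tendsto (fun τ : ℝ => ((2 * Real.pi * ħ : ℝ) : ℂ) ^ 1 *
      empiricalMeasure 1 ħ x ξ (Set.Iic τ)) atTop (𝓝 1) := by
  have hs : 0 < √(2 / ħ) ^ 2 * (‖x‖ ^ 2 + ‖ξ‖ ^ 2) / 2 := by
    have : 0 < ‖x‖ ^ 2 + ‖ξ‖ ^ 2 := by
      rcases eq_or_ne x 0 with hx | hx
      · have hξ : ξ ≠ 0 := fun hξ => h (by rw [hx, hξ])
        have := norm_pos_iff.2 hξ
        positivity
      · have := norm_pos_iff.2 hx
        positivity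
    have : 0 < √(2 / ħ) := by positivity
    positivity
  have h1 := (tendsto_sum_coeff_wignerGen_one hs (hasDiscSum_wignerCoeff (√(2 / ħ)) x ξ)).const_mul 2
  have h2 : Tendsto (fun τ : ℝ => ⌊τ / ħ - (1 : ℕ) / 2⌋₊ + 1) atTop atTop :=
    (tendsto_add_atTop_nat 1).comp (tendsto_nat_floor_atTop.comp
      (tendsto_atTop_add_const_right _ _ (tendsto_id.atTop_div_const hħ)))
  rw [mul_one_div_cancel two_ne_zero] at h1
  refine (h1.comp h2).congr' ?_
  filter_upwards [eventually_ge_atTop (energy 1 ħ 0)] with τ hτ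
  rw [empiricalMeasure_eq_sum (finite_energy_le hħ τ), Function.comp_apply, Finset.mul_sum,
    Finset.mul_sum]
  refine Finset.sum_congr ?_ fun N _ => ?_
  · ext N
    exact Finset.mem_range.trans
      ((energy_le_iff hħ hτ N).symm.trans
        (Set.Finite.mem_toFinset (finite_energy_le hħ τ)).symm)
  · rw [two_pi_pow_mul_wigner hħ, pow_one]

theorem integrable_wigner_mul (hħ : 0 < ħ) (φ : 𝓢(Space d × Space d, ℂ)) (N : ℕ) :
    Integrable fun p : Space d × Space d => wigner d ħ N p.1 p.2 * φ p := by
  simp only [wigner_eq_smul hħ, mul_assoc]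
  refine Integrable.const_mul ?_ _
  exact φ.integrable.bdd_mul
    (Complex.continuous_ofReal.comp (continuous_wignerCoeff _ N)).aestronglyMeasurable
    (Eventually.of_forall fun p => norm_wignerCoeff_le _ N p.1 p.2)

theorem tendsto_sum_integral_wigner_mul (hd : 1 ≤ d) (hħ : 0 < ħ)
    (φ : 𝓢(Space d × Space d, ℂ)) :
    Tendsto (fun M : ℕ => ((2 * Real.pi * ħ : ℝ) : ℂ) ^ d *
      ∑ N ∈ Finset.range M, ∫ p : Space d × Space d, wigner d ħ N p.1 p.2 * φ p)
      atTop (𝓝 (∫ p : Space d × Space d, φ p)) := by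
  have h := (hasSum_wignerPairing hd (by positivity : 0 < √(2 / ħ)) φ).tendsto_sum_nat.const_mul
    (2 ^ d)
  rw [mul_inv_cancel_left₀ (pow_ne_zero d two_ne_zero)] at h
  refine h.congr fun M => ?_
  rw [Finset.mul_sum, Finset.mul_sum]
  refine Finset.sum_congr rfl fun N _ => ?_
  rw [wignerPairing, ← integral_const_mul, ← integral_const_mul]
  simp only [← mul_assoc, two_pi_pow_mul_wigner hħ]

theorem isContinuousKernel_projectionKernel (hħ : 0 < ħ) (N : ℕ) :
    IsContinuousKernel (spectralProjection d ħ N) (projectionKernel d ħ N) ∧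
      ∀ x : Space d, Integrable (fun v : Space d =>
        projectionKernel d ħ N (x + (1 / 2 : ℝ) • v) (x - (1 / 2 : ℝ) • v)) := by
  have hκ : 0 < √(2 / ħ) := by positivity
  have h2 : √(2 / ħ) ^ 2 * ħ = 2 := by
    rw [Real.sq_sqrt (by positivity)]
    field_simp
  rw [projectionKernel_eq hκ h2]
  exact ⟨isContinuousKernel_hermiteKernel hκ h2 N, integrable_hermiteKernel_shift hκ N⟩

end measure

end IsotropicOscillator

end

open IsotropicOscillator in
theorem proposition1p1 (d : ℕ) (hd : 1 ≤ d) (ħ : ℝ) (hħ : 0 < ħ) :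
    -- the projections have continuous kernels, and the integrals defining `W` converge
    (∀ N : ℕ, IsContinuousKernel (spectralProjection d ħ N) (projectionKernel d ħ N) ∧
      ∀ x : Space d, Integrable (fun v : Space d =>
        projectionKernel d ħ N (x + (1 / 2 : ℝ) • v) (x - (1 / 2 : ℝ) • v))) ∧
    (∀ x ξ : Space d,
      -- the measure is signed
      (∀ N : ℕ, (wigner d ħ N x ξ).im = 0) ∧
      -- infinite total variation, but finite on half-lines
      totalVariation (empiricalMeasure d ħ x ξ) Set.univ = ⊤ ∧
      (∀ τ : ℝ, totalVariation (empiricalMeasure d ħ x ξ) (Set.Iic τ) < ⊤) ∧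
      -- total integral, by means of arbitrary Schwartz cut-offs
      (∀ χ : 𝓢(ℝ, ℂ),
        (∀ ε : ℝ, 0 < ε → Summable (fun N : ℕ => χ (ε * energy d ħ N) * wigner d ħ N x ξ)) ∧
        Tendsto (fun ε : ℝ => ((2 * Real.pi * ħ : ℝ) : ℂ) ^ d *
            ∑' N : ℕ, χ (ε * energy d ħ N) * wigner d ħ N x ξ)
          (𝓝[>] 0) (𝓝 (χ 0))) ∧
      -- total integral as an improper integral, in dimension one off the origin
      (d = 1 → (x, ξ) ≠ (0, 0) →
        Tendsto (fun τ : ℝ => ((2 * Real.pi * ħ : ℝ) : ℂ) ^ d *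
            empiricalMeasure d ħ x ξ (Set.Iic τ)) atTop (𝓝 1))) ∧
    -- total integral in the sense of distributions on phase space
    (∀ φ : 𝓢(Space d × Space d, ℂ),
      (∀ N : ℕ, Integrable (fun p : Space d × Space d => wigner d ħ N p.1 p.2 * φ p)) ∧
      Tendsto (fun M : ℕ => ((2 * Real.pi * ħ : ℝ) : ℂ) ^ d *
          ∑ N ∈ Finset.range M, ∫ p : Space d × Space d, wigner d ħ N p.1 p.2 * φ p)
        atTop (𝓝 (∫ p : Space d × Space d, φ p))) := by
  refine ⟨isContinuousKernel_projectionKernel hħ, fun x ξ => ⟨fun N => ?_,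
    totalVariation_univ hd hħ x ξ, fun τ => ?_, fun χ =>
      ⟨fun ε hε => summable_cutoff_mul_wigner hħ x ξ χ hε, tendsto_cutoff_mul_wigner hħ x ξ χ⟩,
    ?_⟩, fun φ => ⟨integrable_wigner_mul hħ φ, tendsto_sum_integral_wigner_mul hd hħ φ⟩⟩
  · rw [wigner_eq hħ, Complex.ofReal_im]
  · exact (totalVariation_Iic_le hħ τ).trans_lt (ENNReal.sum_lt_top.2 fun N _ => enorm_lt_top)
  · rintro rfl hne
    exact tendsto_empiricalMeasure_Iic hħ hne
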